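/- **Setting.** Let $\mathfrak{gl}(1|1)[t]$ be the current Lie superalgebra with basis $e_{ij}[r]=e_{ij}\otimes t^r$ ($i,j\in\{1,2\}$, $r\ge 0$; $|1|=\bar 0$, $|2|=\bar 1$) and supercommutator $$[e_{ij}[r],e_{kl}[s]]=\delta_{jk}e_{il}[r+s]-(-1)^{(|i|+|j|)(|k|+|l|)}\delta_{il}e_{kj}[r+s],$$ and put $e_{ij}(x)=\sum_{r\ge0}e_{ij}[r]x^{-r-1}$. The *Gaudin transfer matrix* is $\mathscr H(x)=\frac12\sum_{a,b=1}^2(-1)^{|b|}e_{ab}(x)e_{ba}(x)$, and the *Bethe algebra* $\mathcal B\subset \mathrm U(\mathfrak{gl}(1|1)[t])$ is the unital subalgebra generated by the coefficients of $e_{11}(x)+e_{22}(x)$ and of $\mathscr H(x)$. It is commutative and commutes with $\mathfrak{gl}(1|1)=\mathfrak{gl}(1|1)\otimes 1$. Let $k\ge1$, let $b_1,\dots,b_k$ be distinct complex numbers, and let $\lambda^{(s)}=(\alpha_s,\beta_s)$, $1\le s\le k$, be non-degenerate polynomial $\mathfrak{gl}(1|1)$-weights, that is, $\alpha_s\in\mathbb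 Z_{>0}$, $\beta_s\in\mathbb Z_{\ge0}$. Put $n_s=\alpha_s+\beta_s$, $n=\sum_s n_s$. Let $L_{\lambda}$ be the irreducible $\mathfrak{gl}(1|1)$-module generated by an even vector $v$ with $e_{12}v=0$ and of weight $\lambda$, and let $L_\lambda(b)$ be the evaluation module, on which $e_{ij}[r]$ acts as $b^re_{ij}$. Fix $0\le l<k$ and let $$\mathcal M=\Big(\bigotimes_{s=1}^kL_{\lambda^{(s)}}(b_s)\Big)^{\rm sing}_{(\sum_s\alpha_s-l,\ \sum_s\beta_s+l)}$$ be the space of vectors killed by $e_{12}$ and of weight $(\sum_s\alpha_s-l,\sum_s\beta_s+l)$; this weight is $(n-l,l)$ when all $\beta_s=0$. Let $\mathcal B_{\mathcal M}$ be the image of $\mathcal B$ in $\mathrm{End}(\mathcal M)$. Set $$\zeta(x)=\sum_{s=1}^k\frac{n_s}{x-b_s},\qquad \varphi(x)=\zeta(x)\prod_{s=1}^k(x-b_s)=n\Big(x^{k-1}+\sum_{i=1}^{k-1}(-1)^i\varepsilon_ix^{k-1-i}\Big).$$ For a character $\chi:\mathcal B\to\mathbb C$ the eigenspace and generalized eigenspace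 of $\mathcal B$ in $\mathcal M$ associated to $\chi$ are $\bigcap_{X\in\mathcal B}\ker(X|_{\mathcal M}-\chi(X))$ and $\bigcap_{X\in\mathcal B}\bigcup_{m\ge1}\ker(X|_{\mathcal M}-\chi(X))^m$; an eigenspace is understood to be non-zero. **Theorem.** 1. $\mathcal B_{\mathcal M}$ is isomorphic, as an algebra, to $\mathbb C[w_1,\dots,w_{k-1}]^{\mathfrak S_l\times\mathfrak S_{k-l-1}}/\langle\sigma_i(\boldsymbol w)-\varepsilon_i\rangle_{i=1,\dots,k-1}$, where the $\sigma_i(\boldsymbol w)$ are the elementary symmetric polynomials in $w_1,\dots,w_{k-1}$, $\mathfrak S_l$ permutes the first $l$ variables and $\mathfrak S_{k-l-1}$ the others. 2. $\mathcal B_{\mathcal M}$ is a Frobenius algebra (finite-dimensional, commutative, with a non-degenerate symmetric bilinear form satisfying $(ab|c)=(a|bc)$), and the $\mathcal B_{\mathcal M}$-module $\mathcal M$ is isomorphic to the regular representation of $\mathcal B_{\mathcal M}$. 3. $\mathcal B_{\mathcal M}$ is a maximal commutative subalgebra of $\mathrm{End}(\mathcal M)$, and $\dim\mathcal B_{\mathcal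 M}=\binom{k-1}{l}$. 4. Every eigenspace of $\mathcal B$ in $\mathcal M$ has dimension one. 5. The eigenspaces of $\mathcal B$ in $\mathcal M$ are in bijection with the monic divisors $y$ of $\varphi$ of degree $l$; on the eigenspace that corresponds to $y$ the series $\mathscr H(x)$ acts by the expansion in powers of $x^{-1}$ of $$\mathcal E_y(x)=\tfrac12\zeta'(x)-\zeta(x)\frac{y'(x)}{y(x)}+\sum_{r,s=1}^k\frac{\alpha_r\alpha_s-\beta_r\beta_s}{2(x-b_r)(x-b_s)}.$$ 6. Every generalized eigenspace of $\mathcal B$ in $\mathcal M$ is a cyclic $\mathcal B$-module. 7. The generalized eigenspace associated to the same character of $\mathcal B$ as the eigenspace of $y$ has dimension $\prod_{a\in\mathbb C}\binom{\mathrm{Mult}_a(\varphi)}{\mathrm{Mult}_a(y)}$, where $\mathrm{Mult}_a(p)$ is the multiplicity of $a$ as a root of $p$. -/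

import Mathlib

open scoped TensorProduct

noncomputable section

namespace Gaudin

/-! ### The current superalgebra of gl(1|1)

The indices `1, 2` are the elements `0, 1` of `Fin 2`, and the parity of `i : Fin 2` is `i` itself,
so `e_{ij}` has parity `i + j` (mod 2). -/

/-- The sign `(-1)^{(|i|+|j|)(|k|+|l|)}`. -/
def sgn (i j k l : Fin 2) : ℂ := (-1) ^ ((i.val + j.val) * (k.val + l.val))

/-- The Kronecker delta. -/
def delta (i j : Fin 2) : ℂ := if i = j then 1 else 0

/-- The free generator `e_{ij}[r] = e_{ij} ⊗ t^r`. -/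
def gen (i j : Fin 2) (r : ℕ) : FreeAlgebra ℂ (Fin 2 × Fin 2 × ℕ) := FreeAlgebra.ι ℂ (i, j, r)

/-- The supercommutator relations of `gl(1|1)[t]`. -/
inductive Rel : FreeAlgebra ℂ (Fin 2 × Fin 2 × ℕ) → FreeAlgebra ℂ (Fin 2 × Fin 2 × ℕ) → Prop
  | bracket (i j k l : Fin 2) (r s : ℕ) :
      Rel (gen i j r * gen k l s - sgn i j k l • (gen k l s * gen i j r))
        (delta j k • gen i l (r + s) - (sgn i j k l * delta i l) • gen k j (r + s))

/-- The universal enveloping superalgebra `U(gl(1|1)[t])`. -/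
abbrev U : Type := RingQuot Rel

/-- The element `e_{ij}[r]` of `U(gl(1|1)[t])`. -/
def e (i j : Fin 2) (r : ℕ) : U := RingQuot.mkAlgHom ℂ Rel (gen i j r)

theorem e_bracket (i j k l : Fin 2) (r s : ℕ) :
    e i j r * e k l s - sgn i j k l • (e k l s * e i j r) =
      delta j k • e i l (r + s) - (sgn i j k l * delta i l) • e k j (r + s) := by
  have h := RingQuot.mkAlgHom_rel ℂ (Rel.bracket i j k l r s)
  simp only [map_sub, map_mul, map_smul] at h
  exact h

/-! ### The Bethe algebra

Series in `x⁻¹` are power series whose variable stands for `x⁻¹`; so `PowerSeries.coeff r`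
is the coefficient of `x^{-r}`. -/

/-- The generating series `e_{ij}(x) = ∑_{r ≥ 0} e_{ij}[r] x^{-r-1}`. -/
def eSer (i j : Fin 2) : PowerSeries U := PowerSeries.X * PowerSeries.mk (e i j)

/-- The series `e_{11}(x) + e_{22}(x)`. -/
def centralSer : PowerSeries U := eSer 0 0 + eSer 1 1

/-- The Gaudin transfer matrix `H(x) = 1/2 ∑_{a,b} (-1)^{|b|} e_{ab}(x) e_{ba}(x)`. -/
def transferSer : PowerSeries U :=
  (1 / 2 : ℂ) • ∑ a : Fin 2, ∑ c : Fin 2, ((-1 : ℂ) ^ c.val) • (eSer a c * eSer c a)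

/-- The Bethe algebra, generated by the coefficients of `e_{11}(x) + e_{22}(x)` and `H(x)`. -/
def betheAlgebra : Subalgebra ℂ U :=
  Algebra.adjoin ℂ (Set.range (fun r : ℕ => PowerSeries.coeff r centralSer) ∪
    Set.range (fun r : ℕ => PowerSeries.coeff r transferSer))

/-- The coefficient of `x^{-r}` in `H(x)`, as an element of the Bethe algebra. -/
def transferCoeff (r : ℕ) : betheAlgebra :=
  ⟨PowerSeries.coeff r transferSer, Algebra.subset_adjoin (Or.inr ⟨r, rfl⟩)⟩

theorem eSer_bracket (i j k l : Fin 2) (m : ℕ) :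
    PowerSeries.coeff m (eSer i j) * e k l 0 =
      sgn i j k l • (e k l 0 * PowerSeries.coeff m (eSer i j)) +
      (delta j k • PowerSeries.coeff m (eSer i l)
        - (sgn i j k l * delta i l) • PowerSeries.coeff m (eSer k j)) := by
  cases m with
  | zero => simp [eSer]
  | succ m =>
    have h := e_bracket i j k l m 0
    simp only [eSer, PowerSeries.coeff_succ_X_mul, PowerSeries.coeff_mk]
    rw [sub_eq_iff_eq_add] at h
    rw [h, add_comm]
    rfl

theorem betheAlgebra_commute {X : U} (hX : X ∈ betheAlgebra) (k l : Fin 2) :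
    Commute X (e k l 0) := by
  have hle : betheAlgebra ≤ Subalgebra.centralizer ℂ {e k l 0} := by
    refine Algebra.adjoin_le ?_
    rintro _ (⟨r, rfl⟩ | ⟨r, rfl⟩)
    · rw [SetLike.mem_coe, Subalgebra.mem_centralizer_iff]
      rintro _ rfl
      simp only [centralSer, map_add, add_mul, mul_add, eSer_bracket]
      fin_cases k <;> fin_cases l <;> norm_num [sgn, delta] <;> abel
    · rw [SetLike.mem_coe, Subalgebra.mem_centralizer_iff]
      rintro _ rfl
      have hs : ∀ (c : ℂ) (f : PowerSeries U),
          PowerSeries.coeff r (c • f) = c • PowerSeries.coeff r f := fun _ _ => rfl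
      have hterm : ∀ p q : ℕ, Commute (∑ a : Fin 2, ∑ c : Fin 2, ((-1 : ℂ) ^ c.val) •
          (PowerSeries.coeff p (eSer a c) * PowerSeries.coeff q (eSer c a))) (e k l 0) := by
        intro p q
        simp only [Commute, SemiconjBy, Fin.sum_univ_two, add_mul, smul_mul_assoc, mul_assoc,
          eSer_bracket, mul_add, mul_sub, mul_smul_comm]
        simp only [← mul_assoc, eSer_bracket, add_mul, sub_mul, smul_mul_assoc]
        fin_cases k <;> fin_cases l <;> norm_num [sgn, delta, mul_assoc] <;> module
      have hsum : PowerSeries.coeff r transferSer = (1 / 2 : ℂ) •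
          ∑ x ∈ Finset.HasAntidiagonal.antidiagonal r, ∑ a : Fin 2, ∑ c : Fin 2, ((-1 : ℂ) ^ c.val) •
            (PowerSeries.coeff x.1 (eSer a c) * PowerSeries.coeff x.2 (eSer c a)) := by
        rw [transferSer, hs]
        simp only [Fin.sum_univ_two, map_add, hs, PowerSeries.coeff_mul, Finset.smul_sum,
          ← Finset.sum_add_distrib]
      change _ * PowerSeries.coeff r transferSer = PowerSeries.coeff r transferSer * _
      rw [hsum]
      exact ((Commute.sum_left _ _ _ fun x _ => hterm x.1 x.2).smul_left _).symm
  have := (Subalgebra.mem_centralizer_iff ℂ).1 (hle hX) _ rfl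
  exact this.symm

/-! ### Tensor products of evaluation modules -/

/-- For a non-degenerate weight `(α, β)` (that is, `α + β ≠ 0`), the action of `e_{ij}` on the
irreducible module `L_{(α,β)}` in the basis `v, e_{21} v`, where `v` is the even
singular vector of weight `(α, β)`. -/
def irr (α β : ℂ) (i j : Fin 2) : Module.End ℂ (Fin 2 → ℂ) :=
  Matrix.toLin' (match i, j with
    | 0, 0 => !![α, 0; 0, α - 1]
    | 0, 1 => !![0, α + β; 0, 0]
    | 1, 0 => !![0, 0; 1, 0]
    | 1, 1 => !![β, 0; 0, β + 1])

/-- The parity operator: `v` is even and `e_{21} v` is odd. -/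
def par : Module.End ℂ (Fin 2 → ℂ) := Matrix.toLin' !![1, 0; 0, -1]

theorem irr_bracket (α β : ℂ) (i j k l : Fin 2) :
    irr α β i j * irr α β k l - sgn i j k l • (irr α β k l * irr α β i j) =
      delta j k • irr α β i l - (sgn i j k l * delta i l) • irr α β k j := by
  simp only [irr, Module.End.mul_eq_comp, ← Matrix.toLin'_mul, ← map_smul, ← map_sub]
  congr 1
  fin_cases i <;> fin_cases j <;> fin_cases k <;> fin_cases l <;>
    ext a c <;> fin_cases a <;> fin_cases c <;>
    simp [sgn, delta] <;> ring

theorem irr_irreducible (α β : ℂ) (h : α + β ≠ 0) (W : Submodule ℂ (Fin 2 → ℂ))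
    (hW : ∀ i j, ∀ v ∈ W, irr α β i j v ∈ W) : W = ⊥ ∨ W = ⊤ := by
  by_cases h0 : W = ⊥
  · exact Or.inl h0
  obtain ⟨v, hv, hv0⟩ := Submodule.exists_mem_ne_zero_of_ne_bot h0
  have key : ∀ u ∈ W, u 0 ≠ 0 → W = ⊤ := by
    intro u hu hu0
    have h1 : (![0, 1] : Fin 2 → ℂ) ∈ W := by
      have := W.smul_mem (u 0)⁻¹ (hW 1 0 u hu)
      convert this using 1
      ext i; fin_cases i <;> simp [irr, Matrix.toLin'_apply, Matrix.vecHead, hu0]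
    have h2 : (![1, 0] : Fin 2 → ℂ) ∈ W := by
      have := W.smul_mem (α + β)⁻¹ (hW 0 1 _ h1)
      convert this using 1
      ext i; fin_cases i <;> simp [irr, Matrix.toLin'_apply, h]
    refine eq_top_iff.2 fun w _ => ?_
    have := W.add_mem (W.smul_mem (w 0) h2) (W.smul_mem (w 1) h1)
    convert this using 1
    ext i; fin_cases i <;> simp
  right
  by_cases hv1 : v 0 = 0
  · have hv2 : v 1 ≠ 0 := fun h2 => hv0 (by ext i; fin_cases i <;> simp [hv1, h2])
    refine key _ (hW 0 1 v hv) ?_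
    simp [irr, Matrix.toLin'_apply, Matrix.vecHead, Matrix.vecTail, h, hv2]
  · exact key v hv hv1

/-- The underlying space of `L_{λ^{(1)}} ⊗ ⋯ ⊗ L_{λ^{(k)}}`. -/
def TensorSpace (k : ℕ) : Type := ⨂[ℂ] _ : Fin k, (Fin 2 → ℂ)

instance (k : ℕ) : AddCommGroup (TensorSpace k) :=
  inferInstanceAs (AddCommGroup (⨂[ℂ] _ : Fin k, (Fin 2 → ℂ)))

instance (k : ℕ) : Module ℂ (TensorSpace k) :=
  inferInstanceAs (Module ℂ (⨂[ℂ] _ : Fin k, (Fin 2 → ℂ)))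

/-- The operator `A_1 ⊗ ⋯ ⊗ A_k`. -/
def tmap {k : ℕ} (A : Fin k → Module.End ℂ (Fin 2 → ℂ)) : Module.End ℂ (TensorSpace k) :=
  (PiTensorProduct.map A : (⨂[ℂ] _ : Fin k, (Fin 2 → ℂ)) →ₗ[ℂ] ⨂[ℂ] _ : Fin k, (Fin 2 → ℂ))

theorem tmap_mul {k : ℕ} (A B : Fin k → Module.End ℂ (Fin 2 → ℂ)) :
    tmap (fun u => A u * B u) = tmap A * tmap B :=
  PiTensorProduct.map_mul A B

theorem tmap_update_add {k : ℕ} (A : Fin k → Module.End ℂ (Fin 2 → ℂ)) (s : Fin k)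
    (C D : Module.End ℂ (Fin 2 → ℂ)) :
    tmap (Function.update A s (C + D)) =
      tmap (Function.update A s C) + tmap (Function.update A s D) :=
  PiTensorProduct.map_update_add A s C D

theorem tmap_update_smul {k : ℕ} (A : Fin k → Module.End ℂ (Fin 2 → ℂ)) (s : Fin k)
    (c : ℂ) (C : Module.End ℂ (Fin 2 → ℂ)) :
    tmap (Function.update A s (c • C)) = c • tmap (Function.update A s C) :=
  PiTensorProduct.map_update_smul A s c C

/-- The operator `A` of parity `d` acting on the `s`-th tensor factor, with the sign rule
`w_1 ⊗ ⋯ ⊗ w_k ↦ (-1)^{(|w_1| + ⋯ + |w_{s-1}|) d} w_1 ⊗ ⋯ ⊗ A w_s ⊗ ⋯ ⊗ w_k`. -/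
def siteOp {k : ℕ} (d : ℕ) (s : Fin k) (A : Module.End ℂ (Fin 2 → ℂ)) :
    Module.End ℂ (TensorSpace k) :=
  tmap (fun u => if u < s then par ^ d else if u = s then A else 1)

/-- The action of `e_{ij}[r]` on `L_{λ^{(1)}}(b_1) ⊗ ⋯ ⊗ L_{λ^{(k)}}(b_k)`,
where `λ^{(s)} = (α_s, β_s)`: on the evaluation module at `b_s`, `e_{ij}[r]` acts as
`b_s^r e_{ij}`. -/
def tensorOp {k : ℕ} (α β : Fin k → ℕ) (b : Fin k → ℂ) (i j : Fin 2) (r : ℕ) :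
    Module.End ℂ (TensorSpace k) :=
  ∑ s : Fin k, (b s) ^ r • siteOp (i.val + j.val) s (irr (α s) (β s) i j)

theorem par_mul_par : par * par = 1 := by
  rw [par, Module.End.mul_eq_comp, ← Matrix.toLin'_mul, Module.End.one_eq_id, ← Matrix.toLin'_one]
  congr 1
  ext a c
  fin_cases a <;> fin_cases c <;> simp

theorem irr_mul_par (α β : ℂ) (i j : Fin 2) :
    irr α β i j * par = ((-1 : ℂ) ^ (i.val + j.val)) • (par * irr α β i j) := by
  simp only [irr, par, Module.End.mul_eq_comp, ← Matrix.toLin'_mul, ← map_smul]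
  congr 1
  fin_cases i <;> fin_cases j <;> ext a c <;> fin_cases a <;> fin_cases c <;> simp

theorem irr_mul_par_pow (α β : ℂ) (i j : Fin 2) (d : ℕ) :
    irr α β i j * par ^ d = ((-1 : ℂ) ^ ((i.val + j.val) * d)) • (par ^ d * irr α β i j) := by
  induction d with
  | zero => simp
  | succ d ih =>
    rw [pow_succ, ← mul_assoc, ih, smul_mul_assoc, mul_assoc, irr_mul_par, mul_smul_comm, smul_smul,
      mul_assoc, ← pow_add]
    rfl

theorem par_pow_mod (d : ℕ) : par ^ d = par ^ (d % 2) := by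
  conv_lhs => rw [← Nat.mod_add_div d 2, pow_add, pow_mul, pow_two, par_mul_par, one_pow, mul_one]

theorem siteOp_mod {k : ℕ} (d : ℕ) (s : Fin k) (A : Module.End ℂ (Fin 2 → ℂ)) :
    siteOp d s A = siteOp (d % 2) s A := by
  rw [siteOp, siteOp, par_pow_mod]

theorem siteOp_eq_update {k : ℕ} (d : ℕ) (s : Fin k) (A : Module.End ℂ (Fin 2 → ℂ)) :
    siteOp d s A = tmap
      (Function.update (fun u : Fin k => if u < s then par ^ d else 1) s A) := by
  rw [siteOp]
  congr 1
  funext u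
  by_cases h : u = s
  · subst h; simp
  · simp [h]

theorem siteOp_add {k : ℕ} (d : ℕ) (s : Fin k) (A B : Module.End ℂ (Fin 2 → ℂ)) :
    siteOp d s (A + B) = siteOp d s A + siteOp d s B := by
  simp only [siteOp_eq_update, tmap_update_add]

theorem siteOp_smul {k : ℕ} (d : ℕ) (s : Fin k) (c : ℂ) (A : Module.End ℂ (Fin 2 → ℂ)) :
    siteOp d s (c • A) = c • siteOp d s A := by
  simp only [siteOp_eq_update, tmap_update_smul]

theorem siteOp_sub {k : ℕ} (d : ℕ) (s : Fin k) (A B : Module.End ℂ (Fin 2 → ℂ)) :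
    siteOp d s (A - B) = siteOp d s A - siteOp d s B := by
  rw [eq_sub_iff_add_eq, ← siteOp_add, sub_add_cancel]

theorem siteOp_mul_same {k : ℕ} (d d' : ℕ) (s : Fin k) (A B : Module.End ℂ (Fin 2 → ℂ)) :
    siteOp d s A * siteOp d' s B = siteOp (d + d') s (A * B) := by
  rw [siteOp, siteOp, siteOp, ← tmap_mul]
  congr 1
  funext u
  rcases lt_trichotomy u s with h | h | h
  · simp [h, pow_add]
  · subst h; simp
  · simp [h.not_gt, h.ne']

theorem siteOp_mul_lt {k : ℕ} (d d' : ℕ) {s t : Fin k} (hst : s < t)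
    (A B : Module.End ℂ (Fin 2 → ℂ)) (c : ℂ) (hA : A * par ^ d' = c • (par ^ d' * A)) :
    siteOp d s A * siteOp d' t B = c • (siteOp d' t B * siteOp d s A) := by
  have key : ∀ C : Module.End ℂ (Fin 2 → ℂ), tmap
      (Function.update (fun u : Fin k => (if u < s then par ^ d else if u = s then A else 1) *
        (if u < t then par ^ d' else if u = t then B else 1)) s C) =
      tmap
      (Function.update (fun u : Fin k => (if u < t then par ^ d' else if u = t then B else 1) *
        (if u < s then par ^ d else if u = s then A else 1)) s C) := by
    intro C
    congr 1
    funext u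
    by_cases h : u = s
    · subst h; simp
    · rw [Function.update_of_ne h, Function.update_of_ne h]
      by_cases h1 : u < s
      · simp [h1, h1.trans hst, ← pow_add, add_comm]
      · simp [h1, h]
  have h1 := key (c • (par ^ d' * A))
  rw [siteOp, siteOp, ← tmap_mul, ← tmap_mul]
  rw [Function.update_eq_self_iff.2 (by simp [hst, hA])] at h1
  rw [h1, tmap_update_smul, Function.update_eq_self_iff.2 (by simp [hst])]

theorem sgn_comm (i j k l : Fin 2) : sgn i j k l = sgn k l i j := by
  rw [sgn, sgn, mul_comm]

theorem sgn_mul_self (i j k l : Fin 2) : sgn i j k l * sgn i j k l = 1 := by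
  rw [sgn, ← mul_pow]; norm_num

theorem siteOp_irr_ne {k : ℕ} (α β α' β' : ℂ) (i j m l : Fin 2) {s t : Fin k} (hst : s ≠ t) :
    siteOp (i.val + j.val) s (irr α β i j) * siteOp (m.val + l.val) t (irr α' β' m l) =
      sgn i j m l • (siteOp (m.val + l.val) t (irr α' β' m l) *
        siteOp (i.val + j.val) s (irr α β i j)) := by
  rcases lt_or_gt_of_ne hst with h | h
  · exact siteOp_mul_lt _ _ h _ _ _ (irr_mul_par_pow _ _ _ _ _)
  · rw [siteOp_mul_lt _ _ h (irr α' β' m l) _ _ (irr_mul_par_pow _ _ _ _ _), smul_smul]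
    have : ((-1 : ℂ) ^ ((m.val + l.val) * (i.val + j.val))) = sgn i j m l := by
      rw [sgn, mul_comm]
    rw [this, sgn_mul_self, one_smul]

theorem siteOp_irr_same {k : ℕ} (α β : ℂ) (i j m l : Fin 2) (s : Fin k) :
    siteOp (i.val + j.val) s (irr α β i j) * siteOp (m.val + l.val) s (irr α β m l) -
      sgn i j m l • (siteOp (m.val + l.val) s (irr α β m l) *
        siteOp (i.val + j.val) s (irr α β i j)) =
      delta j m • siteOp (i.val + l.val) s (irr α β i l) -
        (sgn i j m l * delta i l) • siteOp (m.val + j.val) s (irr α β m j) := by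
  rw [siteOp_mul_same, siteOp_mul_same, add_comm (m.val + l.val) (i.val + j.val), ← siteOp_smul,
    ← siteOp_sub, irr_bracket, siteOp_sub, siteOp_smul, siteOp_smul]
  congr 1
  · by_cases h : j = m
    · subst h
      rw [siteOp_mod, siteOp_mod (i.val + l.val)]
      congr 2; omega
    · simp [delta, h]
  · by_cases h : i = l
    · subst h
      rw [siteOp_mod, siteOp_mod (m.val + j.val)]
      congr 2; omega
    · simp [delta, h]

theorem tensorOp_bracket {k : ℕ} (α β : Fin k → ℕ) (b : Fin k → ℂ) (i j m l : Fin 2) (p q : ℕ) :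
    tensorOp α β b i j p * tensorOp α β b m l q -
      sgn i j m l • (tensorOp α β b m l q * tensorOp α β b i j p) =
      delta j m • tensorOp α β b i l (p + q) -
        (sgn i j m l * delta i l) • tensorOp α β b m j (p + q) := by
  simp only [tensorOp]
  rw [Finset.sum_mul_sum, Finset.sum_mul_sum, Finset.sum_comm (s := Finset.univ) (t := Finset.univ)
    (f := fun x y => (b x ^ q • siteOp (m.val + l.val) x (irr (α x) (β x) m l)) *
      (b y ^ p • siteOp (i.val + j.val) y (irr (α y) (β y) i j)))]
  rw [Finset.smul_sum, Finset.smul_sum, Finset.smul_sum, ← Finset.sum_sub_distrib,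
    ← Finset.sum_sub_distrib]
  refine Finset.sum_congr rfl fun s _ => ?_
  rw [Finset.smul_sum, ← Finset.sum_sub_distrib, Finset.sum_eq_single s]
  · have h := congrArg (fun T => (b s ^ (p + q)) • T)
      (siteOp_irr_same (α s : ℂ) (β s) i j m l s)
    simp only [smul_sub, smul_smul] at h
    simp only [smul_mul_assoc, mul_smul_comm, smul_smul]
    rw [pow_add] at h ⊢
    convert h using 3 <;> ring
  · intro t _ hts
    simp only [smul_mul_assoc, mul_smul_comm, smul_smul]
    rw [siteOp_irr_ne _ _ _ _ i j m l (Ne.symm hts), smul_smul, sub_eq_zero]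
    congr 1
    ring
  · simp

/-- The `gl(1|1)[t]`-module `L_{λ^{(1)}}(b_1) ⊗ ⋯ ⊗ L_{λ^{(k)}}(b_k)`, as a
representation of `U(gl(1|1)[t])`. -/
def tensorRep {k : ℕ} (α β : Fin k → ℕ) (b : Fin k → ℂ) :
    U →ₐ[ℂ] Module.End ℂ (TensorSpace k) :=
  RingQuot.liftAlgHom ℂ ⟨FreeAlgebra.lift ℂ (fun x => tensorOp α β b x.1 x.2.1 x.2.2), by
    rintro _ _ ⟨i, j, m, l, p, q⟩
    simpa only [gen, map_sub, map_mul, map_smul, FreeAlgebra.lift_ι_apply] using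
      tensorOp_bracket α β b i j m l p q⟩

theorem tensorRep_e {k : ℕ} (α β : Fin k → ℕ) (b : Fin k → ℂ) (i j : Fin 2) (r : ℕ) :
    tensorRep α β b (e i j r) = tensorOp α β b i j r := by
  rw [tensorRep, e, RingQuot.liftAlgHom_mkAlgHom_apply, gen, FreeAlgebra.lift_ι_apply]

/-- The space of singular vectors of weight `(μ₁, μ₂)` in `⨂ L_{λ^{(s)}}(b_s)`. -/
def singWeightSpace {k : ℕ} (α β : Fin k → ℕ) (b : Fin k → ℂ) (μ₁ μ₂ : ℂ) :
    Submodule ℂ (TensorSpace k) :=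
  LinearMap.ker (tensorRep α β b (e 0 1 0)) ⊓
    (Module.End.eigenspace (tensorRep α β b (e 0 0 0)) μ₁ ⊓
      Module.End.eigenspace (tensorRep α β b (e 1 1 0)) μ₂)

theorem bethe_mapsTo {k : ℕ} (α β : Fin k → ℕ) (b : Fin k → ℂ) (μ₁ μ₂ : ℂ) {X : U}
    (hX : X ∈ betheAlgebra) (v : TensorSpace k) (hv : v ∈ singWeightSpace α β b μ₁ μ₂) :
    tensorRep α β b X v ∈ singWeightSpace α β b μ₁ μ₂ := by
  have hc : ∀ i j : Fin 2, tensorRep α β b (e i j 0) (tensorRep α β b X v) =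
      tensorRep α β b X (tensorRep α β b (e i j 0) v) := fun i j => by
    rw [← Module.End.mul_apply, ← Module.End.mul_apply, ← map_mul, ← map_mul,
      (betheAlgebra_commute hX i j).eq]
  simp only [singWeightSpace, Submodule.mem_inf, LinearMap.mem_ker,
    Module.End.mem_eigenspace_iff] at hv ⊢
  obtain ⟨h1, h2, h3⟩ := hv
  simp [hc, h1, h2, h3]

/-- The weight `(∑ α_s - l, ∑ β_s + l)` singular space. When all `β_s = 0` this weight is
`(n - l, l)`, with `n = ∑ (α_s + β_s)`. -/
abbrev M {k : ℕ} (α β : Fin k → ℕ) (b : Fin k → ℂ) (l : ℕ) : Submodule ℂ (TensorSpace k) :=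
  singWeightSpace α β b ((∑ s, (α s : ℂ)) - l) ((∑ s, (β s : ℂ)) + l)

/-- The action of the Bethe algebra on `M α β b l`. -/
def betheAct {k : ℕ} (α β : Fin k → ℕ) (b : Fin k → ℂ) (l : ℕ) :
    betheAlgebra →ₐ[ℂ] Module.End ℂ (M α β b l) where
  toFun X := (tensorRep α β b X).restrict (bethe_mapsTo α β b _ _ X.2)
  map_one' := by ext v; simp
  map_mul' X Y := by ext v; simp
  map_zero' := by ext v; simp
  map_add' X Y := by ext v; simp
  commutes' c := by ext v; simp [Module.algebraMap_end_apply]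

/-- The Bethe algebra associated with `M α β b l`: the image of the Bethe algebra in
`End (M α β b l)`. -/
abbrev betheImage {k : ℕ} (α β : Fin k → ℕ) (b : Fin k → ℂ) (l : ℕ) :
    Subalgebra ℂ (Module.End ℂ (M α β b l)) :=
  (betheAct α β b l).range

/-- The eigenspace of the Bethe algebra in `M α β b l` associated to the character `χ`. -/
def eigenspace {k : ℕ} (α β : Fin k → ℕ) (b : Fin k → ℂ) (l : ℕ) (χ : betheAlgebra →ₐ[ℂ] ℂ) :
    Submodule ℂ (M α β b l) :=
  ⨅ X : betheAlgebra, Module.End.eigenspace (betheAct α β b l X) (χ X)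

/-- The generalized eigenspace of the Bethe algebra in `M α β b l` associated to `χ`. -/
def genEigenspace {k : ℕ} (α β : Fin k → ℕ) (b : Fin k → ℂ) (l : ℕ) (χ : betheAlgebra →ₐ[ℂ] ℂ) :
    Submodule ℂ (M α β b l) :=
  ⨅ X : betheAlgebra, Module.End.maxGenEigenspace (betheAct α β b l X) (χ X)

/-! ### The polynomial `φ`, the eigenvalues and the algebra of invariants -/

/-- `φ(x) = ∏_s (x - b_s) ∑_s (α_s + β_s) / (x - b_s)`, as a polynomial. -/
def phi {k : ℕ} (α β : Fin k → ℕ) (b : Fin k → ℂ) : Polynomial ℂ :=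
  ∑ s : Fin k, Polynomial.C ((α s : ℂ) + β s) *
    ∏ r ∈ Finset.univ.erase s, (Polynomial.X - Polynomial.C (b r))

/-- The variable `x`, as an element of the field of Laurent series in `x⁻¹`. The coefficient
of `x^{-r}` in a series is its `r`-th coefficient. -/
def xVar : LaurentSeries ℂ := HahnSeries.single (-1) 1

/-- The function `1 / (x - c)` as a series in `x⁻¹`. -/
def pole (c : ℂ) : LaurentSeries ℂ := (xVar - HahnSeries.C c)⁻¹

/-- `ζ(x) = ∑_s (α_s + β_s) / (x - b_s)`. -/
def zeta {k : ℕ} (α β : Fin k → ℕ) (b : Fin k → ℂ) : LaurentSeries ℂ :=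
  ∑ s : Fin k, HahnSeries.C ((α s : ℂ) + β s) * pole (b s)

/-- The derivative `ζ'(x) = - ∑_s (α_s + β_s) / (x - b_s)^2`. -/
def zetaDeriv {k : ℕ} (α β : Fin k → ℕ) (b : Fin k → ℂ) : LaurentSeries ℂ :=
  -∑ s : Fin k, HahnSeries.C ((α s : ℂ) + β s) * pole (b s) ^ 2

/-- The eigenvalue `ζ'(x)/2 - ζ(x) y'(x)/y(x) +
∑_{r,s} (α_r α_s - β_r β_s) / (2 (x - b_r) (x - b_s))`, expanded in `x⁻¹`. -/
def eigenvalueSer {k : ℕ} (α β : Fin k → ℕ) (b : Fin k → ℂ) (y : Polynomial ℂ) :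
    LaurentSeries ℂ :=
  HahnSeries.C (1 / 2 : ℂ) * zetaDeriv α β b
    - zeta α β b * (Polynomial.eval₂ HahnSeries.C xVar (Polynomial.derivative y) /
        Polynomial.eval₂ HahnSeries.C xVar y)
    + ∑ r : Fin k, ∑ s : Fin k,
        HahnSeries.C (((α r : ℂ) * α s - β r * β s) / 2) * (pole (b r) * pole (b s))

/-- The algebra `ℂ[w_1, …, w_m]^{S_l × S_{m-l}}`, where `S_l` permutes the first `l` variables
and `S_{m-l}` the remaining ones. -/
def invariants (m l : ℕ) : Subalgebra ℂ (MvPolynomial (Fin m) ℂ) where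
  carrier := {p | ∀ σ : Equiv.Perm (Fin m), (∀ i : Fin m, (σ i).val < l ↔ i.val < l) →
    MvPolynomial.rename σ p = p}
  mul_mem' hp hq σ hσ := by rw [map_mul, hp σ hσ, hq σ hσ]
  add_mem' hp hq σ hσ := by rw [map_add, hp σ hσ, hq σ hσ]
  algebraMap_mem' c σ _ := AlgHom.commutes _ c

/-- The ideal of `ℂ[w_1, …, w_m]^{S_l × S_{m-l}}` generated by `σ_i(w) - ε_i`, `i = 1, …, m`. -/
def symmIdeal (m l : ℕ) (ε : ℕ → ℂ) : Ideal (invariants m l) :=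
  Ideal.span {q | ∃ i ∈ Finset.Icc 1 m,
    (q : MvPolynomial (Fin m) ℂ) = MvPolynomial.esymm (Fin m) ℂ i - MvPolynomial.C (ε i)}

/-- A Frobenius algebra: a finite-dimensional commutative algebra with a non-degenerate invariant
symmetric bilinear form. -/
def IsFrobenius (A : Type*) [Ring A] [Algebra ℂ A] : Prop :=
  (∀ a c : A, a * c = c * a) ∧ FiniteDimensional ℂ A ∧
    ∃ B : LinearMap.BilinForm ℂ A, B.IsSymm ∧ B.Nondegenerate ∧
      ∀ a c d : A, B (a * c) d = B a (c * d)

end Gaudin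

end

open scoped TensorProduct

noncomputable section

namespace Gaudin

/-! ### Fermionic operators on the tensor space -/

/-! Each tensor factor is two-dimensional, so the tensor product is a fermionic Fock space over
`ℂ^k`. With the Jordan–Wigner signs, `create` and `annihilate` satisfy the canonical anticommutation
relations. Then `e 1 0 r` acts as `createVec (b ^ r)`, `e 0 1 r` as `annihilateVec (boxes α β * b ^
r)`, and `e 0 0 r`, `e 1 1 r` as scalars minus and plus the same operator `modeOp (b ^ r)`. In the
transfer matrix the quartic terms cancel. What remains is a scalar minus `hopOp`, which acts on
exterior products as the derivation induced by a one-particle operator `hopVec`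
(`tensorRep_transfer`, `hopOp_word`). The singular vectors with `l` particles form the `l`-th
exterior power of the hyperplane `∑ n_s f_s = 0` (`mem_M_iff`, `M_eq_span`).

Taking the numerator of `∑ n_s f_s / (x - b_s)` identifies this hyperplane with `ℂ[x]/φ`, and
`hopVec` becomes multiplication by `∑_{p+q=r} ζ_p x^q` (`hopVec_ofPoly`). So `M` is `Λ^l(ℂ[x]/φ)`,
the quotient of `ℂ[z_1, …, z_l]` by antisymmetry and the multiples of `φ(z_i)`
(`isWedgeQuotient_singVec`). The transfer coefficients act through power sums, and `ζ_0 = n ≠ 0`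
allows all power sums to be recovered from them; the image of the Bethe algebra is therefore that of
the symmetric polynomials (`range_betheAct`).

The rest concerns symmetric polynomials on this exterior power. The staircase monomial is cyclic
(`exists_symmetric_mul_staircase`); this gives the regular representation and maximality. For the
Frobenius form, put `l' = k - 1 - l` and let a top form on `Λ^{l+l'}` pair `Λ^l` with `Λ^{l'}`
perfectly. Symmetric polynomials in all variables act there by scalars, so those in the last `l'`
variables can be traded for those in the first `l`. Thus pairing with the staircase of the last
block is a cocyclic form (`exists_cocyclic`), which also makes every eigenspace a line. The same
scalars are the relations `σ_i = ε_i`, and matching kernels identifies the algebra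
(`symmAct_eq_zero_iff`).

For the spectrum, list the roots `a_j` of `φ` with multiplicity. In the basis of wedges of Newton
polynomials a symmetric polynomial is triangular, with diagonal entries its values at the
`l`-element subfamilies of roots (`repr_symmAct_newton`). Traces and the linear independence of
characters give the dimension of a generalized eigenspace as the number of subfamilies with a given
root polynomial `y`, which is a product of binomial coefficients (`finrank_genEigenspace_eq_card`,
`card_rootPoly_eq`). -/

/-- The matrix unit `v ↦ e_{21} v`. -/
def raiseMat : Module.End ℂ (Fin 2 → ℂ) := Matrix.toLin' !![0, 0; 1, 0]

/-- The matrix unit `e_{21} v ↦ v`. -/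
def lowerMat : Module.End ℂ (Fin 2 → ℂ) := Matrix.toLin' !![0, 1; 0, 0]

/-- The creation operator at the site `s`. -/
def create {k : ℕ} (s : Fin k) : Module.End ℂ (TensorSpace k) := siteOp 1 s raiseMat

/-- The annihilation operator at the site `s`. -/
def annihilate {k : ℕ} (s : Fin k) : Module.End ℂ (TensorSpace k) := siteOp 1 s lowerMat

theorem irr_one_zero (α β : ℂ) : irr α β 1 0 = raiseMat := rfl

theorem irr_zero_one (α β : ℂ) : irr α β 0 1 = (α + β) • lowerMat := by
  rw [lowerMat, ← map_smul]
  simp [irr]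

theorem irr_zero_zero (α β : ℂ) : irr α β 0 0 = α • 1 - raiseMat * lowerMat := by
  rw [lowerMat, raiseMat, Module.End.mul_eq_comp, ← Matrix.toLin'_mul, Module.End.one_eq_id,
    ← Matrix.toLin'_one, ← map_smul, ← map_sub, irr]
  congr 1
  ext a c
  fin_cases a <;> fin_cases c <;> simp

theorem irr_one_one (α β : ℂ) : irr α β 1 1 = β • 1 + raiseMat * lowerMat := by
  rw [lowerMat, raiseMat, Module.End.mul_eq_comp, ← Matrix.toLin'_mul, Module.End.one_eq_id,
    ← Matrix.toLin'_one, ← map_smul, ← map_add, irr]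
  congr 1
  ext a c
  fin_cases a <;> fin_cases c <;> simp

theorem raiseMat_mul_par : raiseMat * par ^ 1 = (-1 : ℂ) • (par ^ 1 * raiseMat) := by
  have := irr_mul_par_pow 0 0 1 0 1
  simpa [irr_one_zero] using this

theorem lowerMat_mul_par : lowerMat * par ^ 1 = (-1 : ℂ) • (par ^ 1 * lowerMat) := by
  have := irr_mul_par_pow 1 0 0 1 1
  simpa [irr_zero_one] using this

theorem raiseMat_mul_self : raiseMat * raiseMat = 0 := by
  rw [raiseMat, Module.End.mul_eq_comp, ← Matrix.toLin'_mul, ← map_zero Matrix.toLin']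
  congr 1
  ext a c
  fin_cases a <;> fin_cases c <;> simp

theorem lowerMat_mul_raiseMat : lowerMat * raiseMat + raiseMat * lowerMat = 1 := by
  rw [lowerMat, raiseMat, Module.End.mul_eq_comp, Module.End.mul_eq_comp, ← Matrix.toLin'_mul,
    ← Matrix.toLin'_mul, Module.End.one_eq_id, ← Matrix.toLin'_one, ← map_add]
  congr 1
  ext a c
  fin_cases a <;> fin_cases c <;> simp

theorem siteOp_two_mul {k : ℕ} (s : Fin k) (A : Module.End ℂ (Fin 2 → ℂ)) :
    siteOp (1 + 1) s A = siteOp 0 s A := by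
  rw [siteOp_mod]

theorem siteOp_zero_one {k : ℕ} (s : Fin k) : siteOp 0 s 1 = (1 : Module.End ℂ (TensorSpace k)) := by
  simp only [siteOp, pow_zero, ite_self]
  exact PiTensorProduct.map_one

theorem create_mul_annihilate {k : ℕ} (s : Fin k) :
    siteOp 0 s (raiseMat * lowerMat) = create s * annihilate s := by
  rw [create, annihilate, siteOp_mul_same, siteOp_two_mul]

theorem create_mul_create {k : ℕ} (s t : Fin k) :
    create s * create t + create t * create s = 0 := by
  rcases lt_trichotomy s t with h | h | h
  · rw [create, create, siteOp_mul_lt 1 1 h _ _ _ raiseMat_mul_par]; simp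
  · subst h
    have : siteOp (k := k) (1 + 1) s 0 = 0 := by
      have := siteOp_smul (1 + 1) s (0 : ℂ) 0
      simpa using this
    rw [create, siteOp_mul_same, raiseMat_mul_self, this, add_zero]
  · rw [create, create, siteOp_mul_lt 1 1 h _ _ _ raiseMat_mul_par]; simp

theorem annihilate_mul_create {k : ℕ} (s t : Fin k) :
    annihilate s * create t + create t * annihilate s = if s = t then 1 else 0 := by
  rcases lt_trichotomy s t with h | h | h
  · rw [create, annihilate, siteOp_mul_lt 1 1 h _ _ _ lowerMat_mul_par]; simp [h.ne]
  · subst h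
    rw [create, annihilate, siteOp_mul_same, siteOp_mul_same, ← siteOp_add, lowerMat_mul_raiseMat,
      siteOp_two_mul, siteOp_zero_one, if_pos rfl]
  · rw [create, annihilate, siteOp_mul_lt 1 1 h _ _ _ raiseMat_mul_par]; simp [h.ne']

/-- The pure tensor `w_1 ⊗ ⋯ ⊗ w_k`. -/
def pureTensor {k : ℕ} (w : Fin k → Fin 2 → ℂ) : TensorSpace k := PiTensorProduct.tprod ℂ w

theorem tmap_pureTensor {k : ℕ} (A : Fin k → Module.End ℂ (Fin 2 → ℂ)) (w : Fin k → Fin 2 → ℂ) :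
    tmap A (pureTensor w) = pureTensor fun u => A u (w u) :=
  PiTensorProduct.map_tprod A w

/-- The vacuum vector `v_1 ⊗ ⋯ ⊗ v_k`. -/
def vac (k : ℕ) : TensorSpace k := pureTensor fun _ => ![1, 0]

/-- The product of the first coordinates is a multilinear form that takes the value one on the
vacuum. -/
theorem vac_ne_zero (k : ℕ) : vac k ≠ 0 := by
  intro h
  let f : MultilinearMap ℂ (fun _ : Fin k => Fin 2 → ℂ) ℂ :=
    (MultilinearMap.mkPiAlgebra ℂ (Fin k) ℂ).compLinearMap fun _ => LinearMap.proj 0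
  have h1 : PiTensorProduct.lift f (PiTensorProduct.tprod ℂ fun _ => ![1, 0]) = 1 := by
    rw [PiTensorProduct.lift.tprod]; simp [f]
  have h2 : PiTensorProduct.tprod ℂ (fun _ : Fin k => (![1, 0] : Fin 2 → ℂ)) = 0 := h
  rw [h2, map_zero] at h1
  exact zero_ne_one h1

theorem annihilate_vac {k : ℕ} (s : Fin k) : annihilate s (vac k) = 0 := by
  rw [annihilate, siteOp, vac, tmap_pureTensor]
  refine MultilinearMap.map_coord_zero (PiTensorProduct.tprod ℂ) s ?_
  ext i
  fin_cases i <;> simp [lowerMat, Matrix.vecHead]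

/-- The creation operator `∑ f_s ψ_s`. -/
def createVec {k : ℕ} : (Fin k → ℂ) →ₗ[ℂ] Module.End ℂ (TensorSpace k) :=
  Fintype.linearCombination ℂ create

/-- The annihilation operator `∑ g_s ∂_s`. -/
def annihilateVec {k : ℕ} (g : Fin k → ℂ) : Module.End ℂ (TensorSpace k) :=
  ∑ s, g s • annihilate s

theorem createVec_apply {k : ℕ} (f : Fin k → ℂ) : createVec f = ∑ s, f s • create s := rfl

theorem createVec_mul {k : ℕ} (f g : Fin k → ℂ) :
    createVec f * createVec g + createVec g * createVec f = 0 := by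
  simp only [createVec_apply, Finset.sum_mul_sum]
  rw [Finset.sum_comm (f := fun i j => g i • create i * f j • create j), ← Finset.sum_add_distrib]
  refine Finset.sum_eq_zero fun s _ => ?_
  rw [← Finset.sum_add_distrib]
  refine Finset.sum_eq_zero fun t _ => ?_
  rw [smul_mul_smul_comm, smul_mul_smul_comm, mul_comm (g t), ← smul_add, create_mul_create,
    smul_zero]

theorem createVec_mul_self {k : ℕ} (f : Fin k → ℂ) : createVec f * createVec f = 0 := by
  have h := createVec_mul f f
  rw [← two_smul ℂ] at h
  exact (smul_eq_zero.1 h).resolve_left two_ne_zero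

theorem annihilateVec_mul {k : ℕ} (g f : Fin k → ℂ) :
    annihilateVec g * createVec f + createVec f * annihilateVec g = (g ⬝ᵥ f) • 1 := by
  simp only [createVec_apply, annihilateVec, Finset.sum_mul_sum]
  rw [Finset.sum_comm (f := fun i j => f i • create i * g j • annihilate j),
    ← Finset.sum_add_distrib, dotProduct, Finset.sum_smul]
  refine Finset.sum_congr rfl fun s _ => ?_
  rw [← Finset.sum_add_distrib, Finset.sum_eq_single s]
  · rw [smul_mul_smul_comm, smul_mul_smul_comm, mul_comm (f s), ← smul_add, annihilate_mul_create,
      if_pos rfl]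
  · intro t _ ht
    rw [smul_mul_smul_comm, smul_mul_smul_comm, mul_comm (f t), ← smul_add, annihilate_mul_create,
      if_neg ht.symm, smul_zero]
  · simp

theorem annihilateVec_vac {k : ℕ} (g : Fin k → ℂ) : annihilateVec g (vac k) = 0 := by
  simp [annihilateVec, LinearMap.sum_apply, annihilate_vac]

/-- The action of the exterior algebra by creation operators. -/
def wedgeAct (k : ℕ) : ExteriorAlgebra ℂ (Fin k → ℂ) →ₐ[ℂ] Module.End ℂ (TensorSpace k) :=
  ExteriorAlgebra.lift ℂ ⟨createVec, createVec_mul_self⟩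

theorem wedgeAct_ι {k : ℕ} (f : Fin k → ℂ) : wedgeAct k (ExteriorAlgebra.ι ℂ f) = createVec f := by
  rw [wedgeAct, ExteriorAlgebra.lift_ι_apply]

/-! ### Words in creation operators -/

/-- The linear map from the exterior algebra that sends `f_1 ∧ ⋯ ∧ f_l` to
`ψ(f_1) ⋯ ψ(f_l) vac`. -/
def fock (k : ℕ) : ExteriorAlgebra ℂ (Fin k → ℂ) →ₗ[ℂ] TensorSpace k :=
  LinearMap.applyₗ (vac k) ∘ₗ (wedgeAct k).toLinearMap

theorem fock_apply {k : ℕ} (x : ExteriorAlgebra ℂ (Fin k → ℂ)) :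
    fock k x = wedgeAct k x (vac k) := rfl

/-- The vector `ψ(f_1) ⋯ ψ(f_l) vac`. -/
def word (k l : ℕ) : (Fin k → ℂ) [⋀^Fin l]→ₗ[ℂ] TensorSpace k :=
  (fock k).compAlternatingMap (ExteriorAlgebra.ιMulti ℂ l)

theorem word_apply {k l : ℕ} (f : Fin l → Fin k → ℂ) :
    word k l f = wedgeAct k (ExteriorAlgebra.ιMulti ℂ l f) (vac k) := rfl

theorem word_zero {k : ℕ} (f : Fin 0 → Fin k → ℂ) : word k 0 f = vac k := by
  simp [word_apply]

theorem word_succ {k l : ℕ} (f : Fin (l + 1) → Fin k → ℂ) :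
    word k (l + 1) f = createVec (f 0) (word k l fun i => f i.succ) := by
  rw [word_apply, ExteriorAlgebra.ιMulti_succ_apply, map_mul, wedgeAct_ι]
  rfl

theorem createVec_swap {k : ℕ} (f g : Fin k → ℂ) (v : TensorSpace k) :
    createVec f (createVec g v) = -createVec g (createVec f v) := by
  have h := LinearMap.congr_fun (createVec_mul f g) v
  exact eq_neg_of_add_eq_zero_left h

theorem annihilateVec_createVec {k : ℕ} (g f : Fin k → ℂ) (v : TensorSpace k) :
    annihilateVec g (createVec f v) = (g ⬝ᵥ f) • v - createVec f (annihilateVec g v) := by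
  have h := LinearMap.congr_fun (annihilateVec_mul g f) v
  exact eq_sub_of_add_eq h

theorem annihilateVec_word {k l : ℕ} (g : Fin k → ℂ) (f : Fin l → Fin k → ℂ)
    (h : ∀ i, g ⬝ᵥ f i = 0) : annihilateVec g (word k l f) = 0 := by
  induction l with
  | zero => rw [word_zero, annihilateVec_vac]
  | succ l ih =>
    rw [word_succ, annihilateVec_createVec, h, ih _ fun i => h i.succ, zero_smul, map_zero, sub_zero]

/-- A functional that kills the tail but not the first vector gives an annihilation operator that
strips off the first letter up to a non-zero scalar, so induction on the length applies. This takes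
the place of injectivity of `fock`. -/
theorem word_ne_zero {k l : ℕ} (f : Fin l → Fin k → ℂ) (h : LinearIndependent ℂ f) :
    word k l f ≠ 0 := by
  induction l with
  | zero => rw [word_zero]; exact vac_ne_zero k
  | succ l ih =>
    intro h0
    rw [show f = Fin.cons (f 0) (fun i => f i.succ) from (Fin.cons_self_tail f).symm,
      linearIndependent_finCons] at h
    obtain ⟨htail, hmem⟩ := h
    obtain ⟨ν, hν0, hν⟩ := Submodule.exists_le_ker_of_notMem hmem
    obtain ⟨g, hg⟩ : ∃ g : Fin k → ℂ, ∀ x, g ⬝ᵥ x = ν x := by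
      refine ⟨fun s => ν (Pi.single s 1), fun x => ?_⟩
      conv_rhs => rw [pi_eq_sum_univ' x, map_sum]
      simp only [map_smul, dotProduct, smul_eq_mul, mul_comm]
    have h1 : annihilateVec g (word k (l + 1) f) = ν (f 0) • word k l fun i => f i.succ := by
      rw [word_succ, annihilateVec_createVec, annihilateVec_word, map_zero, sub_zero, hg]
      intro i
      rw [hg]
      exact hν (Submodule.subset_span ⟨i, rfl⟩)
    rw [h0, map_zero] at h1
    exact (smul_ne_zero hν0 (ih _ htail)) h1.symm

/-- An operator that kills the vacuum and whose commutator with each creation operator is again a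
creation operator obeys the Leibniz rule on words. It is used for the number operator and for
`hopOp`. -/
theorem derivation_word {k : ℕ} (T : Module.End ℂ (TensorSpace k)) (t : Module.End ℂ (Fin k → ℂ))
    (h0 : T (vac k) = 0) (h : ∀ f, T * createVec f = createVec f * T + createVec (t f)) {l : ℕ}
    (f : Fin l → Fin k → ℂ) :
    T (word k l f) = ∑ i, word k l (Function.update f i (t (f i))) := by
  induction l with
  | zero => simp [word_zero, h0]
  | succ l ih =>
    have h1 := LinearMap.congr_fun (h (f 0)) (word k l fun i => f i.succ)
    simp only [Module.End.mul_apply, LinearMap.add_apply] at h1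
    rw [word_succ, h1, ih, Fin.sum_univ_succ, map_sum, add_comm, word_succ]
    congr 1
    refine Finset.sum_congr rfl fun i _ => ?_
    rw [word_succ, Function.update_of_ne (Fin.succ_ne_zero i).symm]
    congr 2
    funext j
    by_cases hj : j = i
    · subst hj; simp
    · rw [Function.update_of_ne hj, Function.update_of_ne (by simpa using hj)]

/-! ### Diagonal operators and the grading by particle number -/

theorem createVec_single {k : ℕ} (s : Fin k) : createVec (Pi.single s 1) = create s := by
  rw [createVec_apply, Finset.sum_eq_single s] <;> simp +contextual

theorem annihilateVec_single {k : ℕ} (s : Fin k) : annihilateVec (Pi.single s 1) = annihilate s := by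
  rw [annihilateVec, Finset.sum_eq_single s] <;> simp +contextual

/-- The diagonal operator `∑ c_s ψ_s ∂_s`. -/
def modeOp {k : ℕ} (c : Fin k → ℂ) : Module.End ℂ (TensorSpace k) :=
  ∑ s, c s • (create s * annihilate s)

theorem modeOp_vac {k : ℕ} (c : Fin k → ℂ) : modeOp c (vac k) = 0 := by
  simp [modeOp, LinearMap.sum_apply, annihilate_vac]

theorem modeOp_mul_createVec {k : ℕ} (c f : Fin k → ℂ) :
    modeOp c * createVec f = createVec f * modeOp c + createVec (c * f) := by
  rw [modeOp, createVec_apply (c * f), Finset.sum_mul, Finset.mul_sum, ← Finset.sum_add_distrib]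
  refine Finset.sum_congr rfl fun s _ => ?_
  have h1 := annihilateVec_mul (Pi.single s 1) f
  have h2 := createVec_mul (Pi.single s 1) f
  rw [annihilateVec_single, single_one_dotProduct] at h1
  rw [createVec_single] at h2
  rw [smul_mul_assoc, mul_assoc, eq_sub_of_add_eq h1, mul_sub, ← mul_assoc,
    eq_neg_of_add_eq_zero_left h2, mul_smul_comm, mul_one, Pi.mul_apply, mul_smul, mul_smul_comm,
    ← smul_add, neg_mul, mul_assoc]
  congr 1
  abel

/-- The number operator. -/
def numberOp (k : ℕ) : Module.End ℂ (TensorSpace k) := modeOp 1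

theorem numberOp_word {k l : ℕ} (f : Fin l → Fin k → ℂ) :
    numberOp k (word k l f) = (l : ℂ) • word k l f := by
  rw [numberOp, derivation_word (modeOp 1) LinearMap.id (modeOp_vac 1)
    (fun f => by rw [modeOp_mul_createVec, one_mul, LinearMap.id_apply])]
  simp [Nat.cast_smul_eq_nsmul]

/-- The span of the vectors `ψ(f_1) ⋯ ψ(f_l) vac`. -/
def wordSpan (k l : ℕ) : Submodule ℂ (TensorSpace k) := Submodule.span ℂ (Set.range (word k l))

theorem createVec_mem_iSup {k : ℕ} (f : Fin k → ℂ) {v : TensorSpace k}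
    (hv : v ∈ ⨆ l, wordSpan k l) : createVec f v ∈ ⨆ l, wordSpan k l := by
  have : (⨆ l, wordSpan k l) ≤ (⨆ l, wordSpan k l).comap (createVec f) := by
    refine iSup_le fun l => Submodule.span_le.2 ?_
    rintro _ ⟨g, rfl⟩
    refine Submodule.mem_iSup_of_mem (l + 1) (Submodule.subset_span ⟨Fin.cons f g, ?_⟩)
    rw [word_succ]
    simp
  exact this hv

theorem create_pureTensor {k : ℕ} (s : Fin k) (w : Fin k → Fin 2 → ℂ) :
    create s (pureTensor w) =
      pureTensor fun u => if u < s then par (w u) else if u = s then raiseMat (w u) else w u := by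
  rw [create, siteOp, tmap_pureTensor]
  congr 1
  funext u
  split_ifs <;> simp

theorem par_apply (w : Fin 2 → ℂ) : par w = ![w 0, -w 1] := by
  ext i
  fin_cases i <;> simp [par, Matrix.vecHead, Matrix.vecTail]

/-- Induction on the set of sites whose vector differs from the vacuum vector: splitting the vector
at a new site into its two coordinates leaves it in the vacuum or excites it with one creation
operator. -/
theorem pureTensor_mem_iSup {k : ℕ} (T : Finset (Fin k)) : ∀ w : Fin k → Fin 2 → ℂ,
    pureTensor (fun u => if u ∈ T then w u else ![1, 0]) ∈ ⨆ l, wordSpan k l := by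
  induction T using Finset.induction_on with
  | empty =>
    intro w
    refine Submodule.mem_iSup_of_mem 0 (Submodule.subset_span ⟨Fin.elim0, ?_⟩)
    rw [word_zero]
    simp [vac]
  | insert s T hs ih =>
    intro w
    -- In the excited term the factors to the left of `s` are twisted by `par` beforehand; as `par`
    -- is an involution, this cancels the Jordan–Wigner sign of `create s`.
    have key : pureTensor (fun u => if u ∈ insert s T then w u else ![1, 0]) =
        w s 0 • pureTensor (fun u => if u ∈ T then w u else ![1, 0]) + w s 1 • create s
          (pureTensor fun u => if u ∈ T then (if u < s then par (w u) else w u) else ![1, 0]) := by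
      rw [create_pureTensor]
      set z : Fin k → Fin 2 → ℂ := fun u => if u ∈ T then w u else ![1, 0] with hz
      have e1 : (fun u => if u ∈ insert s T then w u else ![1, 0]) =
          Function.update z s (w s 0 • ![1, 0] + w s 1 • ![0, 1]) := by
        funext u
        by_cases h : u = s
        · subst h
          ext i; fin_cases i <;> simp
        · simp [h, hz]
      have e2 : (fun u => if u ∈ T then w u else ![1, 0]) = Function.update z s ![1, 0] := by
        funext u
        by_cases h : u = s
        · subst h; simp [hs]
        · simp [h, hz]
      have e3 : (fun u => if u < s then
            par (if u ∈ T then (if u < s then par (w u) else w u) else ![1, 0]) else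
            if u = s then raiseMat (if u ∈ T then (if u < s then par (w u) else w u) else ![1, 0])
            else (if u ∈ T then (if u < s then par (w u) else w u) else ![1, 0])) =
          Function.update z s ![0, 1] := by
        funext u
        rcases lt_trichotomy u s with h | h | h
        · by_cases hT : u ∈ T
          · have := LinearMap.congr_fun par_mul_par (w u)
            simpa [h, h.ne, hz, hT] using this
          · simp [h, h.ne, hz, hT, par_apply]
        · subst h
          ext i; fin_cases i <;> simp [hs, raiseMat, Matrix.vecHead]
        · simp [h.ne', h.not_gt, hz]
      rw [e1, e3, show pureTensor z = _ from congrArg pureTensor e2]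
      unfold pureTensor
      rw [MultilinearMap.map_update_add, MultilinearMap.map_update_smul,
        MultilinearMap.map_update_smul]
      rfl
    rw [key]
    refine Submodule.add_mem _ (Submodule.smul_mem _ _ (ih w)) (Submodule.smul_mem _ _ ?_)
    rw [← createVec_single]
    exact createVec_mem_iSup _ (ih fun u => if u < s then par (w u) else w u)

theorem iSup_wordSpan (k : ℕ) : ⨆ l, wordSpan k l = ⊤ := by
  have h : Submodule.span ℂ (Set.range (pureTensor (k := k))) = ⊤ :=
    PiTensorProduct.span_tprod_eq_top
  rw [eq_top_iff, ← h, Submodule.span_le]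
  rintro _ ⟨w, rfl⟩
  simpa using pureTensor_mem_iSup Finset.univ w

/-- The word spans lie in eigenspaces for distinct eigenvalues and together fill the space.
Independence of eigenspaces leaves no room for anything else. -/
theorem numberOp_eigenspace (k l : ℕ) :
    Module.End.eigenspace (numberOp k) (l : ℂ) = wordSpan k l := by
  have hle : ∀ j : ℕ, wordSpan k j ≤ Module.End.eigenspace (numberOp k) (j : ℂ) := fun j =>
    Submodule.span_le.2 (by
      rintro _ ⟨f, rfl⟩
      exact Module.End.mem_eigenspace_iff.2 (numberOp_word f))
  refine le_antisymm ?_ (hle l)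
  have hind := (Module.End.eigenspaces_iSupIndep (numberOp k)).comp
    (f := fun j : ℕ => (j : ℂ)) Nat.cast_injective
  have hsup : wordSpan k l ⊔ ⨆ (j) (_ : j ≠ l), wordSpan k j = ⊤ := by
    rw [eq_top_iff, ← iSup_wordSpan k]
    refine iSup_le fun j => ?_
    by_cases h : j = l
    · subst h; exact le_sup_left
    · exact le_sup_of_le_right (le_iSup₂_of_le j h le_rfl)
  have hdis := hind l
  intro v hv
  obtain ⟨x, hx, z, hz, rfl⟩ := Submodule.mem_sup.1 (hsup ▸ Submodule.mem_top : v ∈ _)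
  have hz' : z ∈ ⨆ (j) (_ : j ≠ l), Module.End.eigenspace (numberOp k) (j : ℂ) :=
    (iSup₂_mono fun j _ => hle j) hz
  have hz0 : z ∈ Module.End.eigenspace (numberOp k) (l : ℂ) := by
    have := Submodule.sub_mem _ hv (hle l hx)
    simpa using this
  have : z = 0 := Submodule.disjoint_def.1 hdis z hz0 hz'
  rwa [this, add_zero]

/-! ### The generators of the current superalgebra -/

section
variable {k : ℕ} (α β : Fin k → ℕ) (b : Fin k → ℂ)

/-- The dimension-like parameters `n_s = α_s + β_s`. -/
def boxes (s : Fin k) : ℂ := (α s : ℂ) + β s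

theorem siteOp_zero_scalar (c : ℂ) (s : Fin k) :
    siteOp 0 s (c • 1) = c • (1 : Module.End ℂ (TensorSpace k)) := by
  rw [siteOp_smul, siteOp_zero_one]

theorem tensorOp_one_zero (r : ℕ) : tensorOp α β b 1 0 r = createVec (b ^ r) := by
  simp only [tensorOp, createVec_apply, irr_one_zero]
  rfl

theorem tensorOp_zero_one (r : ℕ) :
    tensorOp α β b 0 1 r = annihilateVec (boxes α β * b ^ r) := by
  simp only [tensorOp, annihilateVec, irr_zero_one, siteOp_smul, smul_smul]
  refine Finset.sum_congr rfl fun s _ => ?_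
  rw [mul_comm]
  rfl

theorem tensorOp_zero_zero (r : ℕ) :
    tensorOp α β b 0 0 r = (∑ s, b s ^ r * α s) • 1 - modeOp (b ^ r) := by
  simp only [tensorOp, irr_zero_zero, modeOp, Finset.sum_smul, ← Finset.sum_sub_distrib]
  refine Finset.sum_congr rfl fun s _ => ?_
  rw [siteOp_sub, smul_sub, mul_smul]
  congr 2
  · exact siteOp_zero_scalar _ _
  · exact create_mul_annihilate s

theorem tensorOp_one_one (r : ℕ) :
    tensorOp α β b 1 1 r = (∑ s, b s ^ r * β s) • 1 + modeOp (b ^ r) := by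
  simp only [tensorOp, irr_one_one, modeOp, Finset.sum_smul, ← Finset.sum_add_distrib]
  refine Finset.sum_congr rfl fun s _ => ?_
  rw [siteOp_add, smul_add, mul_smul]
  congr 2
  · rw [← siteOp_zero_scalar, siteOp_mod]; rfl
  · rw [← create_mul_annihilate, siteOp_mod]; rfl

/-- At `r = 0` the two diagonal generators are the extreme weight minus and plus the number
operator, so both weight conditions say that there are `l` particles. -/
theorem mem_M_iff (l : ℕ) (v : TensorSpace k) :
    v ∈ M α β b l ↔ annihilateVec (boxes α β) v = 0 ∧ v ∈ wordSpan k l := by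
  have h1 : tensorOp α β b 0 1 0 = annihilateVec (boxes α β) := by
    rw [tensorOp_zero_one, pow_zero, mul_one]
  rw [M, singWeightSpace, Submodule.mem_inf, Submodule.mem_inf, LinearMap.mem_ker,
    Module.End.mem_eigenspace_iff, Module.End.mem_eigenspace_iff, tensorRep_e, tensorRep_e,
    tensorRep_e, h1, tensorOp_zero_zero, tensorOp_one_one, ← numberOp_eigenspace,
    Module.End.mem_eigenspace_iff, numberOp]
  refine and_congr_right fun _ => ?_
  simp only [pow_zero, one_mul, LinearMap.sub_apply, LinearMap.add_apply, LinearMap.smul_apply,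
    Module.End.one_apply, sub_smul, add_smul, add_right_inj, sub_right_inj, and_self]

end

/-! ### Singular vectors as words in singular one-particle vectors -/

/-- In `g ∧ f_1 ∧ ⋯ ∧ f_l` any multiple of `g` can be subtracted from the other letters. -/
theorem createVec_word_sub {k l : ℕ} (g : Fin k → ℂ) (f : Fin l → Fin k → ℂ) (c : Fin l → ℂ) :
    createVec g (word k l f) = createVec g (word k l fun i => f i - c i • g) := by
  induction l with
  | zero => rw [word_zero, word_zero]
  | succ l ih =>
    have h0 : ∀ v, createVec g (createVec g v) = 0 := fun v =>
      LinearMap.congr_fun (createVec_mul_self g) v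
    rw [word_succ, word_succ, createVec_swap, ih _ fun i => c i.succ, map_sub, map_smul,
      LinearMap.sub_apply, LinearMap.smul_apply, map_sub, map_smul, h0, smul_zero, sub_zero,
      createVec_swap g]

section
variable {k : ℕ} (α β : Fin k → ℕ) (b : Fin k → ℂ)

theorem mem_M_of_word {l : ℕ} (f : Fin l → Fin k → ℂ) (hf : ∀ i, boxes α β ⬝ᵥ f i = 0) :
    word k l f ∈ M α β b l :=
  (mem_M_iff α β b l _).2 ⟨annihilateVec_word _ f hf, Submodule.subset_span ⟨f, rfl⟩⟩

/-- On singular vectors, creating the constant vector `1` and then annihilating with `boxes α β` is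
multiplication by the non-zero scalar `n`. On an arbitrary word the same composite replaces each
letter by its projection to the hyperplane along `1`, up to the factor `n`. -/
theorem M_eq_span (hn : boxes α β ⬝ᵥ 1 ≠ 0) (l : ℕ) :
    M α β b l =
      Submodule.span ℂ {v | ∃ f : Fin l → Fin k → ℂ, (∀ i, boxes α β ⬝ᵥ f i = 0) ∧ word k l f = v} := by
  refine le_antisymm (fun v hv => ?_) (Submodule.span_le.2 ?_)
  · obtain ⟨h0, hv⟩ := (mem_M_iff α β b l v).1 hv
    have h1 := annihilateVec_createVec (boxes α β) 1 v
    rw [h0, map_zero, sub_zero] at h1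
    have h2 : wordSpan k l ≤ (Submodule.span ℂ {v | ∃ f : Fin l → Fin k → ℂ,
        (∀ i, boxes α β ⬝ᵥ f i = 0) ∧ word k l f = v}).comap
          (annihilateVec (boxes α β) * createVec 1) := by
      refine Submodule.span_le.2 ?_
      rintro _ ⟨f, rfl⟩
      -- These coefficients make `f i - c i • 1` orthogonal to `boxes α β`.
      set c : Fin l → ℂ := fun i => (boxes α β ⬝ᵥ f i) / (boxes α β ⬝ᵥ 1) with hc
      have hf : ∀ i, boxes α β ⬝ᵥ (f i - c i • 1) = 0 := fun i => by
        rw [dotProduct_sub, dotProduct_smul, smul_eq_mul, hc, div_mul_cancel₀ _ hn, sub_self]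
      rw [SetLike.mem_coe, Submodule.mem_comap, Module.End.mul_apply, createVec_word_sub 1 f c, annihilateVec_createVec, annihilateVec_word _ _ hf, map_zero,
        sub_zero]
      exact Submodule.smul_mem _ _ (Submodule.subset_span ⟨_, hf, rfl⟩)
    have h3 := h2 hv
    rw [Submodule.mem_comap, Module.End.mul_apply, h1] at h3
    exact (Submodule.smul_mem_iff _ hn).1 h3
  · rintro _ ⟨f, hf, rfl⟩
    exact mem_M_of_word α β b f hf

/-! ### The action of the transfer matrix -/

theorem coeff_eSer_mul (i j p q : Fin 2) (r : ℕ) :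
    PowerSeries.coeff (r + 2) (eSer i j * eSer p q) =
      ∑ x ∈ Finset.HasAntidiagonal.antidiagonal r, e i j x.1 * e p q x.2 := by
  have h : eSer i j * eSer p q =
      PowerSeries.X ^ 2 * (PowerSeries.mk (e i j) * PowerSeries.mk (e p q)) := by
    rw [eSer, eSer, mul_assoc, ← mul_assoc (PowerSeries.mk _), (PowerSeries.commute_X _).eq,
      mul_assoc, ← mul_assoc, pow_two]
  rw [h, PowerSeries.coeff_X_pow_mul, PowerSeries.coeff_mul]
  simp

theorem coeff_eSer_mul_of_lt (i j p q : Fin 2) {r : ℕ} (hr : r < 2) :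
    PowerSeries.coeff r (eSer i j * eSer p q) = 0 := by
  have h : eSer i j * eSer p q =
      PowerSeries.X ^ 2 * (PowerSeries.mk (e i j) * PowerSeries.mk (e p q)) := by
    rw [eSer, eSer, mul_assoc, ← mul_assoc (PowerSeries.mk _), (PowerSeries.commute_X _).eq,
      mul_assoc, ← mul_assoc, pow_two]
  rw [h, PowerSeries.coeff_X_pow_mul', if_neg (by omega)]

theorem coeff_smul_series (c : ℂ) (f : PowerSeries U) (r : ℕ) :
    PowerSeries.coeff r (c • f) = c • PowerSeries.coeff r f := rfl

/-- The shift by two arises because each of the two factors starts in degree `x⁻¹`. -/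
theorem coeff_transferSer (r : ℕ) :
    PowerSeries.coeff (r + 2) transferSer = (1 / 2 : ℂ) • ∑ x ∈ Finset.HasAntidiagonal.antidiagonal r,
      (e 0 0 x.1 * e 0 0 x.2 - e 0 1 x.1 * e 1 0 x.2 +
        (e 1 0 x.1 * e 0 1 x.2 - e 1 1 x.1 * e 1 1 x.2)) := by
  rw [transferSer, coeff_smul_series]
  simp only [Fin.sum_univ_two, map_add, coeff_smul_series, coeff_eSer_mul, Finset.sum_add_distrib,
    Finset.sum_sub_distrib]
  simp only [Fin.val_zero, Fin.val_one, pow_zero, pow_one, one_smul]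
  module

theorem coeff_transferSer_of_lt {r : ℕ} (hr : r < 2) : PowerSeries.coeff r transferSer = 0 := by
  rw [transferSer, coeff_smul_series]
  simp only [Fin.sum_univ_two, map_add, coeff_smul_series, coeff_eSer_mul_of_lt _ _ _ _ hr]
  simp

/-- The coefficient `∑ n_s b_s^p` of `x^{-p-1}` in `ζ`. -/
def zetaCoeff (p : ℕ) : ℂ := boxes α β ⬝ᵥ b ^ p

theorem zetaCoeff_add (p q : ℕ) : (boxes α β * b ^ p) ⬝ᵥ b ^ q = zetaCoeff α β b (p + q) := by
  simp only [zetaCoeff, dotProduct, pow_add, Pi.mul_apply, mul_assoc]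

theorem zetaCoeff_eq (p : ℕ) :
    zetaCoeff α β b p = (∑ s, b s ^ p * α s) + ∑ s, b s ^ p * β s := by
  rw [zetaCoeff, dotProduct, ← Finset.sum_add_distrib]
  exact Finset.sum_congr rfl fun s _ => by simp only [boxes, Pi.pow_apply]; ring

/-- The part of the transfer matrix that is quadratic in the fermions. -/
def hopOp (r : ℕ) : Module.End ℂ (TensorSpace k) :=
  ∑ x ∈ Finset.HasAntidiagonal.antidiagonal r, (zetaCoeff α β b x.1 • modeOp (b ^ x.2) -
    createVec (b ^ x.1) * annihilateVec (boxes α β * b ^ x.2))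

/-- The eigenvalue of the transfer matrix on the vacuum. -/
def vacCoeff (r : ℕ) : ℂ :=
  ∑ x ∈ Finset.HasAntidiagonal.antidiagonal r, (1 / 2 : ℂ) * ((∑ s, b s ^ x.1 * α s) * (∑ s, b s ^ x.2 * α s) -
    (∑ s, b s ^ x.1 * β s) * (∑ s, b s ^ x.2 * β s) - zetaCoeff α β b (x.1 + x.2))

/-- The products of two `modeOp`s from `e_{11} e_{11}` and `e_{22} e_{22}` cancel. Normal ordering
of `e_{12} e_{21}` yields the scalar `zetaCoeff (p + q)` and one more quadratic term. -/
theorem tensorRep_transfer (r : ℕ) :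
    tensorRep α β b (PowerSeries.coeff (r + 2) transferSer) =
      vacCoeff α β b r • 1 - hopOp α β b r := by
  rw [coeff_transferSer, map_smul, map_sum, vacCoeff]
  -- Averaging the summand with its mirror image under `(p, q) ↦ (q, p)` makes the identity hold
  -- term by term on the antidiagonal.
  have hG : hopOp α β b r = (1 / 2 : ℂ) • ∑ x ∈ Finset.HasAntidiagonal.antidiagonal r,
      ((zetaCoeff α β b x.1 • modeOp (b ^ x.2) -
        createVec (b ^ x.1) * annihilateVec (boxes α β * b ^ x.2)) +
      (zetaCoeff α β b x.2 • modeOp (b ^ x.1) -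
        createVec (b ^ x.2) * annihilateVec (boxes α β * b ^ x.1))) := by
    have hsw := Finset.Nat.sum_antidiagonal_swap (n := r)
      (f := fun x : ℕ × ℕ => zetaCoeff α β b x.1 • modeOp (b ^ x.2) -
        createVec (b ^ x.1) * annihilateVec (boxes α β * b ^ x.2))
    simp only [Prod.fst_swap, Prod.snd_swap] at hsw
    rw [Finset.sum_add_distrib, hsw, ← two_smul ℂ, smul_smul]
    norm_num [hopOp]
  rw [hG, Finset.smul_sum, Finset.smul_sum, Finset.sum_smul, ← Finset.sum_sub_distrib]
  refine Finset.sum_congr rfl fun x _ => ?_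
  simp only [map_add, map_sub, map_mul, tensorRep_e, tensorOp_zero_zero, tensorOp_one_one,
    tensorOp_zero_one, tensorOp_one_zero]
  have h := annihilateVec_mul (boxes α β * b ^ x.1) (b ^ x.2)
  rw [eq_sub_of_add_eq h, zetaCoeff_add, zetaCoeff_eq α β b x.1, zetaCoeff_eq α β b x.2]
  simp only [sub_mul, mul_sub, add_mul, mul_add, smul_mul_assoc, mul_smul_comm, one_mul, mul_one]
  module

/-- The one-particle operator of `hopOp`. -/
def hopVec (r : ℕ) : Module.End ℂ (Fin k → ℂ) :=
  ∑ x ∈ Finset.HasAntidiagonal.antidiagonal r, (zetaCoeff α β b x.1 • LinearMap.mulLeft ℂ (b ^ x.2) -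
    (LinearMap.toSpanSingleton ℂ _ (b ^ x.1)).comp
      (dotProductBilin ℂ ℂ (boxes α β * b ^ x.2)))

theorem hopVec_apply (r : ℕ) (f : Fin k → ℂ) :
    hopVec α β b r f = ∑ x ∈ Finset.HasAntidiagonal.antidiagonal r, (zetaCoeff α β b x.1 • (b ^ x.2 * f) -
      ((boxes α β * b ^ x.2) ⬝ᵥ f) • b ^ x.1) := by
  simp [hopVec, LinearMap.sum_apply]

theorem hopOp_vac (r : ℕ) : hopOp α β b r (vac k) = 0 := by
  simp [hopOp, LinearMap.sum_apply, modeOp_vac, annihilateVec_vac]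

/-- The commutator of a quadratic number-preserving operator with a creation operator is a single
creation operator: the diagonal part multiplies `f` by `b ^ q`, and the other part contributes the
pairing of `f` with `boxes α β * b ^ q`. -/
theorem hopOp_mul_createVec (r : ℕ) (f : Fin k → ℂ) :
    hopOp α β b r * createVec f =
      createVec f * hopOp α β b r + createVec (hopVec α β b r f) := by
  rw [hopOp, hopVec_apply, map_sum, Finset.sum_mul, Finset.mul_sum, ← Finset.sum_add_distrib]
  refine Finset.sum_congr rfl fun x _ => ?_
  have h1 := annihilateVec_mul (boxes α β * b ^ x.2) f
  have h2 := createVec_mul (b ^ x.1) f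
  rw [sub_mul, smul_mul_assoc, modeOp_mul_createVec, mul_assoc, eq_sub_of_add_eq h1, mul_sub,
    ← mul_assoc, eq_neg_of_add_eq_zero_left h2, map_sub, map_smul, map_smul, mul_sub,
    mul_smul_comm, mul_smul_comm, mul_one, smul_add, neg_mul, mul_assoc]
  abel

theorem hopOp_word (r : ℕ) {l : ℕ} (f : Fin l → Fin k → ℂ) :
    hopOp α β b r (word k l f) =
      ∑ i, word k l (Function.update f i (hopVec α β b r (f i))) :=
  derivation_word _ _ (hopOp_vac α β b r) (hopOp_mul_createVec α β b r) f

end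

section

open Polynomial

/-! ### One-particle vectors as polynomials modulo `φ` -/

section
variable {k : ℕ} (α β : Fin k → ℕ) (b : Fin k → ℂ)

/-- The numerator of `∑ n_s f_s / (x - b_s)` over the common denominator `∏ (x - b_s)`. -/
def numer : (Fin k → ℂ) →ₗ[ℂ] ℂ[X] where
  toFun f := ∑ s, C (boxes α β s * f s) * ∏ r ∈ Finset.univ.erase s, (X - C (b r))
  map_add' f g := by
    simp only [Pi.add_apply, mul_add, map_add, add_mul, Finset.sum_add_distrib]
  map_smul' c f := by
    simp only [Pi.smul_apply, smul_eq_mul, RingHom.id_apply, Finset.smul_sum, smul_eq_C_mul,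
      ← mul_assoc, ← map_mul, mul_left_comm c]

theorem numer_apply (f : Fin k → ℂ) : numer α β b f =
    ∑ s, C (boxes α β s * f s) * ∏ r ∈ Finset.univ.erase s, (X - C (b r)) := rfl

theorem numer_one : numer α β b 1 = phi α β b := by
  simp [numer_apply, phi, boxes]

/-- This is `x / (x - b_s) = b_s / (x - b_s) + 1` over the common denominator. On the hyperplane,
pointwise multiplication by `b` thus becomes multiplication by `x`, provided that the product is
taken before reduction modulo `φ`. -/
theorem X_mul_numer (f : Fin k → ℂ) : X * numer α β b f =
    numer α β b (b * f) + C (boxes α β ⬝ᵥ f) * ∏ r, (X - C (b r)) := by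
  rw [dotProduct, map_sum, Finset.sum_mul, numer_apply, numer_apply, Finset.mul_sum,
    ← Finset.sum_add_distrib]
  refine Finset.sum_congr rfl fun s _ => ?_
  rw [← Finset.mul_prod_erase Finset.univ _ (Finset.mem_univ s)]
  simp only [Pi.mul_apply, map_mul]
  ring

theorem eval_numer (f : Fin k → ℂ) (s : Fin k) : (numer α β b f).eval (b s) =
    boxes α β s * f s * ∏ r ∈ Finset.univ.erase s, (b s - b r) := by
  rw [numer_apply, eval_finsetSum, Finset.sum_eq_single s]
  · simp [eval_prod]
  · intro t _ ht
    rw [eval_mul, eval_prod, Finset.prod_eq_zero (Finset.mem_erase.2 ⟨ht.symm, Finset.mem_univ s⟩),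
      mul_zero]
    simp
  · simp

theorem natDegree_prod_erase (s : Fin k) :
    (∏ r ∈ Finset.univ.erase s, (X - C (b r))).natDegree = k - 1 := by
  rw [natDegree_prod_of_monic _ _ fun r _ => monic_X_sub_C (b r)]
  simp

theorem natDegree_numer_le (f : Fin k → ℂ) : (numer α β b f).natDegree ≤ k - 1 := by
  rw [numer_apply]
  refine natDegree_sum_le_of_forall_le _ _ fun s _ => ?_
  refine (natDegree_C_mul_le _ _).trans ?_
  rw [natDegree_prod_erase]

/-- All the products in the numerator are monic of degree `k - 1`. Hence the hyperplane condition is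
the vanishing of the top coefficient, and the hyperplane has the size of the remainders modulo `φ`.
-/
theorem coeff_numer (f : Fin k → ℂ) : (numer α β b f).coeff (k - 1) = boxes α β ⬝ᵥ f := by
  rw [numer_apply, finsetSum_coeff, dotProduct]
  refine Finset.sum_congr rfl fun s _ => ?_
  rw [coeff_C_mul]
  have h := (monic_prod_of_monic (Finset.univ.erase s) _ fun r _ => monic_X_sub_C (b r)).coeff_natDegree
  rw [natDegree_prod_erase] at h
  rw [h, mul_one]

/-- The monic multiple of `φ`. -/
def monicPhi : ℂ[X] := C (boxes α β ⬝ᵥ 1)⁻¹ * phi α β b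

/-- The function with numerator `p`, for `p` of degree less than `k`. -/
def unnumer : ℂ[X] →ₗ[ℂ] (Fin k → ℂ) where
  toFun p s := p.eval (b s) / (boxes α β s * ∏ r ∈ Finset.univ.erase s, (b s - b r))
  map_add' p q := by ext s; simp [add_div]
  map_smul' c p := by ext s; simp [mul_div_assoc]

theorem unnumer_apply (p : ℂ[X]) (s : Fin k) : unnumer α β b p s =
    p.eval (b s) / (boxes α β s * ∏ r ∈ Finset.univ.erase s, (b s - b r)) := rfl

/-- The one-particle vector that corresponds to a polynomial modulo `φ`. -/
def ofPoly : ℂ[X] →ₗ[ℂ] (Fin k → ℂ) := unnumer α β b ∘ₗ modByMonicHom (monicPhi α β b)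

theorem ofPoly_apply (p : ℂ[X]) : ofPoly α β b p = unnumer α β b (p %ₘ monicPhi α β b) := rfl

theorem boxes_ne_zero (hα : ∀ s, 0 < α s) (s : Fin k) : boxes α β s ≠ 0 := by
  have h : boxes α β s = ((α s + β s : ℕ) : ℂ) := by simp [boxes]
  rw [h, Nat.cast_ne_zero]
  have := hα s
  omega

theorem boxes_dot_one_ne_zero (hα : ∀ s, 0 < α s) (hk : 0 < k) : boxes α β ⬝ᵥ 1 ≠ 0 := by
  have h : boxes α β ⬝ᵥ 1 = ((∑ s, (α s + β s) : ℕ) : ℂ) := by simp [boxes, dotProduct]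
  rw [h, Nat.cast_ne_zero]
  have h1 : α ⟨0, hk⟩ + β ⟨0, hk⟩ ≤ ∑ s, (α s + β s) :=
    Finset.single_le_sum (f := fun s => α s + β s) (fun _ _ => Nat.zero_le _) (Finset.mem_univ _)
  have := hα ⟨0, hk⟩
  omega

theorem denominator_ne_zero (hα : ∀ s, 0 < α s) (hb : Function.Injective b) (s : Fin k) :
    boxes α β s * ∏ r ∈ Finset.univ.erase s, (b s - b r) ≠ 0 := by
  refine mul_ne_zero (boxes_ne_zero α β hα s) (Finset.prod_ne_zero_iff.2 fun r hr => ?_)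
  exact sub_ne_zero.2 fun h => (Finset.mem_erase.1 hr).1 (hb h.symm)

theorem unnumer_numer (hα : ∀ s, 0 < α s) (hb : Function.Injective b) (f : Fin k → ℂ) :
    unnumer α β b (numer α β b f) = f := by
  ext s
  rw [unnumer_apply, eval_numer, div_eq_iff (denominator_ne_zero α β b hα hb s)]
  ring

/-- Lagrange interpolation: both polynomials have degree less than `k` and agree at the `k` distinct
points `b_s`. -/
theorem numer_unnumer (hα : ∀ s, 0 < α s) (hb : Function.Injective b) (hk : 0 < k) (p : ℂ[X])
    (hp : p.natDegree < k) : numer α β b (unnumer α β b p) = p := by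
  have hdeg : ∀ q : ℂ[X], q.natDegree < k → q.degree < ((Finset.univ : Finset (Fin k)).card : ℕ) :=
    fun q hq => by
      rw [Finset.card_fin]
      exact (degree_le_natDegree).trans_lt (by exact_mod_cast hq)
  refine eq_of_degrees_lt_of_eval_index_eq (v := b) Finset.univ hb.injOn (hdeg _ ?_) (hdeg _ hp) ?_
  · have := natDegree_numer_le α β b (unnumer α β b p)
    omega
  · intro s _
    rw [eval_numer, unnumer_apply, mul_comm (boxes α β s), mul_assoc,
      div_mul_cancel₀ _ (denominator_ne_zero α β b hα hb s)]

section
variable (hn : boxes α β ⬝ᵥ 1 ≠ 0)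
include hn

theorem phi_eq : phi α β b = C (boxes α β ⬝ᵥ 1) * monicPhi α β b := by
  rw [monicPhi, ← mul_assoc, ← C_mul, mul_inv_cancel₀ hn, C_1, one_mul]

theorem natDegree_phi : (phi α β b).natDegree = k - 1 := by
  refine natDegree_eq_of_le_of_coeff_ne_zero (numer_one α β b ▸ natDegree_numer_le α β b 1) ?_
  rw [← numer_one, coeff_numer]
  exact hn

theorem natDegree_monicPhi : (monicPhi α β b).natDegree = k - 1 := by
  rw [monicPhi, natDegree_C_mul (inv_ne_zero hn), natDegree_phi α β b hn]

theorem monic_monicPhi : (monicPhi α β b).Monic := by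
  rw [Monic, leadingCoeff, natDegree_monicPhi α β b hn, monicPhi, coeff_C_mul, ← numer_one,
    coeff_numer, inv_mul_cancel₀ hn]

theorem natDegree_modByMonic_lt_card (hk : 0 < k) (p : ℂ[X]) :
    (p %ₘ monicPhi α β b).natDegree < k := by
  have := natDegree_modByMonic_le p (monic_monicPhi α β b hn)
  rw [natDegree_monicPhi α β b hn] at this
  omega

theorem coeff_modByMonic_monicPhi (p : ℂ[X]) : (p %ₘ monicPhi α β b).coeff (k - 1) = 0 := by
  refine coeff_eq_zero_of_degree_lt ?_
  have h := degree_modByMonic_lt p (monic_monicPhi α β b hn)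
  rwa [degree_eq_natDegree (monic_monicPhi α β b hn).ne_zero, natDegree_monicPhi α β b hn] at h

theorem numer_mod (f : Fin k → ℂ) (hf : boxes α β ⬝ᵥ f = 0) :
    numer α β b f %ₘ monicPhi α β b = numer α β b f := by
  rw [modByMonic_eq_self_iff (monic_monicPhi α β b hn),
    degree_eq_natDegree (monic_monicPhi α β b hn).ne_zero, natDegree_monicPhi α β b hn,
    degree_lt_iff_coeff_zero]
  intro j hj
  rcases hj.eq_or_lt with rfl | hj
  · rw [coeff_numer, hf]
  · exact coeff_eq_zero_of_natDegree_lt ((natDegree_numer_le α β b f).trans_lt hj)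

variable (hα : ∀ s, 0 < α s) (hb : Function.Injective b) (hk : 0 < k)
include hα hb

theorem eq_ofPoly (f : Fin k → ℂ) (hf : boxes α β ⬝ᵥ f = 0) (q : ℂ[X])
    (h : monicPhi α β b ∣ numer α β b f - q) : f = ofPoly α β b q := by
  rw [ofPoly_apply, ← (modByMonic_eq_of_dvd_sub (monic_monicPhi α β b hn) h),
    numer_mod α β b hn f hf, unnumer_numer α β b hα hb]

include hk

theorem numer_ofPoly (p : ℂ[X]) : numer α β b (ofPoly α β b p) = p %ₘ monicPhi α β b := by
  rw [ofPoly_apply, numer_unnumer α β b hα hb hk _ (natDegree_modByMonic_lt_card α β b hn hk p)]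

theorem boxes_dot_ofPoly (p : ℂ[X]) : boxes α β ⬝ᵥ ofPoly α β b p = 0 := by
  rw [← coeff_numer α β b, numer_ofPoly α β b hn hα hb hk, coeff_modByMonic_monicPhi α β b hn]

theorem ofPoly_eq_zero_iff (p : ℂ[X]) : ofPoly α β b p = 0 ↔ monicPhi α β b ∣ p := by
  rw [← modByMonic_eq_zero_iff_dvd (monic_monicPhi α β b hn)]
  refine ⟨fun h => ?_, fun h => by rw [ofPoly_apply, h, map_zero]⟩
  rw [← numer_ofPoly α β b hn hα hb hk, h, map_zero]

end

theorem dot_hopVec (r : ℕ) (f : Fin k → ℂ) : boxes α β ⬝ᵥ hopVec α β b r f = 0 := by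
  rw [hopVec_apply, dotProduct_sum]
  refine Finset.sum_eq_zero fun x _ => ?_
  have h : (boxes α β * b ^ x.2) ⬝ᵥ f = boxes α β ⬝ᵥ (b ^ x.2 * f) := by
    simp only [dotProduct, Pi.mul_apply, mul_assoc]
  rw [dotProduct_sub, dotProduct_smul, dotProduct_smul, h, zetaCoeff, smul_eq_mul, smul_eq_mul]
  ring

/-- Split off the boundary term of the antidiagonal from each of the two sums, at opposite ends, so
that one factor `b` comes out of both remaining sums. -/
theorem hopVec_succ (r : ℕ) (f : Fin k → ℂ) : hopVec α β b (r + 1) f =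
    b * hopVec α β b r f + zetaCoeff α β b (r + 1) • f -
      ((boxes α β * b ^ (r + 1)) ⬝ᵥ f) • 1 := by
  rw [hopVec_apply, hopVec_apply, Finset.sum_sub_distrib, Finset.sum_sub_distrib,
    Finset.Nat.sum_antidiagonal_succ', Finset.Nat.sum_antidiagonal_succ, mul_sub, Finset.mul_sum,
    Finset.mul_sum]
  simp only [pow_zero, one_mul, pow_succ', mul_smul_comm, mul_assoc]
  abel

/-- By `hopVec_succ` the recursion multiplies by `x` and adds a multiple of the starting vector and
a multiple of the constant vector. The last has numerator a multiple of `φ`, so the rank-one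
correction disappears modulo `φ`. -/
theorem hopVec_ofPoly (hn : boxes α β ⬝ᵥ 1 ≠ 0) (hα : ∀ s, 0 < α s) (hb : Function.Injective b)
    (hk : 0 < k) (r : ℕ) (p : ℂ[X]) : hopVec α β b r (ofPoly α β b p) =
      ∑ x ∈ Finset.HasAntidiagonal.antidiagonal r,
        zetaCoeff α β b x.1 • ofPoly α β b (X ^ x.2 * p) := by
  simp only [← map_smul, ← map_sum]
  refine eq_ofPoly α β b hn hα hb _ (dot_hopVec α β b r _) _ ?_
  have hp : monicPhi α β b ∣ numer α β b (ofPoly α β b p) - p := by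
    rw [numer_ofPoly α β b hn hα hb hk]
    exact ⟨-(p /ₘ monicPhi α β b), by
      have := modByMonic_add_div p (monicPhi α β b)
      linear_combination this⟩
  induction r with
  | zero =>
    simp only [hopVec_apply, Finset.Nat.antidiagonal_zero, Finset.sum_singleton, pow_zero, mul_one,
      one_mul, boxes_dot_ofPoly α β b hn hα hb hk, zero_smul, sub_zero, map_smul, ← smul_sub]
    rw [smul_eq_C_mul]
    exact Dvd.dvd.mul_left hp _
  | succ r ih =>
    have h1 := X_mul_numer α β b (hopVec α β b r (ofPoly α β b p))
    rw [dot_hopVec, C_0, zero_mul, add_zero] at h1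
    rw [hopVec_succ, map_sub, map_add, ← h1, map_smul, map_smul, numer_one, phi_eq α β b hn,
      Finset.Nat.sum_antidiagonal_succ']
    have e : ∑ x ∈ Finset.HasAntidiagonal.antidiagonal r,
        zetaCoeff α β b x.1 • (X ^ (x.2 + 1) * p) = X * ∑ x ∈ Finset.HasAntidiagonal.antidiagonal r,
        zetaCoeff α β b x.1 • (X ^ x.2 * p) := by
      rw [Finset.mul_sum]
      exact Finset.sum_congr rfl fun x _ => by rw [mul_smul_comm, pow_succ', mul_assoc]
    rw [e]
    obtain ⟨u, hu⟩ := ih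
    obtain ⟨w, hw⟩ := hp
    refine ⟨X * u + C (zetaCoeff α β b (r + 1)) * w -
      C (((boxes α β * b ^ (r + 1)) ⬝ᵥ ofPoly α β b p)) * C (boxes α β ⬝ᵥ 1), ?_⟩
    simp only [smul_eq_C_mul, pow_zero, one_mul] at hu ⊢
    linear_combination X * hu + C (zetaCoeff α β b (r + 1)) * hw

end

end

open Polynomial (aeval)

/-! ### Multivariate polynomials as multi-particle vectors -/

theorem mvPolynomial_lhom_ext {l : ℕ} {N : Type*} [AddCommGroup N] [Module ℂ N]
    {f g : MvPolynomial (Fin l) ℂ →ₗ[ℂ] N}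
    (h : ∀ μ, f (MvPolynomial.monomial μ 1) = g (MvPolynomial.monomial μ 1)) : f = g :=
  (MvPolynomial.basisMonomials (Fin l) ℂ).ext fun μ => by
    simpa only [MvPolynomial.coe_basisMonomials] using h μ

theorem monomial_eq_prod_aeval {l : ℕ} (μ : Fin l →₀ ℕ) :
    (MvPolynomial.monomial μ 1 : MvPolynomial (Fin l) ℂ) =
      ∏ i, aeval (MvPolynomial.X i : MvPolynomial (Fin l) ℂ) (Polynomial.X ^ μ i : Polynomial ℂ) := by
  rw [MvPolynomial.monomial_eq, MvPolynomial.C_1, one_mul, Finsupp.prod_fintype _ _ (by simp)]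
  simp

theorem aeval_mul_prod_aeval {l : ℕ} (i : Fin l) (p : Polynomial ℂ) (f : Fin l → Polynomial ℂ) :
    aeval (MvPolynomial.X i : MvPolynomial (Fin l) ℂ) p *
        ∏ j, aeval (MvPolynomial.X j : MvPolynomial (Fin l) ℂ) (f j) =
      ∏ j, aeval (MvPolynomial.X j : MvPolynomial (Fin l) ℂ) (Function.update f i (p * f i) j) := by
  rw [← Finset.mul_prod_erase Finset.univ _ (Finset.mem_univ i),
    ← Finset.mul_prod_erase Finset.univ (fun j => aeval (MvPolynomial.X j) (Function.update f i _ j))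
      (Finset.mem_univ i), Function.update_self, map_mul, mul_assoc]
  congr 2
  refine Finset.prod_congr rfl fun j hj => ?_
  rw [Function.update_of_ne (Finset.ne_of_mem_erase hj)]

section
variable {k : ℕ} (α β : Fin k → ℕ) (b : Fin k → ℂ)

/-- The linear map `z_1^{μ_1} ⋯ z_l^{μ_l} ↦ x^{μ_1} ∧ ⋯ ∧ x^{μ_l}`. -/
def polyWedge (l : ℕ) : MvPolynomial (Fin l) ℂ →ₗ[ℂ] ExteriorAlgebra ℂ (Fin k → ℂ) :=
  (MvPolynomial.basisMonomials (Fin l) ℂ).constr ℂ fun μ =>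
    ExteriorAlgebra.ιMulti ℂ l fun i => ofPoly α β b (Polynomial.X ^ μ i)

theorem polyWedge_monomial {l : ℕ} (μ : Fin l →₀ ℕ) :
    polyWedge α β b l (MvPolynomial.monomial μ 1) =
      ExteriorAlgebra.ιMulti ℂ l fun i => ofPoly α β b (Polynomial.X ^ μ i) := by
  have h := (MvPolynomial.basisMonomials (Fin l) ℂ).constr_basis ℂ (fun μ : Fin l →₀ ℕ =>
    ExteriorAlgebra.ιMulti ℂ l fun i => ofPoly α β b (Polynomial.X ^ μ i)) μ
  rwa [MvPolynomial.coe_basisMonomials] at h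

/-- Both sides are multilinear in `p`, and for powers of `x` this is the definition on monomials. -/
theorem polyWedge_prod {l : ℕ} (p : Fin l → Polynomial ℂ) :
    polyWedge α β b l (∏ i, aeval (MvPolynomial.X i) (p i)) =
      ExteriorAlgebra.ιMulti ℂ l fun i => ofPoly α β b (p i) := by
  have h : (polyWedge α β b l).compMultilinearMap
      ((MultilinearMap.mkPiAlgebra ℂ (Fin l) (MvPolynomial (Fin l) ℂ)).compLinearMap
        fun i => (aeval (MvPolynomial.X i : MvPolynomial (Fin l) ℂ)).toLinearMap) =
      (ExteriorAlgebra.ιMulti ℂ l).toMultilinearMap.compLinearMap fun _ => ofPoly α β b := by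
    refine Module.Basis.ext_multilinear (fun _ => Polynomial.basisMonomials ℂ) fun μ => ?_
    have := polyWedge_monomial α β b (Finsupp.equivFunOnFinite.symm μ)
    rw [monomial_eq_prod_aeval] at this
    simpa [← Polynomial.X_pow_eq_monomial] using this
  exact congrArg (fun F => F p) h

/-- The linear map from polynomials in `l` variables to the tensor space. -/
def wordPoly (l : ℕ) : MvPolynomial (Fin l) ℂ →ₗ[ℂ] TensorSpace k := fock k ∘ₗ polyWedge α β b l

theorem wordPoly_prod {l : ℕ} (p : Fin l → Polynomial ℂ) :
    wordPoly α β b l (∏ i, aeval (MvPolynomial.X i) (p i)) =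
      word k l fun i => ofPoly α β b (p i) := by
  rw [wordPoly, LinearMap.comp_apply, polyWedge_prod]
  rfl

theorem wordPoly_monomial {l : ℕ} (μ : Fin l →₀ ℕ) :
    wordPoly α β b l (MvPolynomial.monomial μ 1) =
      word k l fun i => ofPoly α β b (Polynomial.X ^ μ i) := by
  rw [monomial_eq_prod_aeval, wordPoly_prod]

/-- Permuting the variables of a monomial permutes the letters of an alternating word. -/
theorem wordPoly_rename {l : ℕ} (σ : Equiv.Perm (Fin l)) (q : MvPolynomial (Fin l) ℂ) :
    wordPoly α β b l (MvPolynomial.rename σ q) =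
      (Equiv.Perm.sign σ : ℤ) • wordPoly α β b l q := by
  have h : wordPoly α β b l ∘ₗ (MvPolynomial.rename σ).toLinearMap =
      (Equiv.Perm.sign σ : ℤ) • wordPoly α β b l := by
    refine mvPolynomial_lhom_ext fun μ => ?_
    rw [LinearMap.comp_apply, AlgHom.toLinearMap_apply, MvPolynomial.rename_monomial,
      wordPoly_monomial, LinearMap.smul_apply, wordPoly_monomial]
    have := (word k l).map_perm (fun i => ofPoly α β b (Polynomial.X ^ μ i)) σ⁻¹
    rw [Equiv.Perm.sign_inv] at this
    rw [← Units.smul_def, ← this]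
    congr 1
    funext i
    simp only [Function.comp_apply]
    congr 2
    rw [← Finsupp.mapDomain_apply σ.injective μ (σ⁻¹ i)]
    simp
  exact LinearMap.congr_fun h q

theorem wordPoly_mul_eq_zero {l : ℕ} (i : Fin l) (p : Polynomial ℂ)
    (hp : ∀ g, ofPoly α β b (p * g) = 0) (q : MvPolynomial (Fin l) ℂ) :
    wordPoly α β b l (aeval (MvPolynomial.X i) p * q) = 0 := by
  have h : wordPoly α β b l ∘ₗ LinearMap.mulLeft ℂ (aeval (MvPolynomial.X i) p) = 0 := by
    refine mvPolynomial_lhom_ext fun μ => ?_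
    rw [LinearMap.comp_apply, LinearMap.mulLeft_apply, monomial_eq_prod_aeval,
      aeval_mul_prod_aeval, wordPoly_prod, LinearMap.zero_apply]
    refine (word k l).map_coord_zero i ?_
    rw [Function.update_self, hp]
  exact LinearMap.congr_fun h q

/-- Multiplication by a power sum is the derivation of the exterior power induced by multiplication
by `x ^ r`; this links power sums to `hopOp`. -/
theorem wordPoly_psum_mul {l : ℕ} (r : ℕ) (p : Fin l → Polynomial ℂ) :
    wordPoly α β b l (MvPolynomial.psum (Fin l) ℂ r * ∏ i, aeval (MvPolynomial.X i) (p i)) =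
      ∑ i, word k l (Function.update (fun j => ofPoly α β b (p j)) i
        (ofPoly α β b (Polynomial.X ^ r * p i))) := by
  rw [MvPolynomial.psum, Finset.sum_mul, map_sum]
  refine Finset.sum_congr rfl fun i _ => ?_
  have : (MvPolynomial.X i ^ r : MvPolynomial (Fin l) ℂ) =
      aeval (MvPolynomial.X i : MvPolynomial (Fin l) ℂ) (Polynomial.X ^ r : Polynomial ℂ) := by simp
  rw [this, aeval_mul_prod_aeval, wordPoly_prod]
  congr 1
  funext j
  by_cases h : j = i
  · subst h; simp
  · simp [h]

theorem ι_mul_ιMulti (l : ℕ) (h : Fin k → ℂ) (f : Fin l → Fin k → ℂ) :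
    ExteriorAlgebra.ιMulti ℂ l f * ExteriorAlgebra.ι ℂ h =
      (-1 : ℂ) ^ l • (ExteriorAlgebra.ι ℂ h * ExteriorAlgebra.ιMulti ℂ l f) := by
  induction l with
  | zero => simp
  | succ l ih =>
    rw [ExteriorAlgebra.ιMulti_succ_apply, mul_assoc, ih, mul_smul_comm, ← mul_assoc, ← mul_assoc,
      eq_neg_of_add_eq_zero_left (ExteriorAlgebra.ι_add_mul_swap (R := ℂ) (f 0) h), pow_succ,
      mul_smul, neg_mul, neg_one_smul]

theorem polyWedge_mul_ι {l : ℕ} (h : Fin k → ℂ) (q : MvPolynomial (Fin l) ℂ) :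
    polyWedge α β b l q * ExteriorAlgebra.ι ℂ h =
      (-1 : ℂ) ^ l • (ExteriorAlgebra.ι ℂ h * polyWedge α β b l q) := by
  have : LinearMap.mulRight ℂ (ExteriorAlgebra.ι ℂ h) ∘ₗ polyWedge α β b l =
      (-1 : ℂ) ^ l • (LinearMap.mulLeft ℂ (ExteriorAlgebra.ι ℂ h) ∘ₗ polyWedge α β b l) := by
    refine mvPolynomial_lhom_ext fun μ => ?_
    simp only [LinearMap.comp_apply, LinearMap.smul_apply, LinearMap.mulRight_apply,
      LinearMap.mulLeft_apply, polyWedge_monomial, ι_mul_ιMulti]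
  exact LinearMap.congr_fun this q

/-- An element of the exterior algebra commutes up to sign with creation operators, so if it kills
the vacuum it kills every word. This makes products well defined on the tensor space without knowing
that `fock` is injective. -/
theorem wedgeAct_word_eq_zero {l l' : ℕ} (q : MvPolynomial (Fin l) ℂ)
    (hq : wordPoly α β b l q = 0) (f : Fin l' → Fin k → ℂ) :
    wedgeAct k (polyWedge α β b l q) (word k l' f) = 0 := by
  induction l' with
  | zero => rw [word_zero]; exact hq
  | succ l' ih =>
    have h := congrArg (wedgeAct k) (polyWedge_mul_ι α β b (f 0) q)
    rw [map_mul, map_smul, map_mul, wedgeAct_ι] at h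
    have h' := LinearMap.congr_fun h (word k l' fun i => f i.succ)
    rw [word_succ]
    rw [Module.End.mul_apply, LinearMap.smul_apply, Module.End.mul_apply, ih, map_zero,
      smul_zero] at h'
    exact h'

/-! ### Blocks of variables and exterior products -/

/-- Polynomials in the first `l` of `l + l'` variables. -/
def firstVars (l l' : ℕ) : MvPolynomial (Fin l) ℂ →ₐ[ℂ] MvPolynomial (Fin (l + l')) ℂ :=
  MvPolynomial.rename (Fin.castAdd l')

/-- Polynomials in the last `l'` of `l + l'` variables. -/
def lastVars (l l' : ℕ) : MvPolynomial (Fin l') ℂ →ₐ[ℂ] MvPolynomial (Fin (l + l')) ℂ :=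
  MvPolynomial.rename (Fin.natAdd l)

theorem firstVars_monomial_mul {l l' : ℕ} (μ : Fin l →₀ ℕ) (μ' : Fin l' →₀ ℕ) :
    firstVars l l' (MvPolynomial.monomial μ 1) * lastVars l l' (MvPolynomial.monomial μ' 1) =
      MvPolynomial.monomial (Finsupp.equivFunOnFinite.symm (Fin.append μ μ')) 1 := by
  rw [monomial_eq_prod_aeval, monomial_eq_prod_aeval, monomial_eq_prod_aeval, map_prod, map_prod,
    Fin.prod_univ_add]
  simp [firstVars, lastVars]

/-- A product of polynomials in disjoint blocks of variables corresponds to the exterior product, so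
a factor that vanishes in the Fock space makes the whole product vanish. -/
theorem wordPoly_mul_of_eq_zero {l l' : ℕ} (q : MvPolynomial (Fin l) ℂ)
    (hq : wordPoly α β b l q = 0) (q' : MvPolynomial (Fin l') ℂ) :
    wordPoly α β b (l + l') (firstVars l l' q * lastVars l l' q') = 0 := by
  have h1 : ∀ q, polyWedge α β b (l + l') (firstVars l l' q * lastVars l l' q') =
      polyWedge α β b l q * polyWedge α β b l' q' := by
    intro q
    have : ((LinearMap.mul ℂ _).compl₁₂ (firstVars l l').toLinearMap
          (lastVars l l').toLinearMap).compr₂ (polyWedge α β b (l + l')) =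
        (LinearMap.mul ℂ _).compl₁₂ (polyWedge α β b l) (polyWedge α β b l') := by
      refine mvPolynomial_lhom_ext fun μ => mvPolynomial_lhom_ext fun μ' => ?_
      simp only [LinearMap.compr₂_apply, LinearMap.compl₁₂_apply, LinearMap.mul_apply',
        AlgHom.toLinearMap_apply, firstVars_monomial_mul, polyWedge_monomial,
        ExteriorAlgebra.ιMulti_mul_ιMulti]
      congr 1
      funext i
      refine Fin.addCases (fun i => ?_) (fun i => ?_) i <;> simp
    exact LinearMap.congr_fun (LinearMap.congr_fun this q) q'
  rw [wordPoly, LinearMap.comp_apply, h1, fock_apply, map_mul, Module.End.mul_apply]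
  have h2 : (wedgeAct k (polyWedge α β b l q)) ∘ₗ wordPoly α β b l' = 0 := by
    refine mvPolynomial_lhom_ext fun μ => ?_
    rw [LinearMap.comp_apply, wordPoly_monomial, wedgeAct_word_eq_zero α β b q hq,
      LinearMap.zero_apply]
  exact LinearMap.congr_fun h2 q'

/-- The monomial `z_2 z_3^2 ⋯ z_l^{l-1}`. -/
def staircase (l : ℕ) : MvPolynomial (Fin l) ℂ :=
  MvPolynomial.monomial (Finsupp.equivFunOnFinite.symm fun i : Fin l => (i : ℕ)) 1

section
variable (hα : ∀ s, 0 < α s) (hb : Function.Injective b) (hk : 0 < k)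
include hα hb hk

theorem wordPoly_mem_M {l : ℕ} (q : MvPolynomial (Fin l) ℂ) :
    wordPoly α β b l q ∈ M α β b l := by
  induction q using MvPolynomial.induction_on' with
  | monomial μ a =>
    rw [← mul_one a, ← smul_eq_mul, ← MvPolynomial.smul_monomial, map_smul, wordPoly_monomial]
    exact Submodule.smul_mem _ _ (mem_M_of_word α β b _ fun i =>
      boxes_dot_ofPoly α β b (boxes_dot_one_ne_zero α β hα hk) hα hb hk _)
  | add p q hp hq => rw [map_add]; exact Submodule.add_mem _ hp hq

theorem exists_wordPoly_eq {l : ℕ} {v : TensorSpace k} (hv : v ∈ M α β b l) :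
    ∃ q, wordPoly α β b l q = v := by
  have hn := boxes_dot_one_ne_zero α β hα hk
  rw [M_eq_span α β b hn] at hv
  change v ∈ LinearMap.range (wordPoly α β b l)
  refine Submodule.span_le.2 ?_ hv
  rintro _ ⟨f, hf, rfl⟩
  refine ⟨∏ i, aeval (MvPolynomial.X i) (numer α β b (f i)), ?_⟩
  rw [wordPoly_prod]
  congr 1
  funext i
  exact (eq_ofPoly α β b hn hα hb (f i) (hf i) _ (by simp)).symm

theorem wordPoly_monicPhi_mul {l : ℕ} (i : Fin l) (q : MvPolynomial (Fin l) ℂ) :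
    wordPoly α β b l (aeval (MvPolynomial.X i) (monicPhi α β b) * q) = 0 := by
  refine wordPoly_mul_eq_zero α β b i _ (fun g => ?_) q
  exact (ofPoly_eq_zero_iff α β b (boxes_dot_one_ne_zero α β hα hk) hα hb hk _).2 (dvd_mul_right _ _)

/-- The Leibniz rule for `hopOp` together with `hopVec_ofPoly` matches the derivation description of
multiplication by power sums. -/
theorem hopOp_wordPoly {l : ℕ} (r : ℕ) (q : MvPolynomial (Fin l) ℂ) :
    hopOp α β b r (wordPoly α β b l q) = ∑ x ∈ Finset.HasAntidiagonal.antidiagonal r,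
      zetaCoeff α β b x.1 • wordPoly α β b l (MvPolynomial.psum (Fin l) ℂ x.2 * q) := by
  have h : hopOp α β b r ∘ₗ wordPoly α β b l = ∑ x ∈ Finset.HasAntidiagonal.antidiagonal r,
      zetaCoeff α β b x.1 •
        (wordPoly α β b l ∘ₗ LinearMap.mulLeft ℂ (MvPolynomial.psum (Fin l) ℂ x.2)) := by
    refine mvPolynomial_lhom_ext fun μ => ?_
    simp only [LinearMap.comp_apply, LinearMap.sum_apply, LinearMap.smul_apply,
      LinearMap.mulLeft_apply]
    rw [monomial_eq_prod_aeval]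
    simp only [wordPoly_psum_mul]
    rw [wordPoly_prod, hopOp_word]
    simp only [Finset.smul_sum]
    rw [Finset.sum_comm]
    refine Finset.sum_congr rfl fun i _ => ?_
    rw [hopVec_ofPoly α β b (boxes_dot_one_ne_zero α β hα hk) hα hb hk,
      AlternatingMap.map_update_sum]
    simp only [AlternatingMap.map_update_smul]
  simpa using LinearMap.congr_fun h q

/-- The letters are the classes of `1, x, …, x^{m-1}`, which are independent modulo `φ` because `φ`
has degree `k - 1 = m`. -/
theorem wordPoly_staircase_ne_zero {m : ℕ} (hm : m + 1 = k) :
    wordPoly α β b m (staircase m) ≠ 0 := by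
  have hn := boxes_dot_one_ne_zero α β hα hk
  rw [staircase, wordPoly_monomial]
  refine word_ne_zero _ ?_
  rw [Fintype.linearIndependent_iff]
  intro g hg
  simp only [← map_smul, ← map_sum, Finsupp.equivFunOnFinite_symm_apply_apply] at hg
  rw [ofPoly_eq_zero_iff α β b hn hα hb hk] at hg
  have hdeg : (∑ i : Fin m, g i • (Polynomial.X : Polynomial ℂ) ^ (i : ℕ)).degree <
      (monicPhi α β b).degree := by
    rw [Polynomial.degree_eq_natDegree (monic_monicPhi α β b hn).ne_zero,
      natDegree_monicPhi α β b hn, Polynomial.degree_lt_iff_coeff_zero]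
    intro j hj
    rw [Polynomial.finsetSum_coeff]
    refine Finset.sum_eq_zero fun i _ => ?_
    rw [Polynomial.coeff_smul, Polynomial.coeff_X_pow, if_neg (by omega), smul_zero]
  have h0 := Polynomial.eq_zero_of_dvd_of_degree_lt hg hdeg
  intro i
  have := congrArg (fun p => Polynomial.coeff p i) h0
  simpa [Polynomial.finsetSum_coeff, Polynomial.coeff_X_pow, Fin.val_inj] using this

end

end

/-! ### Polynomials modulo antisymmetry -/

/-- The product `p_1(z_1) ⋯ p_l(z_l)`. -/
def prodVars {l : ℕ} (p : Fin l → Polynomial ℂ) : MvPolynomial (Fin l) ℂ :=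
  ∏ i, aeval (MvPolynomial.X i : MvPolynomial (Fin l) ℂ) (p i)

theorem aeval_mul_prodVars {l : ℕ} (i : Fin l) (p : Polynomial ℂ) (f : Fin l → Polynomial ℂ) :
    aeval (MvPolynomial.X i : MvPolynomial (Fin l) ℂ) p * prodVars f =
      prodVars (Function.update f i (p * f i)) :=
  aeval_mul_prod_aeval i p f

theorem monomial_eq_prodVars {l : ℕ} (μ : Fin l →₀ ℕ) :
    (MvPolynomial.monomial μ 1 : MvPolynomial (Fin l) ℂ) =
      prodVars fun i => Polynomial.X ^ μ i :=
  monomial_eq_prod_aeval μ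

theorem staircase_eq (l : ℕ) : staircase l = prodVars fun i => Polynomial.X ^ (i : ℕ) := by
  rw [staircase, monomial_eq_prodVars]
  rfl

theorem rename_prodVars {l : ℕ} (σ : Equiv.Perm (Fin l)) (p : Fin l → Polynomial ℂ) :
    MvPolynomial.rename σ (prodVars (p ∘ σ)) = prodVars p := by
  rw [prodVars, map_prod, prodVars,
    ← Equiv.prod_comp σ fun i => aeval (MvPolynomial.X i : MvPolynomial (Fin l) ℂ) (p i)]
  refine Finset.prod_congr rfl fun i _ => ?_
  rw [← Polynomial.aeval_algHom_apply, MvPolynomial.rename_X, Function.comp_apply]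

/-- The span of the differences `q - sgn(σ) σ(q)`. -/
def altSub (l : ℕ) : Submodule ℂ (MvPolynomial (Fin l) ℂ) :=
  Submodule.span ℂ {x | ∃ (σ : Equiv.Perm (Fin l)) (q : MvPolynomial (Fin l) ℂ),
    x = q - (Equiv.Perm.sign σ : ℤ) • MvPolynomial.rename σ q}

theorem sub_rename_mem_altSub {l : ℕ} (σ : Equiv.Perm (Fin l)) (q : MvPolynomial (Fin l) ℂ) :
    q - (Equiv.Perm.sign σ : ℤ) • MvPolynomial.rename σ q ∈ altSub l :=
  Submodule.subset_span ⟨σ, q, rfl⟩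

theorem altSub_le_ker {l : ℕ} {N : Type*} [AddCommGroup N] [Module ℂ N]
    (f : MvPolynomial (Fin l) ℂ →ₗ[ℂ] N)
    (hf : ∀ (σ : Equiv.Perm (Fin l)) q,
      f (MvPolynomial.rename σ q) = (Equiv.Perm.sign σ : ℤ) • f q) :
    altSub l ≤ LinearMap.ker f := by
  refine Submodule.span_le.2 ?_
  rintro _ ⟨σ, q, rfl⟩
  rw [SetLike.mem_coe, LinearMap.mem_ker, map_sub, map_zsmul, hf, smul_smul, ← Units.val_mul,
    Int.units_mul_self, Units.val_one, one_smul, sub_self]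

theorem mul_mem_altSub {l : ℕ} {s : MvPolynomial (Fin l) ℂ} (hs : s.IsSymmetric)
    {q : MvPolynomial (Fin l) ℂ} (hq : q ∈ altSub l) : s * q ∈ altSub l := by
  have : altSub l ≤ (altSub l).comap (LinearMap.mulLeft ℂ s) := by
    refine Submodule.span_le.2 ?_
    rintro _ ⟨σ, q, rfl⟩
    rw [SetLike.mem_coe, Submodule.mem_comap, LinearMap.mulLeft_apply, mul_sub, mul_smul_comm]
    have h := sub_rename_mem_altSub σ (s * q)
    rwa [map_mul, hs σ] at h
  exact this hq

/-- A transposition of two equal factors fixes the product and has sign `-1`, so twice the product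
is a relation. -/
theorem prodVars_mem_altSub {l : ℕ} (p : Fin l → Polynomial ℂ) (hp : ¬ Function.Injective p) :
    prodVars p ∈ altSub l := by
  obtain ⟨i, j, hij, hne⟩ : ∃ i j, p i = p j ∧ i ≠ j := by
    simpa [Function.Injective] using hp
  have h := sub_rename_mem_altSub (Equiv.swap i j) (prodVars p)
  have e : p ∘ Equiv.swap i j = p := by
    funext a
    rcases eq_or_ne a i with rfl | h1
    · simp [hij]
    rcases eq_or_ne a j with rfl | h2
    · simp [hij]
    · simp [Equiv.swap_apply_of_ne_of_ne h1 h2]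
  have e2 := rename_prodVars (Equiv.swap i j) p
  rw [e] at e2
  rw [e2, Equiv.Perm.sign_swap hne] at h
  simp only [Units.val_neg, Units.val_one, neg_smul, one_smul, sub_neg_eq_add] at h
  rw [← two_smul ℂ] at h
  exact (Submodule.smul_mem_iff _ two_ne_zero).1 h

theorem prodVars_comp_perm_sub_mem {l : ℕ} (p : Fin l → Polynomial ℂ) (σ : Equiv.Perm (Fin l)) :
    prodVars (p ∘ σ) - (Equiv.Perm.sign σ : ℤ) • prodVars p ∈ altSub l := by
  have := sub_rename_mem_altSub σ (prodVars (p ∘ σ))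
  rwa [rename_prodVars] at this

/-- The polynomial `∏ (x - z_i)`. -/
def charPoly (l : ℕ) : Polynomial (MvPolynomial (Fin l) ℂ) :=
  ∏ i, (Polynomial.X - Polynomial.C (MvPolynomial.X i))

theorem charPoly_monic (l : ℕ) : (charPoly l).Monic :=
  Polynomial.monic_prod_of_monic _ _ fun _ _ => Polynomial.monic_X_sub_C _

theorem natDegree_charPoly (l : ℕ) : (charPoly l).natDegree = l := by
  rw [charPoly, Polynomial.natDegree_prod_of_monic _ _ fun _ _ => Polynomial.monic_X_sub_C _]
  simp

theorem eval_charPoly {l : ℕ} (i : Fin l) : (charPoly l).eval (MvPolynomial.X i) = 0 := by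
  rw [charPoly, Polynomial.eval_prod]
  exact Finset.prod_eq_zero (Finset.mem_univ i) (by simp)

theorem map_rename_charPoly {l : ℕ} (σ : Equiv.Perm (Fin l)) :
    (charPoly l).map (MvPolynomial.rename σ : _ →ₐ[ℂ] MvPolynomial (Fin l) ℂ).toRingHom =
      charPoly l := by
  rw [charPoly, Polynomial.map_prod, ← Equiv.prod_comp σ fun i =>
    (Polynomial.X - Polynomial.C (MvPolynomial.X i : MvPolynomial (Fin l) ℂ))]
  refine Finset.prod_congr rfl fun i _ => ?_
  simp

theorem coeff_charPoly_isSymmetric (l j : ℕ) : ((charPoly l).coeff j).IsSymmetric := by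
  intro σ
  conv_rhs => rw [← map_rename_charPoly σ, Polynomial.coeff_map]
  rfl

/-- Each `z_i` is a root of the monic polynomial `charPoly l`, whose coefficients are symmetric.
High powers of a variable can therefore be lowered with symmetric coefficients. -/
theorem X_pow_eq_neg_sum {l : ℕ} (i : Fin l) : (MvPolynomial.X i : MvPolynomial (Fin l) ℂ) ^ l =
    -∑ j ∈ Finset.range l, (charPoly l).coeff j * MvPolynomial.X i ^ j := by
  have h := eval_charPoly i
  rw [(charPoly_monic l).as_sum, natDegree_charPoly] at h
  rw [eq_neg_iff_add_eq_zero, ← h]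
  simp [Polynomial.eval_finsetSum]

/-- Modulo antisymmetry the polynomials form a module over the symmetric ones generated by the
staircase; this is the source of the cyclic vector. Exponents at least `l` are lowered by
`X_pow_eq_neg_sum`. Once all are below `l`, they either repeat, giving zero, or permute `0, …, l -
1`, giving a signed staircase. -/
theorem exists_symmetric_mul_staircase {l : ℕ} (q : MvPolynomial (Fin l) ℂ) :
    ∃ s : MvPolynomial (Fin l) ℂ, s.IsSymmetric ∧ q - s * staircase l ∈ altSub l := by
  have hmono : ∀ (d : ℕ) (μ : Fin l → ℕ), ∑ i, μ i = d → ∃ s : MvPolynomial (Fin l) ℂ,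
      s.IsSymmetric ∧ prodVars (fun i => Polynomial.X ^ μ i) - s * staircase l ∈ altSub l := by
    intro d
    induction d using Nat.strong_induction_on with
    | _ d ih =>
      intro μ hμ
      by_cases hlt : ∀ i, μ i < l
      · by_cases hinj : Function.Injective μ
        · let f : Fin l → Fin l := fun i => ⟨μ i, hlt i⟩
          have hf : Function.Injective f := fun i j h => hinj (Fin.mk.inj_iff.1 h)
          let σ : Equiv.Perm (Fin l) := Equiv.ofBijective f (Finite.injective_iff_bijective.1 hf)
          refine ⟨MvPolynomial.C ((Equiv.Perm.sign σ : ℤ) : ℂ), MvPolynomial.IsSymmetric.C _, ?_⟩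
          have h := prodVars_comp_perm_sub_mem
            (fun i : Fin l => (Polynomial.X : Polynomial ℂ) ^ (i : ℕ)) σ
          rw [← staircase_eq] at h
          rw [← MvPolynomial.smul_eq_C_mul, Int.cast_smul_eq_zsmul]
          exact h
        · refine ⟨0, MvPolynomial.IsSymmetric.zero, ?_⟩
          rw [zero_mul, sub_zero]
          refine prodVars_mem_altSub _ fun h => hinj fun i j hij => h ?_
          simp only [hij]
      · push Not at hlt
        obtain ⟨i, hi⟩ := hlt
        have hl : 0 < l := i.pos
        have hsum : ∀ c, ∑ a, Function.update μ i c a + μ i = c + d := by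
          intro c
          rw [Finset.sum_update_of_mem (Finset.mem_univ i), ← hμ,
            ← Finset.add_sum_erase Finset.univ μ (Finset.mem_univ i), Finset.sdiff_singleton_eq_erase]
          ring
        have hIH : ∀ j < l, ∃ s : MvPolynomial (Fin l) ℂ, s.IsSymmetric ∧
            prodVars (fun a => Polynomial.X ^ Function.update μ i (j + (μ i - l)) a) -
              s * staircase l ∈ altSub l := by
          intro j hj
          refine ih _ ?_ _ rfl
          have := hsum (j + (μ i - l))
          omega
        choose! s hs hs' using hIH
        have hX : ∀ j c, MvPolynomial.X i ^ j *
            prodVars (fun a => Polynomial.X ^ Function.update μ i c a) =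
            prodVars (fun a => Polynomial.X ^ Function.update μ i (j + c) a) := by
          intro j c
          have e : (MvPolynomial.X i : MvPolynomial (Fin l) ℂ) ^ j =
            aeval (MvPolynomial.X i : MvPolynomial (Fin l) ℂ) (Polynomial.X ^ j : Polynomial ℂ) := by
            simp
          rw [e, aeval_mul_prodVars]
          congr 1
          funext a
          by_cases h : a = i
          · subst h; simp [pow_add]
          · simp [h]
        refine ⟨-∑ j ∈ Finset.range l, (charPoly l).coeff j * s j, ?_, ?_⟩
        · refine MvPolynomial.IsSymmetric.neg ?_
          have : ∑ j ∈ Finset.range l, (charPoly l).coeff j * s j ∈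
              MvPolynomial.symmetricSubalgebra (Fin l) ℂ :=
            Subalgebra.sum_mem _ fun j hj => Subalgebra.mul_mem _ (coeff_charPoly_isSymmetric l j)
              (hs j (Finset.mem_range.1 hj))
          exact this
        · have e : prodVars (fun a => Polynomial.X ^ μ a) = -∑ j ∈ Finset.range l,
              (charPoly l).coeff j *
                prodVars (fun a => Polynomial.X ^ Function.update μ i (j + (μ i - l)) a) := by
            have h1 := hX l (μ i - l)
            rw [Nat.add_sub_of_le hi, Function.update_eq_self, X_pow_eq_neg_sum, neg_mul,
              Finset.sum_mul] at h1
            rw [← h1]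
            congr 1
            exact Finset.sum_congr rfl fun j _ => by rw [mul_assoc, hX]
          rw [e, neg_mul, sub_neg_eq_add, neg_add_eq_sub, ← neg_sub, Finset.sum_mul,
            ← Finset.sum_sub_distrib]
          refine Submodule.neg_mem _ (Submodule.sum_mem _ fun j hj => ?_)
          rw [mul_assoc, ← mul_sub]
          exact mul_mem_altSub (coeff_charPoly_isSymmetric l j) (hs' j (Finset.mem_range.1 hj))
  induction q using MvPolynomial.induction_on' with
  | monomial μ a =>
    obtain ⟨s, hs, h⟩ := hmono _ μ rfl
    refine ⟨MvPolynomial.C a * s, (MvPolynomial.IsSymmetric.C a).mul hs, ?_⟩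
    have e : MvPolynomial.monomial μ a = MvPolynomial.C a * prodVars fun i => Polynomial.X ^ μ i := by
      rw [← monomial_eq_prodVars, MvPolynomial.C_mul_monomial, mul_one]
    rw [e, mul_assoc, ← mul_sub]
    exact mul_mem_altSub (MvPolynomial.IsSymmetric.C a) h
  | add p q hp hq =>
    obtain ⟨s, hs, h⟩ := hp
    obtain ⟨t, ht, h'⟩ := hq
    refine ⟨s + t, hs.add ht, ?_⟩
    rw [add_mul, add_sub_add_comm]
    exact Submodule.add_mem _ h h'

/-! ### Antisymmetrization -/

/-- The operator `∑ sgn(σ) σ`. -/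
def alternant (l : ℕ) : MvPolynomial (Fin l) ℂ →ₗ[ℂ] MvPolynomial (Fin l) ℂ :=
  ∑ σ : Equiv.Perm (Fin l), (Equiv.Perm.sign σ : ℤ) • (MvPolynomial.rename σ).toLinearMap

theorem alternant_apply {l : ℕ} (q : MvPolynomial (Fin l) ℂ) :
    alternant l q = ∑ σ : Equiv.Perm (Fin l),
      (Equiv.Perm.sign σ : ℤ) • MvPolynomial.rename σ q := by
  simp [alternant, LinearMap.sum_apply]

theorem alternant_rename {l : ℕ} (σ : Equiv.Perm (Fin l)) (q : MvPolynomial (Fin l) ℂ) :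
    alternant l (MvPolynomial.rename σ q) = (Equiv.Perm.sign σ : ℤ) • alternant l q := by
  rw [alternant_apply, alternant_apply, ← Equiv.sum_comp (Equiv.mulRight σ) (fun τ =>
    (Equiv.Perm.sign τ : ℤ) • MvPolynomial.rename τ q), Finset.smul_sum]
  refine Finset.sum_congr rfl fun τ _ => ?_
  rw [MvPolynomial.rename_rename, Equiv.coe_mulRight, Equiv.Perm.sign_mul, smul_smul,
    Units.val_mul, mul_left_comm, ← Units.val_mul, Int.units_mul_self, Units.val_one, mul_one]
  rfl

theorem alternant_mul {l : ℕ} {s : MvPolynomial (Fin l) ℂ} (hs : s.IsSymmetric)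
    (q : MvPolynomial (Fin l) ℂ) : alternant l (s * q) = s * alternant l q := by
  rw [alternant_apply, alternant_apply, Finset.mul_sum]
  refine Finset.sum_congr rfl fun σ _ => ?_
  rw [map_mul, hs σ, mul_smul_comm]

/-- The alternant of the staircase is the Vandermonde determinant in distinct variables. -/
theorem alternant_staircase_ne_zero (l : ℕ) : alternant l (staircase l) ≠ 0 := by
  have h : alternant l (staircase l) =
      (Matrix.vandermonde (MvPolynomial.X : Fin l → MvPolynomial (Fin l) ℂ)).det := by
    rw [alternant_apply, Matrix.det_apply]
    refine Finset.sum_congr rfl fun σ _ => ?_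
    rw [Units.smul_def, staircase_eq, prodVars, map_prod]
    congr 1
    refine Finset.prod_congr rfl fun i _ => ?_
    simp [Matrix.vandermonde_apply]
  rw [h, Matrix.det_vandermonde_ne_zero_iff]
  exact MvPolynomial.X_injective

/-- Antisymmetrization kills the relations and is linear over symmetric polynomials, so it yields
`s` times the Vandermonde determinant. With `exists_symmetric_mul_staircase`, this makes the
quotient by antisymmetry free of rank one over the symmetric polynomials. -/
theorem eq_zero_of_mul_staircase_mem {l : ℕ} {s : MvPolynomial (Fin l) ℂ} (hs : s.IsSymmetric)
    (h : s * staircase l ∈ altSub l) : s = 0 := by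
  have h0 := altSub_le_ker (alternant l) alternant_rename h
  rw [LinearMap.mem_ker, alternant_mul hs] at h0
  exact (mul_eq_zero.1 h0).resolve_right (alternant_staircase_ne_zero l)

/-! ### Power sums generate the symmetric polynomials -/

/-- Newton's identities express `j • esymm j` through power sums and lower elementary symmetric
polynomials, and `j` is invertible in `ℂ`. -/
theorem adjoin_psum (l : ℕ) : Algebra.adjoin ℂ (Set.range (MvPolynomial.psum (Fin l) ℂ)) =
    MvPolynomial.symmetricSubalgebra (Fin l) ℂ := by
  refine le_antisymm (Algebra.adjoin_le ?_) ?_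
  · rintro _ ⟨r, rfl⟩
    exact MvPolynomial.psum_isSymmetric (Fin l) ℂ r
  have hes : ∀ j, MvPolynomial.esymm (Fin l) ℂ j ∈
      Algebra.adjoin ℂ (Set.range (MvPolynomial.psum (Fin l) ℂ)) := by
    intro j
    induction j using Nat.strong_induction_on with
    | _ j ih =>
      rcases Nat.eq_zero_or_pos j with rfl | hj
      · rw [MvPolynomial.esymm_zero]; exact Subalgebra.one_mem _
      have h := MvPolynomial.mul_esymm_eq_sum (Fin l) ℂ j
      have h1 : (j : ℂ) • MvPolynomial.esymm (Fin l) ℂ j ∈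
          Algebra.adjoin ℂ (Set.range (MvPolynomial.psum (Fin l) ℂ)) := by
        rw [MvPolynomial.smul_eq_C_mul, map_natCast, h]
        refine Subalgebra.mul_mem _ (Subalgebra.pow_mem _ (Subalgebra.neg_mem _
          (Subalgebra.one_mem _)) _) (Subalgebra.sum_mem _ fun a ha => ?_)
        exact Subalgebra.mul_mem _ (Subalgebra.mul_mem _ (Subalgebra.pow_mem _ (Subalgebra.neg_mem _
          (Subalgebra.one_mem _)) _) (ih _ (Finset.mem_filter.1 ha).2))
          (Algebra.subset_adjoin ⟨_, rfl⟩)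
      have h2 := Subalgebra.smul_mem _ h1 (j : ℂ)⁻¹
      rwa [smul_smul, inv_mul_cancel₀ (Nat.cast_ne_zero.2 hj.ne'), one_smul] at h2
  intro s hs
  obtain ⟨p, hp⟩ := MvPolynomial.esymmAlgHom_fin_surjective ℂ (le_refl l) ⟨s, hs⟩
  have h := MvPolynomial.esymmAlgHom_apply (σ := Fin l) p
  rw [hp] at h
  change s = _ at h
  rw [h, MvPolynomial.aeval_def, MvPolynomial.eval₂_eq]
  exact Subalgebra.sum_mem _ fun d _ => Subalgebra.mul_mem _ (Subalgebra.algebraMap_mem _ _)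
    (Subalgebra.prod_mem _ fun i _ => Subalgebra.pow_mem _ (hes _) _)

/-! ### Polynomials modulo antisymmetry and a monic polynomial -/

/-- The span of `altSub` and the multiples of the polynomials `φ(z_i)`. -/
def wedgeKer (φ : Polynomial ℂ) (l : ℕ) : Submodule ℂ (MvPolynomial (Fin l) ℂ) :=
  altSub l ⊔ Submodule.span ℂ {x | ∃ (i : Fin l) (q : MvPolynomial (Fin l) ℂ),
    x = aeval (MvPolynomial.X i) φ * q}

theorem wedgeKer_le_ker {φ : Polynomial ℂ} {l : ℕ} {N : Type*} [AddCommGroup N] [Module ℂ N]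
    (f : MvPolynomial (Fin l) ℂ →ₗ[ℂ] N)
    (hf : ∀ (σ : Equiv.Perm (Fin l)) q,
      f (MvPolynomial.rename σ q) = (Equiv.Perm.sign σ : ℤ) • f q)
    (hφ : ∀ (i : Fin l) q, f (aeval (MvPolynomial.X i) φ * q) = 0) :
    wedgeKer φ l ≤ LinearMap.ker f := by
  refine sup_le (altSub_le_ker f hf) (Submodule.span_le.2 ?_)
  rintro _ ⟨i, q, rfl⟩
  exact hφ i q

/-- A polynomial sequence is a basis of `ℂ[x]`, and a multilinear map into the quotient that
vanishes on tuples of basis vectors vanishes. -/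
theorem span_prodVars (S : Polynomial.Sequence ℂ) (l : ℕ) :
    Submodule.span ℂ (Set.range fun μ : Fin l → ℕ => prodVars fun i => S (μ i)) = ⊤ := by
  have hS : ∀ i, IsUnit (S i).leadingCoeff := fun i =>
    (Polynomial.leadingCoeff_ne_zero.2 (S.ne_zero i)).isUnit
  set W := Submodule.span ℂ (Set.range fun μ : Fin l → ℕ => prodVars fun i => S (μ i)) with hW
  have h : W.mkQ.compMultilinearMap
      ((MultilinearMap.mkPiAlgebra ℂ (Fin l) (MvPolynomial (Fin l) ℂ)).compLinearMap
        fun i => (aeval (MvPolynomial.X i : MvPolynomial (Fin l) ℂ)).toLinearMap) = 0 := by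
    refine Module.Basis.ext_multilinear (fun _ => S.basis hS) fun μ => ?_
    have : prodVars (fun i => S (μ i)) ∈ W := Submodule.subset_span ⟨μ, rfl⟩
    simpa [prodVars] using this
  have hm : ∀ μ : Fin l →₀ ℕ, (MvPolynomial.monomial μ 1 : MvPolynomial (Fin l) ℂ) ∈ W := by
    intro μ
    rw [monomial_eq_prodVars]
    have := congrArg (fun F => F fun i => Polynomial.X ^ μ i) h
    simpa [prodVars] using this
  rw [eq_top_iff]
  rintro q -
  induction q using MvPolynomial.induction_on' with
  | monomial μ a =>
    rw [← mul_one a, ← smul_eq_mul, ← MvPolynomial.smul_monomial]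
    exact W.smul_mem _ (hm μ)
  | add p q hp hq => exact W.add_mem hp hq

theorem prodVars_mem_wedgeKer {φ : Polynomial ℂ} {l : ℕ} (p : Fin l → Polynomial ℂ) (i : Fin l)
    (h : φ ∣ p i) : prodVars p ∈ wedgeKer φ l := by
  obtain ⟨g, hg⟩ := h
  refine Submodule.mem_sup_right (Submodule.subset_span ⟨i, prodVars (Function.update p i g), ?_⟩)
  rw [aeval_mul_prodVars]
  simp [← hg]

/-- Up to sign and `wedgeKer`, a product of members of the sequence can be sorted. -/
theorem prodVars_sort {φ : Polynomial ℂ} {m : ℕ} (S : Polynomial.Sequence ℂ)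
    (hS : ∀ i, m ≤ i → φ ∣ S i) {l : ℕ} (μ : Fin l → ℕ) :
    prodVars (fun i => S (μ i)) ∈ wedgeKer φ l ∨ ∃ (I : Fin l ↪o Fin m) (c : ℤ),
      ∑ i, (I i : ℕ) = ∑ i, μ i ∧
      prodVars (fun i => S (μ i)) - c • prodVars (fun i => S (I i)) ∈ wedgeKer φ l := by
  by_cases hlt : ∀ i, μ i < m
  · by_cases hinj : Function.Injective μ
    · right
      have hmono : StrictMono (μ ∘ Tuple.sort μ) :=
        (Tuple.monotone_sort μ).strictMono_of_injective (hinj.comp (Tuple.sort μ).injective)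
      refine ⟨OrderEmbedding.ofStrictMono (fun i => ⟨μ (Tuple.sort μ i), hlt _⟩)
        (fun i j hij => hmono hij), Equiv.Perm.sign (Tuple.sort μ)⁻¹, ?_, ?_⟩
      · exact Equiv.sum_comp (Tuple.sort μ) μ
      · have h := prodVars_comp_perm_sub_mem (fun i => S (μ (Tuple.sort μ i))) (Tuple.sort μ)⁻¹
        refine Submodule.mem_sup_left ?_
        convert h using 3
        · funext i
          simp
        · rfl
    · left
      refine Submodule.mem_sup_left (prodVars_mem_altSub _ fun h => hinj fun i j hij => h ?_)
      simp only [hij]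
  · left
    push Not at hlt
    obtain ⟨i, hi⟩ := hlt
    exact prodVars_mem_wedgeKer _ i (hS _ hi)

/-- The usual spanning set of an exterior power, for any sequence whose members from index `m` on
are divisible by `φ`. It is applied to powers of `x` for the pairing and to Newton polynomials for
the spectrum. -/
theorem wedgeKer_sup_span {φ : Polynomial ℂ} {m : ℕ} (S : Polynomial.Sequence ℂ)
    (hS : ∀ i, m ≤ i → φ ∣ S i) (l : ℕ) :
    wedgeKer φ l ⊔ Submodule.span ℂ
      (Set.range fun I : Fin l ↪o Fin m => prodVars fun i => S (I i)) = ⊤ := by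
  rw [eq_top_iff, ← span_prodVars S l, Submodule.span_le]
  rintro _ ⟨μ, rfl⟩
  rcases prodVars_sort S hS μ with h | ⟨I, c, -, h⟩
  · exact Submodule.mem_sup_left h
  · have h' := Submodule.add_mem _ (Submodule.mem_sup_left h) (Submodule.mem_sup_right
      (zsmul_mem (Submodule.subset_span (s := Set.range fun I : Fin l ↪o Fin m =>
        prodVars fun i => S (I i)) ⟨I, rfl⟩) c))
    rwa [sub_add_cancel] at h'

theorem mul_mem_wedgeKer {φ : Polynomial ℂ} {l : ℕ} {s : MvPolynomial (Fin l) ℂ}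
    (hs : s.IsSymmetric) {q : MvPolynomial (Fin l) ℂ} (hq : q ∈ wedgeKer φ l) :
    s * q ∈ wedgeKer φ l := by
  have : wedgeKer φ l ≤ (wedgeKer φ l).comap (LinearMap.mulLeft ℂ s) := by
    refine sup_le (fun x hx => Submodule.mem_sup_left (mul_mem_altSub hs hx))
      (Submodule.span_le.2 ?_)
    rintro _ ⟨i, q, rfl⟩
    refine Submodule.mem_sup_right (Submodule.subset_span ⟨i, s * q, ?_⟩)
    rw [LinearMap.mulLeft_apply]
    ring
  exact this hq

/-- The polynomials `1, x, …, x^{m-1}, φ, x φ, x² φ, …`, where `m` is the degree of `φ`. -/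
def powerSequence (φ : Polynomial ℂ) (hφ : φ.Monic) : Polynomial.Sequence ℂ where
  elems' i := if i < φ.natDegree then Polynomial.X ^ i else φ * Polynomial.X ^ (i - φ.natDegree)
  degree_eq' i := by
    split_ifs with h
    · exact Polynomial.degree_X_pow i
    · rw [Polynomial.degree_mul, Polynomial.degree_X_pow, Polynomial.degree_eq_natDegree hφ.ne_zero,
        ← Nat.cast_add, Nat.add_sub_of_le (not_lt.1 h)]

theorem powerSequence_of_lt {φ : Polynomial ℂ} (hφ : φ.Monic) {i : ℕ} (h : i < φ.natDegree) :
    powerSequence φ hφ i = Polynomial.X ^ i :=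
  if_pos h

theorem dvd_powerSequence {φ : Polynomial ℂ} (hφ : φ.Monic) (i : ℕ) (h : φ.natDegree ≤ i) :
    φ ∣ powerSequence φ hφ i := by
  have : powerSequence φ hφ i = φ * Polynomial.X ^ (i - φ.natDegree) := if_neg (not_lt.2 h)
  rw [this]
  exact dvd_mul_right _ _

/-! ### Symmetry and power sums for two blocks of variables -/

theorem firstVars_mul_lastVars_prodVars {l l' : ℕ} (p : Fin l → Polynomial ℂ)
    (p' : Fin l' → Polynomial ℂ) :
    firstVars l l' (prodVars p) * lastVars l l' (prodVars p') = prodVars (Fin.append p p') := by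
  rw [prodVars, prodVars, prodVars, map_prod, map_prod, Fin.prod_univ_add]
  simp [firstVars, lastVars, ← Polynomial.aeval_algHom_apply]

/-- The permutation of `l + l'` letters that acts by `σ` on the first `l` and by `τ` on the
others. -/
def blockPerm {l l' : ℕ} (σ : Equiv.Perm (Fin l)) (τ : Equiv.Perm (Fin l')) :
    Equiv.Perm (Fin (l + l')) :=
  finSumFinEquiv.permCongr (Equiv.Perm.sumCongr σ τ)

theorem sign_blockPerm {l l' : ℕ} (σ : Equiv.Perm (Fin l)) (τ : Equiv.Perm (Fin l')) :
    Equiv.Perm.sign (blockPerm σ τ) = Equiv.Perm.sign σ * Equiv.Perm.sign τ := by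
  rw [blockPerm, Equiv.Perm.sign_permCongr, Equiv.Perm.sign_sumCongr]

theorem blockPerm_castAdd {l l' : ℕ} (σ : Equiv.Perm (Fin l)) (τ : Equiv.Perm (Fin l'))
    (i : Fin l) : blockPerm σ τ (Fin.castAdd l' i) = Fin.castAdd l' (σ i) := by
  simp [blockPerm, Equiv.permCongr_apply]

theorem blockPerm_natAdd {l l' : ℕ} (σ : Equiv.Perm (Fin l)) (τ : Equiv.Perm (Fin l'))
    (i : Fin l') : blockPerm σ τ (Fin.natAdd l i) = Fin.natAdd l (τ i) := by
  simp [blockPerm, Equiv.permCongr_apply]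

theorem rename_blockPerm_firstVars {l l' : ℕ} (σ : Equiv.Perm (Fin l)) (τ : Equiv.Perm (Fin l'))
    (q : MvPolynomial (Fin l) ℂ) : MvPolynomial.rename (blockPerm σ τ) (firstVars l l' q) =
      firstVars l l' (MvPolynomial.rename σ q) := by
  rw [firstVars, MvPolynomial.rename_rename, MvPolynomial.rename_rename]
  congr 2
  funext i
  exact blockPerm_castAdd σ τ i

theorem rename_blockPerm_lastVars {l l' : ℕ} (σ : Equiv.Perm (Fin l)) (τ : Equiv.Perm (Fin l'))
    (q : MvPolynomial (Fin l') ℂ) : MvPolynomial.rename (blockPerm σ τ) (lastVars l l' q) =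
      lastVars l l' (MvPolynomial.rename τ q) := by
  rw [lastVars, MvPolynomial.rename_rename, MvPolynomial.rename_rename]
  congr 2
  funext i
  exact blockPerm_natAdd σ τ i

theorem psum_add (l l' r : ℕ) : MvPolynomial.psum (Fin (l + l')) ℂ r =
    firstVars l l' (MvPolynomial.psum (Fin l) ℂ r) +
      lastVars l l' (MvPolynomial.psum (Fin l') ℂ r) := by
  simp [MvPolynomial.psum, firstVars, lastVars, Fin.sum_univ_add]

theorem coeff_charPoly {m i : ℕ} (hi : i ≤ m) :
    (charPoly m).coeff (m - i) = (-1) ^ i * MvPolynomial.esymm (Fin m) ℂ i := by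
  have h := Multiset.prod_X_sub_C_coeff
    ((Finset.univ : Finset (Fin m)).val.map (MvPolynomial.X : Fin m → MvPolynomial (Fin m) ℂ))
    (k := m - i) (by simp)
  rw [Multiset.map_map] at h
  simp only [Multiset.card_map, Finset.card_val, Finset.card_fin, Nat.sub_sub_self hi] at h
  rw [MvPolynomial.esymm_eq_multiset_esymm]
  exact h

/-! ### The top form -/

/-- A non-zero antisymmetric linear form on polynomials in `m` variables that vanishes modulo
`φ(z_i)`. -/
structure IsTopForm (φ : Polynomial ℂ) {m : ℕ} (ℓ : MvPolynomial (Fin m) ℂ →ₗ[ℂ] ℂ) : Prop where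
  rename : ∀ (σ : Equiv.Perm (Fin m)) q,
    ℓ (MvPolynomial.rename σ q) = (Equiv.Perm.sign σ : ℤ) • ℓ q
  vanish : ∀ (i : Fin m) q, ℓ (aeval (MvPolynomial.X i) φ * q) = 0
  staircase_ne_zero : ℓ (staircase m) ≠ 0

namespace IsTopForm

variable {φ : Polynomial ℂ}

theorem eq_zero_of_not_injective {m : ℕ} {ℓ : MvPolynomial (Fin m) ℂ →ₗ[ℂ] ℂ}
    (h : IsTopForm φ ℓ) (p : Fin m → Polynomial ℂ) (hp : ¬ Function.Injective p) :
    ℓ (prodVars p) = 0 :=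
  altSub_le_ker ℓ h.rename (prodVars_mem_altSub p hp)

theorem ne_zero_of_injective {m : ℕ} {ℓ : MvPolynomial (Fin m) ℂ →ₗ[ℂ] ℂ}
    (h : IsTopForm φ ℓ) (μ : Fin m → Fin m) (hμ : Function.Injective μ) :
    ℓ (prodVars fun i => Polynomial.X ^ (μ i : ℕ)) ≠ 0 := by
  let σ : Equiv.Perm (Fin m) := Equiv.ofBijective μ (Finite.injective_iff_bijective.1 hμ)
  have h1 := altSub_le_ker ℓ h.rename (prodVars_comp_perm_sub_mem
    (fun i : Fin m => (Polynomial.X : Polynomial ℂ) ^ (i : ℕ)) σ)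
  rw [← staircase_eq, LinearMap.mem_ker, map_sub, map_zsmul, sub_eq_zero] at h1
  have h2 : ℓ (prodVars fun i => Polynomial.X ^ (μ i : ℕ)) =
      (Equiv.Perm.sign σ : ℤ) • ℓ (staircase m) := h1
  rw [h2, zsmul_eq_mul]
  refine mul_ne_zero ?_ h.staircase_ne_zero
  exact_mod_cast (Equiv.Perm.sign σ).ne_zero

/-- The pairing through the top form descends to the quotient in the first block, since permutations
of that block extend by the identity with the same sign. -/
theorem pairing_eq_zero_of_wedgeKer {l l' : ℕ} {ℓ : MvPolynomial (Fin (l + l')) ℂ →ₗ[ℂ] ℂ}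
    (h : IsTopForm φ ℓ) {x : MvPolynomial (Fin l) ℂ} (hx : x ∈ wedgeKer φ l)
    (q' : MvPolynomial (Fin l') ℂ) : ℓ (firstVars l l' x * lastVars l l' q') = 0 := by
  have := wedgeKer_le_ker (φ := φ) (l := l)
    (ℓ ∘ₗ (LinearMap.mulRight ℂ (lastVars l l' q')) ∘ₗ (firstVars l l').toLinearMap) ?_ ?_ hx
  · exact this
  · intro σ q
    have e := h.rename (blockPerm σ 1) (firstVars l l' q * lastVars l l' q')
    rw [map_mul, rename_blockPerm_firstVars, rename_blockPerm_lastVars, sign_blockPerm,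
      Equiv.Perm.sign_one, mul_one, Equiv.Perm.coe_one, MvPolynomial.rename_id_apply] at e
    exact e
  · intro i q
    have e := h.vanish (Fin.castAdd l' i) (firstVars l l' q * lastVars l l' q')
    have e2 : firstVars l l' (aeval (MvPolynomial.X i) φ) =
        aeval (MvPolynomial.X (Fin.castAdd l' i)) φ := by
      rw [← Polynomial.aeval_algHom_apply, firstVars, MvPolynomial.rename_X]
    simp only [LinearMap.comp_apply, AlgHom.toLinearMap_apply, LinearMap.mulRight_apply, map_mul,
      e2, mul_assoc]
    exact e

/-- Pair with the monomial whose exponents form the complement of `J`. Any other index set meets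
this complement, so its term has a repeated exponent and vanishes; only the coefficient of `J`
survives. -/
theorem coeff_eq_zero_of_pairing {l l' : ℕ} {ℓ : MvPolynomial (Fin (l + l')) ℂ →ₗ[ℂ] ℂ}
    (h : IsTopForm φ ℓ) (hφ : φ.Monic) (hdeg : φ.natDegree = l + l')
    (c : (Fin l ↪o Fin (l + l')) → ℂ)
    (hc : ∀ q', ℓ (firstVars l l' (∑ I, c I • prodVars fun i => powerSequence φ hφ (I i)) *
      lastVars l l' q') = 0) (J : Fin l ↪o Fin (l + l')) : c J = 0 := by
  -- `ν` enumerates the complement of the range of `J`.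
  obtain ⟨ν, hν, hνJ⟩ : ∃ ν : Fin l' → Fin (l + l'), Function.Injective ν ∧
      ∀ a, a ∈ Set.range ν ↔ a ∉ Set.range J := by
    let T : Finset (Fin (l + l')) := (Finset.univ.map J.toEmbedding)ᶜ
    have hT : T.card = l' := by
      rw [Finset.card_compl, Finset.card_map, Finset.card_fin, Fintype.card_fin]
      omega
    refine ⟨T.orderEmbOfFin hT, (T.orderEmbOfFin hT).injective, fun a => ?_⟩
    rw [Finset.range_orderEmbOfFin]
    simp [T]
  have h1 := hc (prodVars fun i => Polynomial.X ^ (ν i : ℕ))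
  simp only [map_sum, map_smul, Finset.sum_mul, smul_mul_assoc,
    firstVars_mul_lastVars_prodVars] at h1
  have hpow : ∀ (I : Fin l ↪o Fin (l + l')), Fin.append (fun i => powerSequence φ hφ (I i))
      (fun i => (Polynomial.X : Polynomial ℂ) ^ (ν i : ℕ)) =
      fun i => Polynomial.X ^ ((Fin.append (⇑I) ν i : Fin (l + l')) : ℕ) := by
    intro I
    funext i
    refine Fin.addCases (fun i => ?_) (fun i => ?_) i
    · have hi : (I i : ℕ) < φ.natDegree := by rw [hdeg]; exact (I i).2
      simp [powerSequence_of_lt hφ hi]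
    · simp
  simp only [hpow] at h1
  rw [Finset.sum_eq_single J] at h1
  · refine (smul_eq_zero.1 h1).resolve_right (h.ne_zero_of_injective _ ?_)
    rw [Fin.append_injective_iff]
    refine ⟨J.injective, hν, fun i j hij => ?_⟩
    exact (hνJ (ν j)).1 ⟨j, rfl⟩ ⟨i, hij⟩
  · intro I _ hIJ
    have hex : ∃ i, I i ∉ Set.range J := by
      by_contra hcon
      push Not at hcon
      refine hIJ ?_
      have hsub : Finset.univ.map I.toEmbedding ⊆ Finset.univ.map J.toEmbedding := by
        intro a ha
        obtain ⟨i, -, rfl⟩ := Finset.mem_map.1 ha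
        obtain ⟨j, hj⟩ := hcon i
        exact Finset.mem_map.2 ⟨j, Finset.mem_univ _, hj⟩
      have heq := Finset.eq_of_subset_of_card_le hsub (by simp)
      have hr : Set.range I = Set.range J := by
        have := congrArg (fun s : Finset _ => (s : Set (Fin (l + l')))) heq
        simpa using this
      exact DFunLike.coe_injective
        ((StrictMono.range_inj I.strictMono J.strictMono).1 hr)
    obtain ⟨i, hi⟩ := hex
    obtain ⟨j, hj⟩ := (hνJ (I i)).2 hi
    rw [h.eq_zero_of_not_injective, smul_zero]
    intro hinj
    have : Fin.castAdd l' i = Fin.natAdd l j := hinj (by simp [hj])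
    have := congrArg Fin.val this
    simp at this
    omega
  · simp

/-- Non-degeneracy of the pairing: reduce modulo `wedgeKer` to a combination of basis wedges, all of
whose coefficients must vanish. -/
theorem wedgeKer_of_pairing {l l' : ℕ} {ℓ : MvPolynomial (Fin (l + l')) ℂ →ₗ[ℂ] ℂ}
    (h : IsTopForm φ ℓ) (hφ : φ.Monic) (hdeg : φ.natDegree = l + l')
    {q : MvPolynomial (Fin l) ℂ} (hq : ∀ q', ℓ (firstVars l l' q * lastVars l l' q') = 0) :
    q ∈ wedgeKer φ l := by
  have htop := wedgeKer_sup_span (powerSequence φ hφ) (m := l + l')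
    (fun i hi => dvd_powerSequence hφ i (hdeg ▸ hi)) l
  obtain ⟨x, hx, y, hy, rfl⟩ := Submodule.mem_sup.1 (htop ▸ Submodule.mem_top : q ∈ _)
  have hy' : ∀ q', ℓ (firstVars l l' y * lastVars l l' q') = 0 := fun q' => by
    have := hq q'
    rwa [map_add, add_mul, map_add, h.pairing_eq_zero_of_wedgeKer hx, zero_add] at this
  obtain ⟨c, rfl⟩ := (Submodule.mem_span_range_iff_exists_fun ℂ).1 hy
  have hc := h.coeff_eq_zero_of_pairing hφ hdeg c hy'
  simp only [hc, zero_smul, Finset.sum_const_zero, add_zero]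
  exact hx

/-- The top exterior power is spanned by the staircase alone, because the only order embedding of
`Fin m` into itself is the identity. Hence multiplication by a symmetric polynomial is a scalar
there. -/
theorem exists_scalar {m : ℕ} {ℓ : MvPolynomial (Fin m) ℂ →ₗ[ℂ] ℂ}
    (h : IsTopForm φ ℓ) (hφ : φ.Monic) (hdeg : φ.natDegree = m)
    {s : MvPolynomial (Fin m) ℂ} (hs : s.IsSymmetric) : ∃ c : ℂ, ∀ q, ℓ (s * q) = c * ℓ q := by
  refine ⟨ℓ (s * staircase m) / ℓ (staircase m), fun q => ?_⟩
  set c := ℓ (s * staircase m) / ℓ (staircase m) with hc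
  let f : MvPolynomial (Fin m) ℂ →ₗ[ℂ] ℂ := ℓ ∘ₗ LinearMap.mulLeft ℂ s - c • ℓ
  have hf : wedgeKer φ m ≤ LinearMap.ker f := by
    intro x hx
    have h1 := wedgeKer_le_ker ℓ h.rename h.vanish hx
    have h2 := wedgeKer_le_ker ℓ h.rename h.vanish (mul_mem_wedgeKer hs hx)
    rw [LinearMap.mem_ker] at h1 h2 ⊢
    simp [f, h1, h2]
  have htop := wedgeKer_sup_span (powerSequence φ hφ) (m := m)
    (fun i hi => dvd_powerSequence hφ i (hdeg ▸ hi)) m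
  have hst : Submodule.span ℂ (Set.range fun I : Fin m ↪o Fin m =>
      prodVars fun i => powerSequence φ hφ (I i)) ≤ LinearMap.ker f := by
    refine Submodule.span_le.2 ?_
    rintro _ ⟨I, rfl⟩
    have hI : ∀ i, I i = i := fun i => by
      have := Subsingleton.elim (α := Fin m ≃o Fin m)
        (RelIso.ofSurjective I (Finite.injective_iff_surjective.1 I.injective)) (OrderIso.refl _)
      exact congrArg (fun e => e i) this
    have : (prodVars fun i => powerSequence φ hφ (I i)) = staircase m := by
      rw [staircase_eq]
      congr 1
      funext i
      rw [hI, powerSequence_of_lt hφ (hdeg ▸ i.2)]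
    change f (prodVars fun i => powerSequence φ hφ (I i)) = 0
    rw [this]
    simp [f, hc, h.staircase_ne_zero]
  have hall : q ∈ LinearMap.ker f := (sup_le hf hst) (htop ▸ Submodule.mem_top)
  rw [LinearMap.mem_ker] at hall
  simpa [f, sub_eq_zero] using hall

/-- A form of Cayley–Hamilton on the top exterior power. The relations `charPoly m (z_i) = 0` and
`φ(z_i) = 0` both express `z_i^m`, and testing them against a suitable monomial compares their
coefficients one at a time. -/
theorem coeff_charPoly_mul {m : ℕ} {ℓ : MvPolynomial (Fin m) ℂ →ₗ[ℂ] ℂ}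
    (h : IsTopForm φ ℓ) (hφ : φ.Monic) (hdeg : φ.natDegree = m) {j : ℕ} (hj : j < m)
    (q : MvPolynomial (Fin m) ℂ) : ℓ ((charPoly m).coeff j * q) = φ.coeff j * ℓ q := by
  have hex := fun j => h.exists_scalar hφ hdeg (coeff_charPoly_isSymmetric m j)
  choose c hc using hex
  rw [hc]
  congr 1
  let i : Fin m := ⟨j, hj⟩
  -- The staircase with the factor at position `j` removed: multiplying by `z_i^n` with `n < m`
  -- repeats an exponent unless `n = j`, when it restores the staircase.
  let μ : Fin m → Polynomial ℂ := fun a => if a = i then 1 else Polynomial.X ^ (a : ℕ)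
  have hX : ∀ n : ℕ, n < m → ℓ (MvPolynomial.X i ^ n * prodVars μ) =
      if n = j then ℓ (staircase m) else 0 := by
    intro n hn
    have e : (MvPolynomial.X i : MvPolynomial (Fin m) ℂ) ^ n =
        aeval (MvPolynomial.X i : MvPolynomial (Fin m) ℂ) (Polynomial.X ^ n : Polynomial ℂ) := by
      simp
    rw [e, aeval_mul_prodVars]
    split_ifs with hnj
    · rw [staircase_eq]
      congr 2
      funext a
      by_cases ha : a = i
      · subst ha; simp [μ, hnj, i]
      · simp [μ, ha]
    · refine h.eq_zero_of_not_injective _ fun hinj => ?_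
      have hne : (⟨n, hn⟩ : Fin m) ≠ i := fun he => hnj (Fin.mk.inj_iff.1 he)
      refine hne (hinj ?_)
      rw [Function.update_of_ne hne, Function.update_self]
      simp [μ, hne]
  have h1 : ℓ (MvPolynomial.X i ^ m * prodVars μ) =
      -∑ n ∈ Finset.range m, c n * ℓ (MvPolynomial.X i ^ n * prodVars μ) := by
    rw [X_pow_eq_neg_sum, neg_mul, map_neg, Finset.sum_mul, map_sum]
    congr 1
    exact Finset.sum_congr rfl fun n _ => by rw [mul_assoc, hc]
  have h2 := h.vanish i (prodVars μ)
  rw [hφ.as_sum, hdeg] at h2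
  simp only [map_add, map_pow, Polynomial.aeval_X, map_sum, map_mul, Polynomial.aeval_C, add_mul,
    Finset.sum_mul, mul_assoc] at h2
  have h3 : ∀ n, ℓ (algebraMap ℂ (MvPolynomial (Fin m) ℂ) (φ.coeff n) *
      (MvPolynomial.X i ^ n * prodVars μ)) =
      φ.coeff n * ℓ (MvPolynomial.X i ^ n * prodVars μ) := fun n => by
    rw [← Algebra.smul_def, map_smul, smul_eq_mul]
  simp only [h3] at h2
  rw [h1, neg_add_eq_sub, sub_eq_zero] at h2
  have hs : ∀ g : ℕ → ℂ, ∑ n ∈ Finset.range m, g n * ℓ (MvPolynomial.X i ^ n * prodVars μ) =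
      g j * ℓ (staircase m) := by
    intro g
    rw [Finset.sum_eq_single j]
    · rw [hX j hj, if_pos rfl]
    · intro n hn hnj
      rw [hX n (Finset.mem_range.1 hn), if_neg hnj, mul_zero]
    · intro hj'
      exact absurd (Finset.mem_range.2 hj) hj'
  rw [hs, hs] at h2
  exact (mul_right_cancel₀ h.staircase_ne_zero h2).symm

theorem esymm_mul {m : ℕ} {ℓ : MvPolynomial (Fin m) ℂ →ₗ[ℂ] ℂ}
    (h : IsTopForm φ ℓ) (hφ : φ.Monic) (hdeg : φ.natDegree = m) {i : ℕ} (h1 : 1 ≤ i) (hi : i ≤ m)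
    (q : MvPolynomial (Fin m) ℂ) :
    ℓ (MvPolynomial.esymm (Fin m) ℂ i * q) = (-1) ^ i * φ.coeff (m - i) * ℓ q := by
  have h2 := h.coeff_charPoly_mul hφ hdeg (j := m - i) (by omega) q
  have e : ((-1 : MvPolynomial (Fin m) ℂ) ^ i * MvPolynomial.esymm (Fin m) ℂ i) * q =
      ((-1 : ℂ) ^ i) • (MvPolynomial.esymm (Fin m) ℂ i * q) := by
    rw [MvPolynomial.smul_eq_C_mul, map_pow, map_neg, map_one, mul_assoc]
  rw [coeff_charPoly hi, e, map_smul, smul_eq_mul] at h2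
  rw [mul_assoc, ← h2, ← mul_assoc, ← mul_pow]
  simp

/-- Under the top form a power sum in all variables is a scalar, so a power sum in the last block
equals that scalar minus the power sum in the first block. Power sums generate, and the property
passes to sums and products. -/
theorem exists_first_of_last {l l' : ℕ} {ℓ : MvPolynomial (Fin (l + l')) ℂ →ₗ[ℂ] ℂ}
    (h : IsTopForm φ ℓ) (hφ : φ.Monic) (hdeg : φ.natDegree = l + l')
    {s : MvPolynomial (Fin l') ℂ} (hs : s.IsSymmetric) :
    ∃ t : MvPolynomial (Fin l) ℂ, t.IsSymmetric ∧
      ∀ x, ℓ (lastVars l l' s * x) = ℓ (firstVars l l' t * x) := by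
  have hs' : s ∈ Algebra.adjoin ℂ (Set.range (MvPolynomial.psum (Fin l') ℂ)) := by
    rw [adjoin_psum]; exact hs
  induction hs' using Algebra.adjoin_induction with
  | mem x hx =>
    obtain ⟨r, rfl⟩ := hx
    obtain ⟨c, hc⟩ := h.exists_scalar hφ hdeg
      (MvPolynomial.psum_isSymmetric (Fin (l + l')) ℂ r)
    refine ⟨MvPolynomial.C c - MvPolynomial.psum (Fin l) ℂ r,
      (MvPolynomial.IsSymmetric.C c).sub (MvPolynomial.psum_isSymmetric _ _ r), fun x => ?_⟩
    have h1 := hc x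
    rw [psum_add, add_mul, map_add] at h1
    rw [map_sub, sub_mul, map_sub, eq_sub_iff_add_eq, add_comm, h1]
    rw [firstVars, MvPolynomial.rename_C, ← MvPolynomial.smul_eq_C_mul, map_smul, smul_eq_mul]
  | algebraMap r =>
    refine ⟨MvPolynomial.C r, MvPolynomial.IsSymmetric.C r, fun x => ?_⟩
    rw [MvPolynomial.algebraMap_eq, firstVars, lastVars, MvPolynomial.rename_C,
      MvPolynomial.rename_C]
  | add a b ha hb iha ihb =>
    rw [adjoin_psum] at ha hb
    obtain ⟨t, ht, h1⟩ := iha ha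
    obtain ⟨u, hu, h2⟩ := ihb hb
    refine ⟨t + u, ht.add hu, fun x => ?_⟩
    rw [map_add, map_add, add_mul, add_mul, map_add, map_add, h1, h2]
  | mul a b ha hb iha ihb =>
    rw [adjoin_psum] at ha hb
    obtain ⟨t, ht, h1⟩ := iha ha
    obtain ⟨u, hu, h2⟩ := ihb hb
    refine ⟨t * u, ht.mul hu, fun x => ?_⟩
    rw [map_mul (lastVars l l'), map_mul (firstVars l l'), mul_assoc, h1, mul_left_comm, h2,
      mul_left_comm, mul_assoc]

/-- Any partner `q'` is a symmetric multiple of the staircase modulo antisymmetry, and the symmetric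
factor can be moved to the first block. So pairing all symmetric multiples of `q` with one staircase
already detects `q`. -/
theorem wedgeKer_of_frobenius {l l' : ℕ} {ℓ : MvPolynomial (Fin (l + l')) ℂ →ₗ[ℂ] ℂ}
    (h : IsTopForm φ ℓ) (hφ : φ.Monic) (hdeg : φ.natDegree = l + l')
    {q : MvPolynomial (Fin l) ℂ} (hq : ∀ s : MvPolynomial (Fin l) ℂ, s.IsSymmetric →
      ℓ (firstVars l l' (s * q) * lastVars l l' (staircase l')) = 0) :
    q ∈ wedgeKer φ l := by
  refine h.wedgeKer_of_pairing hφ hdeg fun q' => ?_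
  obtain ⟨s, hs, hsq⟩ := exists_symmetric_mul_staircase q'
  obtain ⟨t, ht, hst⟩ := h.exists_first_of_last hφ hdeg (l := l) hs
  have h1 := altSub_le_ker
    (ℓ ∘ₗ (LinearMap.mulLeft ℂ (firstVars l l' q)) ∘ₗ (lastVars l l').toLinearMap) (by
      intro σ q'
      have e := h.rename (blockPerm 1 σ) (firstVars l l' q * lastVars l l' q')
      rw [map_mul, rename_blockPerm_firstVars, rename_blockPerm_lastVars, sign_blockPerm,
        Equiv.Perm.sign_one, one_mul, Equiv.Perm.coe_one, MvPolynomial.rename_id_apply] at e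
      exact e) hsq
  simp only [LinearMap.mem_ker, LinearMap.comp_apply, AlgHom.toLinearMap_apply,
    LinearMap.mulLeft_apply, map_sub, sub_eq_zero] at h1
  rw [h1, map_mul (lastVars l l'), mul_left_comm, hst, ← mul_assoc, ← map_mul (firstVars l l')]
  exact hq t ht

end IsTopForm

/-! ### The algebra of invariants modulo `σ_i(w) = ε_i` -/

section
variable (l l' : ℕ)

theorem firstVars_mem_invariants {s : MvPolynomial (Fin l) ℂ} (hs : s.IsSymmetric) :
    firstVars l l' s ∈ invariants (l + l') l := by
  intro σ hσ
  have hlt : ∀ i : Fin l, (σ (Fin.castAdd l' i) : ℕ) < l := fun i =>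
    (hσ _).2 (by simp)
  let f : Fin l → Fin l := fun i => ⟨σ (Fin.castAdd l' i), hlt i⟩
  have hf : Function.Injective f := fun i j h => by
    have h1 : σ (Fin.castAdd l' i) = σ (Fin.castAdd l' j) := Fin.ext (Fin.mk.inj_iff.1 h)
    exact Fin.castAdd_injective l l' (σ.injective h1)
  let τ : Equiv.Perm (Fin l) := Equiv.ofBijective f (Finite.injective_iff_bijective.1 hf)
  rw [firstVars, MvPolynomial.rename_rename]
  conv_rhs => rw [← hs τ, MvPolynomial.rename_rename]
  rfl

theorem lastVars_mem_invariants {s : MvPolynomial (Fin l') ℂ} (hs : s.IsSymmetric) :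
    lastVars l l' s ∈ invariants (l + l') l := by
  intro σ hσ
  have hlt : ∀ i : Fin l', l ≤ (σ (Fin.natAdd l i) : ℕ) := fun i =>
    not_lt.1 fun h => absurd ((hσ _).1 h) (by simp)
  let f : Fin l' → Fin l' := fun i => ⟨σ (Fin.natAdd l i) - l, by
    have := (σ (Fin.natAdd l i)).2
    have := hlt i
    omega⟩
  have hfv : ∀ i, Fin.natAdd l (f i) = σ (Fin.natAdd l i) := fun i =>
    Fin.ext (by simp [f, Nat.add_sub_of_le (hlt i)])
  have hf : Function.Injective f := fun i j h => by
    have h1 : σ (Fin.natAdd l i) = σ (Fin.natAdd l j) := by rw [← hfv, ← hfv, h]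
    exact Fin.natAdd_injective l' l (σ.injective h1)
  let τ : Equiv.Perm (Fin l') := Equiv.ofBijective f (Finite.injective_iff_bijective.1 hf)
  rw [lastVars, MvPolynomial.rename_rename]
  conv_rhs => rw [← hs τ, MvPolynomial.rename_rename]
  congr 2
  funext i
  exact (hfv i).symm

theorem mem_invariants_of_isSymmetric {m : ℕ} {s : MvPolynomial (Fin m) ℂ} (hs : s.IsSymmetric) :
    s ∈ invariants m l := fun σ _ => hs σ

theorem rename_blockPerm_of_mem {x : MvPolynomial (Fin (l + l')) ℂ}
    (hx : x ∈ invariants (l + l') l) (σ : Equiv.Perm (Fin l)) (τ : Equiv.Perm (Fin l')) :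
    MvPolynomial.rename (blockPerm σ τ) x = x := by
  refine hx _ fun i => ?_
  refine Fin.addCases (fun i => ?_) (fun i => ?_) i
  · rw [blockPerm_castAdd]; simp
  · rw [blockPerm_natAdd]; simp

/-- The average over the symmetric group. -/
def average (l : ℕ) : MvPolynomial (Fin l) ℂ →ₗ[ℂ] MvPolynomial (Fin l) ℂ :=
  ∑ σ : Equiv.Perm (Fin l), (MvPolynomial.rename σ).toLinearMap

theorem average_apply (q : MvPolynomial (Fin l) ℂ) :
    average l q = ∑ σ : Equiv.Perm (Fin l), MvPolynomial.rename σ q := by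
  simp [average, LinearMap.sum_apply]

theorem average_isSymmetric (q : MvPolynomial (Fin l) ℂ) : (average l q).IsSymmetric := by
  intro τ
  rw [average_apply, map_sum, ← Equiv.sum_comp (Equiv.mulLeft τ) (fun σ =>
    MvPolynomial.rename σ q)]
  refine Finset.sum_congr rfl fun σ _ => ?_
  rw [MvPolynomial.rename_rename]
  rfl

/-- Averaging over the product of the two symmetric groups fixes an invariant up to a non-zero
factor and turns a monomial into a product of a symmetric polynomial in each block. -/
theorem invariants_induction (x : invariants (l + l') l) :
    (x : MvPolynomial (Fin (l + l')) ℂ) ∈ Submodule.span ℂ {y | ∃ (s : MvPolynomial (Fin l) ℂ)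
      (t : MvPolynomial (Fin l') ℂ), s.IsSymmetric ∧ t.IsSymmetric ∧
        y = firstVars l l' s * lastVars l l' t} := by
  set W := Submodule.span ℂ {y | ∃ (s : MvPolynomial (Fin l) ℂ)
      (t : MvPolynomial (Fin l') ℂ), s.IsSymmetric ∧ t.IsSymmetric ∧
        y = firstVars l l' s * lastVars l l' t} with hW
  have hP : ∀ q : MvPolynomial (Fin (l + l')) ℂ, ∑ σ : Equiv.Perm (Fin l),
      ∑ τ : Equiv.Perm (Fin l'), MvPolynomial.rename (blockPerm σ τ) q ∈ W := by
    intro q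
    induction q using MvPolynomial.induction_on' with
    | monomial μ a =>
      have e : MvPolynomial.monomial μ a = a • (firstVars l l' (MvPolynomial.monomial
          (Finsupp.equivFunOnFinite.symm fun i => μ (Fin.castAdd l' i)) 1) *
          lastVars l l' (MvPolynomial.monomial
          (Finsupp.equivFunOnFinite.symm fun i => μ (Fin.natAdd l i)) 1)) := by
        rw [firstVars_monomial_mul, MvPolynomial.smul_monomial, smul_eq_mul, mul_one]
        refine congrArg (fun ν => MvPolynomial.monomial ν a) (Finsupp.ext fun i => ?_)
        refine Fin.addCases (fun i => ?_) (fun i => ?_) i <;> simp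
      rw [e]
      simp only [map_smul, map_mul, rename_blockPerm_firstVars, rename_blockPerm_lastVars,
        ← Finset.smul_sum]
      rw [← Finset.sum_mul_sum]
      refine W.smul_mem _ (Submodule.subset_span
        ⟨average l (MvPolynomial.monomial
            (Finsupp.equivFunOnFinite.symm fun i => μ (Fin.castAdd l' i)) 1),
          average l' (MvPolynomial.monomial
            (Finsupp.equivFunOnFinite.symm fun i => μ (Fin.natAdd l i)) 1),
          average_isSymmetric _ _, average_isSymmetric _ _, ?_⟩)
      rw [average_apply, average_apply, map_sum, map_sum]
    | add p q hp hq =>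
      simp only [map_add, Finset.sum_add_distrib]
      exact W.add_mem hp hq
  have h := hP x
  simp only [rename_blockPerm_of_mem l l' x.2, Finset.sum_const, smul_smul] at h
  rw [← Nat.cast_smul_eq_nsmul ℂ] at h
  refine (Submodule.smul_mem_iff _ ?_).1 h
  rw [Nat.cast_ne_zero]
  exact mul_ne_zero (Finset.card_ne_zero.2 Finset.univ_nonempty)
    (Finset.card_ne_zero.2 Finset.univ_nonempty)

/-- Symmetric polynomials in the first `l` variables as invariants. -/
def firstInv : MvPolynomial.symmetricSubalgebra (Fin l) ℂ →ₐ[ℂ] invariants (l + l') l :=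
  ((firstVars l l').comp (MvPolynomial.symmetricSubalgebra (Fin l) ℂ).val).codRestrict _
    fun s => firstVars_mem_invariants l l' s.2

theorem coe_firstInv (s : MvPolynomial.symmetricSubalgebra (Fin l) ℂ) :
    (firstInv l l' s : MvPolynomial (Fin (l + l')) ℂ) = firstVars l l' s := rfl

/-- The class of a symmetric polynomial in the first `l` variables. -/
def firstClass (ε : ℕ → ℂ) : MvPolynomial.symmetricSubalgebra (Fin l) ℂ →ₐ[ℂ]
    invariants (l + l') l ⧸ symmIdeal (l + l') l ε :=
  (Ideal.Quotient.mkₐ ℂ _).comp (firstInv l l')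

theorem firstClass_eq_zero_iff (ε : ℕ → ℂ) (s : MvPolynomial.symmetricSubalgebra (Fin l) ℂ) :
    firstClass l l' ε s = 0 ↔ firstInv l l' s ∈ symmIdeal (l + l') l ε :=
  Ideal.Quotient.eq_zero_iff_mem

/-- A fully symmetric polynomial is a polynomial in the elementary ones, each of which is a constant
modulo the ideal. -/
theorem exists_scalar_sub_mem {m : ℕ} (ε : ℕ → ℂ) {s : MvPolynomial (Fin m) ℂ}
    (hs : s.IsSymmetric) : ∃ c : ℂ, (⟨s, mem_invariants_of_isSymmetric l hs⟩ : invariants m l) -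
      algebraMap ℂ _ c ∈ symmIdeal m l ε := by
  obtain ⟨p, hp⟩ := MvPolynomial.esymmAlgHom_fin_surjective ℂ (le_refl m) ⟨s, hs⟩
  let J : MvPolynomial.symmetricSubalgebra (Fin m) ℂ →ₐ[ℂ] invariants m l :=
    (MvPolynomial.symmetricSubalgebra (Fin m) ℂ).val.codRestrict _
      fun s => mem_invariants_of_isSymmetric l s.2
  have key : ∀ p : MvPolynomial (Fin m) ℂ, ∃ c : ℂ,
      J (MvPolynomial.esymmAlgHom (Fin m) ℂ m p) - algebraMap ℂ _ c ∈ symmIdeal m l ε := by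
    intro p
    induction p using MvPolynomial.induction_on with
    | C a =>
      refine ⟨a, ?_⟩
      rw [← MvPolynomial.algebraMap_eq, AlgHom.commutes, AlgHom.commutes, sub_self]
      exact Ideal.zero_mem _
    | add p q hp hq =>
      obtain ⟨c, hc⟩ := hp
      obtain ⟨d, hd⟩ := hq
      refine ⟨c + d, ?_⟩
      rw [map_add, map_add, map_add, add_sub_add_comm]
      exact Ideal.add_mem _ hc hd
    | mul_X p i hp =>
      obtain ⟨c, hc⟩ := hp
      refine ⟨c * ε (i + 1), ?_⟩
      have hX : J (MvPolynomial.esymmAlgHom (Fin m) ℂ m (MvPolynomial.X i)) -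
          algebraMap ℂ _ (ε (i + 1)) ∈ symmIdeal m l ε := by
        refine Ideal.subset_span ⟨i + 1, Finset.mem_Icc.2 ⟨by omega, i.2⟩, ?_⟩
        rw [MvPolynomial.esymmAlgHom, MvPolynomial.aeval_X]
        rfl
      rw [map_mul, map_mul, map_mul]
      have := Ideal.add_mem _ (Ideal.mul_mem_right
        (J (MvPolynomial.esymmAlgHom (Fin m) ℂ m (MvPolynomial.X i))) _ hc)
        (Ideal.mul_mem_left _ (algebraMap ℂ (invariants m l) c) hX)
      convert this using 1
      ring
  obtain ⟨c, hc⟩ := key p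
  rw [hp] at hc
  exact ⟨c, hc⟩

/-- The quotient counterpart of `exists_first_of_last`: power sums in the last block are constants
minus power sums in the first block modulo the ideal. -/
theorem firstClass_surjective (ε : ℕ → ℂ) : Function.Surjective (firstClass l l' ε) := by
  rw [← AlgHom.range_eq_top, eq_top_iff]
  have hlast : ∀ (t : MvPolynomial (Fin l') ℂ) (ht : t.IsSymmetric),
      Ideal.Quotient.mk (symmIdeal (l + l') l ε) ⟨_, lastVars_mem_invariants l l' ht⟩ ∈
        (firstClass l l' ε).range := by
    intro t ht
    have ht' : t ∈ Algebra.adjoin ℂ (Set.range (MvPolynomial.psum (Fin l') ℂ)) := by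
      rw [adjoin_psum]; exact ht
    induction ht' using Algebra.adjoin_induction with
    | mem x hx =>
      obtain ⟨r, rfl⟩ := hx
      obtain ⟨c, hc⟩ := exists_scalar_sub_mem l ε (MvPolynomial.psum_isSymmetric (Fin (l + l')) ℂ r)
      refine ⟨algebraMap ℂ _ c - ⟨_, MvPolynomial.psum_isSymmetric (Fin l) ℂ r⟩, ?_⟩
      change Ideal.Quotient.mk _ (firstInv l l' _) = _
      rw [Ideal.Quotient.mk_eq_mk_iff_sub_mem, ← neg_mem_iff]
      convert hc using 1
      ext1
      rw [map_sub, AlgHom.commutes]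
      have := psum_add l l' r
      simp only [Subalgebra.coe_neg, Subalgebra.coe_sub, coe_firstInv, this]
      ring
    | algebraMap r =>
      refine ⟨algebraMap ℂ _ r, ?_⟩
      change Ideal.Quotient.mk _ (firstInv l l' (algebraMap ℂ _ r)) = _
      congr 1
      ext1
      exact ((firstVars l l').commutes r).trans ((lastVars l l').commutes r).symm
    | add a b ha hb iha ihb =>
      rw [adjoin_psum] at ha hb
      have := Subalgebra.add_mem _ (iha ha) (ihb hb)
      rw [← map_add] at this
      convert this using 2
      ext1
      exact map_add _ _ _
    | mul a b ha hb iha ihb =>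
      rw [adjoin_psum] at ha hb
      have := Subalgebra.mul_mem _ (iha ha) (ihb hb)
      rw [← map_mul] at this
      convert this using 2
      ext1
      exact map_mul _ _ _
  rintro y -
  obtain ⟨x, rfl⟩ := Ideal.Quotient.mk_surjective y
  have hx := invariants_induction l l' x
  have hgen : ∀ z, z ∈ Submodule.span ℂ {y | ∃ (s : MvPolynomial (Fin l) ℂ)
      (t : MvPolynomial (Fin l') ℂ), s.IsSymmetric ∧ t.IsSymmetric ∧
        y = firstVars l l' s * lastVars l l' t} → ∃ hz : z ∈ invariants (l + l') l,
        Ideal.Quotient.mk (symmIdeal (l + l') l ε) ⟨z, hz⟩ ∈ (firstClass l l' ε).range := by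
    intro z hz
    induction hz using Submodule.span_induction with
    | mem z hz =>
      obtain ⟨s, t, hs, ht, rfl⟩ := hz
      refine ⟨Subalgebra.mul_mem _ (firstVars_mem_invariants l l' hs)
        (lastVars_mem_invariants l l' ht), ?_⟩
      have h1 : Ideal.Quotient.mk (symmIdeal (l + l') l ε) ⟨_, firstVars_mem_invariants l l' hs⟩ ∈
          (firstClass l l' ε).range := ⟨⟨s, hs⟩, rfl⟩
      have := Subalgebra.mul_mem _ h1 (hlast t ht)
      rw [← map_mul] at this
      exact this
    | zero =>
      refine ⟨Subalgebra.zero_mem _, ?_⟩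
      have := Subalgebra.zero_mem (firstClass l l' ε).range
      rw [← map_zero (Ideal.Quotient.mk (symmIdeal (l + l') l ε))] at this
      exact this
    | add a b _ _ ha hb =>
      obtain ⟨ha, ha'⟩ := ha
      obtain ⟨hb, hb'⟩ := hb
      refine ⟨Subalgebra.add_mem _ ha hb, ?_⟩
      have := Subalgebra.add_mem _ ha' hb'
      rw [← map_add] at this
      exact this
    | smul c a _ ha =>
      obtain ⟨ha, ha'⟩ := ha
      refine ⟨Subalgebra.smul_mem _ ha c, ?_⟩
      exact Subalgebra.smul_mem _ ha' c
  exact (hgen x hx).2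

/-! ### Comparison of the invariants with polynomials modulo antisymmetry -/

variable {l l'}

/-- The generators of the ideal act by zero on the top exterior power by `IsTopForm.esymm_mul`; the
invariance of the cofactors plays no role. -/
theorem IsTopForm.symmIdeal_eq_zero {φ : Polynomial ℂ}
    {ℓ : MvPolynomial (Fin (l + l')) ℂ →ₗ[ℂ] ℂ}
    (h : IsTopForm φ ℓ) (hφ : φ.Monic) (hdeg : φ.natDegree = l + l') {ε : ℕ → ℂ}
    (hε : ∀ i, 1 ≤ i → i ≤ l + l' → ε i = (-1) ^ i * φ.coeff (l + l' - i))
    {x : invariants (l + l') l} (hx : x ∈ symmIdeal (l + l') l ε)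
    (q : MvPolynomial (Fin (l + l')) ℂ) : ℓ (x * q) = 0 := by
  induction hx using Submodule.span_induction generalizing q with
  | mem x hx =>
    obtain ⟨i, hi, hxi⟩ := hx
    obtain ⟨h1, hi⟩ := Finset.mem_Icc.1 hi
    rw [hxi, sub_mul, map_sub, h.esymm_mul hφ hdeg h1 hi, ← MvPolynomial.smul_eq_C_mul, map_smul,
      smul_eq_mul, hε i h1 hi, sub_self]
  | zero => rw [Subalgebra.coe_zero, zero_mul, map_zero]
  | add a b _ _ ha hb => rw [Subalgebra.coe_add, add_mul, map_add, ha, hb, add_zero]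
  | smul a b _ hb =>
    rw [smul_eq_mul, Subalgebra.coe_mul, mul_comm (a : MvPolynomial (Fin (l + l')) ℂ), mul_assoc]
    exact hb _

theorem IsTopForm.mul_mem_wedgeKer_of_firstClass {φ : Polynomial ℂ}
    {ℓ : MvPolynomial (Fin (l + l')) ℂ →ₗ[ℂ] ℂ}
    (h : IsTopForm φ ℓ) (hφ : φ.Monic) (hdeg : φ.natDegree = l + l') {ε : ℕ → ℂ}
    (hε : ∀ i, 1 ≤ i → i ≤ l + l' → ε i = (-1) ^ i * φ.coeff (l + l' - i))
    {s : MvPolynomial.symmetricSubalgebra (Fin l) ℂ} (hs : firstClass l l' ε s = 0)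
    (q : MvPolynomial (Fin l) ℂ) : (s : MvPolynomial (Fin l) ℂ) * q ∈ wedgeKer φ l := by
  rw [firstClass_eq_zero_iff] at hs
  refine h.wedgeKer_of_pairing hφ hdeg fun q' => ?_
  rw [map_mul (firstVars l l'), mul_assoc]
  exact h.symmIdeal_eq_zero hφ hdeg hε hs _

/-! ### Reduction of `φ` modulo the product of the first linear factors -/

/-- The coefficients of the remainder of a polynomial modulo `∏ (x - z_i)`. -/
def remCoeff (l : ℕ) (p : Polynomial ℂ) (j : ℕ) : MvPolynomial (Fin l) ℂ :=
  (p.map MvPolynomial.C %ₘ charPoly l).coeff j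

theorem remCoeff_isSymmetric (l : ℕ) (p : Polynomial ℂ) (j : ℕ) :
    (remCoeff l p j).IsSymmetric := by
  intro σ
  have h := Polynomial.map_modByMonic (p := p.map MvPolynomial.C)
    (MvPolynomial.rename σ : _ →ₐ[ℂ] MvPolynomial (Fin l) ℂ).toRingHom (charPoly_monic l)
  rw [map_rename_charPoly, Polynomial.map_map] at h
  have e : (MvPolynomial.rename σ : _ →ₐ[ℂ] MvPolynomial (Fin l) ℂ).toRingHom.comp
      MvPolynomial.C = MvPolynomial.C := by
    ext1 c
    exact MvPolynomial.rename_C σ c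
  rw [e] at h
  conv_rhs => rw [remCoeff, ← h, Polynomial.coeff_map]
  rfl

theorem aeval_eq_sum_remCoeff {l : ℕ} (p : Polynomial ℂ) (i : Fin l) :
    aeval (MvPolynomial.X i : MvPolynomial (Fin l) ℂ) p =
      ∑ j ∈ Finset.range l, remCoeff l p j * MvPolynomial.X i ^ j := by
  have h := congrArg (Polynomial.eval (MvPolynomial.X i))
    (Polynomial.modByMonic_add_div (p.map MvPolynomial.C) (charPoly l))
  rw [Polynomial.eval_add, Polynomial.eval_mul, eval_charPoly, zero_mul, add_zero] at h
  rw [Polynomial.aeval_def, MvPolynomial.algebraMap_eq, Polynomial.eval₂_eq_eval_map, ← h]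
  refine Polynomial.eval_eq_sum_range' ?_ _
  have h1 := Polynomial.natDegree_modByMonic_lt (p.map MvPolynomial.C) (charPoly_monic l) (by
    intro h1
    have h2 := natDegree_charPoly l
    rw [h1, Polynomial.natDegree_one] at h2
    exact absurd i.2 (by omega))
  rwa [natDegree_charPoly] at h1

theorem charPoly_add (l l' : ℕ) : charPoly (l + l') =
    (charPoly l).map (firstVars l l').toRingHom * (charPoly l').map (lastVars l l').toRingHom := by
  rw [charPoly, charPoly, charPoly, Fin.prod_univ_add, Polynomial.map_prod, Polynomial.map_prod]
  simp [firstVars, lastVars]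

/-- Modulo the ideal, `φ` coincides with `charPoly (l + l')`, which is divisible by the polynomial
of the first block. So the remainder of `φ` by that polynomial has coefficients in the ideal. -/
theorem firstClass_remCoeff {φ : Polynomial ℂ} (hφ : φ.Monic) (hdeg : φ.natDegree = l + l')
    {ε : ℕ → ℂ} (hε : ∀ i, 1 ≤ i → i ≤ l + l' → ε i = (-1) ^ i * φ.coeff (l + l' - i)) (j : ℕ) :
    firstClass l l' ε ⟨_, remCoeff_isSymmetric l φ j⟩ = 0 := by
  rw [firstClass_eq_zero_iff]
  set F := (firstVars l l').toRingHom with hF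
  have hFC : F.comp MvPolynomial.C = MvPolynomial.C := by
    ext1 c
    exact MvPolynomial.rename_C _ c
  have hmon : ((charPoly l).map F).Monic := (charPoly_monic l).map F
  have hmod : ∀ p : Polynomial ℂ, ∀ j, firstVars l l' (remCoeff l p j) =
      (p.map MvPolynomial.C %ₘ (charPoly l).map F).coeff j := by
    intro p j
    have h := Polynomial.map_modByMonic (p := p.map MvPolynomial.C) F (charPoly_monic l)
    rw [Polynomial.map_map, hFC] at h
    rw [← h, Polynomial.coeff_map]
    rfl
  have hd : ∀ i, ∃ y ∈ symmIdeal (l + l') l ε, (y : MvPolynomial (Fin (l + l')) ℂ) =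
      (φ.map MvPolynomial.C - charPoly (l + l')).coeff i := by
    intro i
    rw [Polynomial.coeff_sub, Polynomial.coeff_map]
    rcases lt_trichotomy i (l + l') with hi | hi | hi
    · have hi' : l + l' - (l + l' - i) = i := by omega
      have hc := coeff_charPoly (m := l + l') (i := l + l' - i) (by omega)
      have he := hε (l + l' - i) (by omega) (by omega)
      rw [hi'] at hc he
      let y : invariants (l + l') l := ⟨MvPolynomial.esymm (Fin (l + l')) ℂ (l + l' - i) -
        MvPolynomial.C (ε (l + l' - i)), mem_invariants_of_isSymmetric l
          ((MvPolynomial.esymm_isSymmetric _ _ _).sub (MvPolynomial.IsSymmetric.C _))⟩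
      have hy : y ∈ symmIdeal (l + l') l ε := Ideal.subset_span
        ⟨l + l' - i, Finset.mem_Icc.2 ⟨by omega, by omega⟩, rfl⟩
      -- The extra sign occurs because `φ` stands first in the difference, while `y` is the
      -- elementary symmetric polynomial minus its constant.
      refine ⟨(-1) ^ (l + l' - i + 1) * y, Ideal.mul_mem_left _ _ hy, ?_⟩
      have h1 : φ.coeff i = (-1) ^ (l + l' - i) * ε (l + l' - i) := by
        rw [he, ← mul_assoc, ← mul_pow]; simp
      rw [hc, h1]
      simp only [y, Subalgebra.coe_mul, Subalgebra.coe_pow, Subalgebra.coe_neg, Subalgebra.coe_one,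
        map_mul, map_pow, map_neg, map_one]
      ring
    · refine ⟨0, Ideal.zero_mem _, ?_⟩
      have h1 : φ.coeff i = 1 := by rw [hi, ← hdeg]; exact hφ
      have h2 : (charPoly (l + l')).coeff i = 1 := by
        have := charPoly_monic (l + l')
        rw [Polynomial.Monic, Polynomial.leadingCoeff, natDegree_charPoly] at this
        rw [hi, this]
      rw [h1, h2, map_one, sub_self]
      rfl
    · refine ⟨0, Ideal.zero_mem _, ?_⟩
      rw [Polynomial.coeff_eq_zero_of_natDegree_lt (hdeg ▸ hi),
        Polynomial.coeff_eq_zero_of_natDegree_lt (by rwa [natDegree_charPoly]), map_zero, sub_self]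
      rfl
  choose y hy hyd using hd
  set P := φ.map MvPolynomial.C - charPoly (l + l') with hP
  have hrem : φ.map MvPolynomial.C %ₘ (charPoly l).map F = P %ₘ (charPoly l).map F := by
    refine Polynomial.modByMonic_eq_of_dvd_sub hmon ?_
    rw [hP, sub_sub_cancel, charPoly_add]
    exact dvd_mul_right _ _
  have hsum : P %ₘ (charPoly l).map F = ∑ i ∈ Finset.range (P.natDegree + 1),
      P.coeff i • ((Polynomial.X ^ i : Polynomial ℂ).map MvPolynomial.C %ₘ (charPoly l).map F) := by
    have h1 := congrArg (Polynomial.modByMonicHom ((charPoly l).map F))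
      (P.as_sum_range_C_mul_X_pow)
    rw [map_sum] at h1
    refine h1.trans (Finset.sum_congr rfl fun i _ => ?_)
    rw [← Polynomial.smul_eq_C_mul, map_smul, Polynomial.map_pow, Polynomial.map_X]
    rfl
  have hfin : firstInv l l' ⟨_, remCoeff_isSymmetric l φ j⟩ =
      ∑ i ∈ Finset.range (P.natDegree + 1), y i *
        firstInv l l' ⟨_, remCoeff_isSymmetric l (Polynomial.X ^ i) j⟩ := by
    ext1
    rw [coe_firstInv, hmod, hrem, hsum, Polynomial.finsetSum_coeff, AddSubmonoidClass.coe_finsetSum]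
    refine Finset.sum_congr rfl fun i _ => ?_
    rw [Polynomial.coeff_smul, smul_eq_mul, Subalgebra.coe_mul, hyd, coe_firstInv, hmod]
  rw [hfin]
  exact Ideal.sum_mem _ fun i _ => Ideal.mul_mem_right _ _ (hy i)

/-- Every element of `wedgeKer` is, modulo antisymmetry, the staircase times a symmetric polynomial
of zero class: expand `φ(z_i)` in powers of `z_i` with the coefficients `remCoeff`. Freeness over
the symmetric polynomials then identifies this polynomial with `s`. -/
theorem firstClass_eq_zero_of_wedgeKer {φ : Polynomial ℂ} (hφ : φ.Monic)
    (hdeg : φ.natDegree = l + l') {ε : ℕ → ℂ}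
    (hε : ∀ i, 1 ≤ i → i ≤ l + l' → ε i = (-1) ^ i * φ.coeff (l + l' - i))
    {s : MvPolynomial.symmetricSubalgebra (Fin l) ℂ}
    (hs : (s : MvPolynomial (Fin l) ℂ) * staircase l ∈ wedgeKer φ l) :
    firstClass l l' ε s = 0 := by
  have key : ∀ x ∈ wedgeKer φ l, ∃ t : MvPolynomial.symmetricSubalgebra (Fin l) ℂ,
      firstClass l l' ε t = 0 ∧ x - t * staircase l ∈ altSub l := by
    intro x hx
    obtain ⟨a, ha, c, hc, rfl⟩ := Submodule.mem_sup.1 hx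
    have hc' : ∃ t : MvPolynomial.symmetricSubalgebra (Fin l) ℂ,
        firstClass l l' ε t = 0 ∧ c - t * staircase l ∈ altSub l := by
      clear hx
      induction hc using Submodule.span_induction with
      | mem z hz =>
        obtain ⟨i, q, rfl⟩ := hz
        choose u hu hu' using fun j =>
          exists_symmetric_mul_staircase (MvPolynomial.X i ^ j * q : MvPolynomial (Fin l) ℂ)
        refine ⟨∑ j ∈ Finset.range l, ⟨_, remCoeff_isSymmetric l φ j⟩ * ⟨u j, hu j⟩, ?_, ?_⟩
        · rw [map_sum]
          exact Finset.sum_eq_zero fun j _ => by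
            rw [map_mul, firstClass_remCoeff hφ hdeg hε, zero_mul]
        · rw [aeval_eq_sum_remCoeff, AddSubmonoidClass.coe_finsetSum, Finset.sum_mul,
            Finset.sum_mul, ← Finset.sum_sub_distrib]
          refine Submodule.sum_mem _ fun j _ => ?_
          rw [Subalgebra.coe_mul, mul_assoc, mul_assoc, ← mul_sub]
          exact mul_mem_altSub (remCoeff_isSymmetric l φ j) (hu' j)
      | zero => exact ⟨0, map_zero _, by simp⟩
      | add a b _ _ ha hb =>
        obtain ⟨t, ht, ht'⟩ := ha
        obtain ⟨u, hu, hu'⟩ := hb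
        refine ⟨t + u, by rw [map_add, ht, hu, add_zero], ?_⟩
        rw [Subalgebra.coe_add, add_mul, add_sub_add_comm]
        exact Submodule.add_mem _ ht' hu'
      | smul c a _ ha =>
        obtain ⟨t, ht, ht'⟩ := ha
        refine ⟨c • t, by rw [map_smul, ht, smul_zero], ?_⟩
        rw [Subalgebra.coe_smul, smul_mul_assoc, ← smul_sub]
        exact Submodule.smul_mem _ _ ht'
    obtain ⟨t, ht, ht'⟩ := hc'
    refine ⟨t, ht, ?_⟩
    rw [add_sub_assoc]
    exact Submodule.add_mem _ ha ht'
  obtain ⟨t, ht, ht'⟩ := key _ hs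
  rw [← sub_mul] at ht'
  have h0 := eq_zero_of_mul_staircase_mem (s.2.sub t.2) ht'
  have : s = t := Subtype.ext (sub_eq_zero.1 h0)
  rw [this, ht]

end

/-! ### Commutative algebras of operators -/

section
variable {B V : Type*} [Semiring B] [Algebra ℂ B] [AddCommGroup V] [Module ℂ V]
  (f : B →ₐ[ℂ] Module.End ℂ V)

theorem exists_character_of_eigenvector {χ : B → ℂ} {u : V} (hu : u ≠ 0)
    (h : ∀ X, f X u = χ X • u) : ∃ ψ : B →ₐ[ℂ] ℂ, ⇑ψ = χ := by
  have hinj : ∀ c d : ℂ, c • u = d • u → c = d := fun c d hcd => smul_left_injective ℂ hu hcd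
  refine ⟨AlgHom.ofLinearMap
    { toFun := χ
      map_add' := fun X Y => hinj _ _ ?_
      map_smul' := fun c X => hinj _ _ ?_ } (hinj _ _ ?_) fun X Y => hinj _ _ ?_, rfl⟩
  · rw [← h, map_add, LinearMap.add_apply, h, h, add_smul]
  · rw [← h, map_smul, LinearMap.smul_apply, h, smul_smul]
    rfl
  · change χ 1 • u = _
    rw [← h, map_one, one_smul]
    rfl
  · change χ (X * Y) • u = (χ X * χ Y) • u
    rw [← h, map_mul, Module.End.mul_apply, h Y, map_smul, h X, smul_smul, mul_comm]

variable {f} (hf : ∀ X Y, Commute (f X) (f Y))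
include hf

theorem mapsTo_maxGenEigenspace (X Y : B) (c : ℂ) :
    Set.MapsTo (f X) ((f Y).maxGenEigenspace c) ((f Y).maxGenEigenspace c) :=
  Module.End.mapsTo_maxGenEigenspace_of_comm (hf Y X) c

theorem apply_mem_iInf_maxGenEigenspace {χ : B → ℂ} (X : B) {v : V}
    (hv : v ∈ ⨅ Y, (f Y).maxGenEigenspace (χ Y)) :
    f X v ∈ ⨅ Y, (f Y).maxGenEigenspace (χ Y) := by
  rw [Submodule.mem_iInf] at hv ⊢
  exact fun Y => mapsTo_maxGenEigenspace hf X Y _ (hv Y)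

theorem iSupIndep_iInf_maxGenEigenspace :
    iSupIndep fun χ : B → ℂ => ⨅ X, (f X).maxGenEigenspace (χ X) :=
  Module.End.independent_iInf_maxGenEigenspace_of_forall_mapsTo _ (mapsTo_maxGenEigenspace hf)

variable [FiniteDimensional ℂ V]

theorem iSup_iInf_maxGenEigenspace :
    ⨆ χ : B → ℂ, ⨅ X, (f X).maxGenEigenspace (χ X) = ⊤ :=
  Module.End.iSup_iInf_maxGenEigenspace_eq_top_of_forall_mapsTo _
    (mapsTo_maxGenEigenspace hf) fun X => Module.End.iSup_maxGenEigenspace_eq_top (f X)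

/-- A non-zero invariant subspace of least dimension inside the generalized eigenspace meets each
eigenspace of `f X` in a non-zero invariant subspace, hence lies in all of them. This needs no
finite generation of `B`. -/
theorem iInf_eigenspace_ne_bot {χ : B → ℂ}
    (h : ⨅ X, (f X).maxGenEigenspace (χ X) ≠ ⊥) : ⨅ X, (f X).eigenspace (χ X) ≠ ⊥ := by
  let P : Submodule ℂ V → Prop := fun W => W ≠ ⊥ ∧ (W ≤ ⨅ X, (f X).maxGenEigenspace (χ X)) ∧
    ∀ X, ∀ w ∈ W, f X w ∈ W
  have hP : ∃ d, ∃ W, P W ∧ Module.finrank ℂ W = d :=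
    ⟨_, _, ⟨h, le_rfl, fun X w hw => apply_mem_iInf_maxGenEigenspace hf X hw⟩, rfl⟩
  classical
  obtain ⟨W, ⟨hW0, hWle, hWinv⟩, hWd⟩ := Nat.find_spec hP
  have hmin : ∀ W', P W' → W' ≤ W → W' = W := fun W' hW' hle =>
    Submodule.eq_of_le_of_finrank_le hle (hWd ▸ Nat.find_min' hP ⟨W', hW', rfl⟩)
  refine fun hbot => hW0 (eq_bot_iff.2 (hbot ▸ le_iInf fun X => ?_))
  suffices hX : W ⊓ (f X).eigenspace (χ X) = W from inf_eq_left.1 hX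
  refine hmin _ ⟨?_, inf_le_left.trans hWle, fun Y w hw => ?_⟩ inf_le_left
  · obtain ⟨w, hw, hw0⟩ := Submodule.exists_mem_ne_zero_of_ne_bot hW0
    have h1 := (Submodule.mem_iInf _).1 (hWle hw) X
    rw [Module.End.mem_maxGenEigenspace] at h1
    set T : Module.End ℂ V := f X - χ X • 1 with hT
    have hTW : ∀ n, (T ^ n) w ∈ W := by
      intro n
      induction n with
      | zero => simpa using hw
      | succ n ih =>
        rw [pow_succ', Module.End.mul_apply, hT, LinearMap.sub_apply, LinearMap.smul_apply]
        exact W.sub_mem (hWinv X _ ih) (W.smul_mem _ ih)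
    have hpos : Nat.find h1 ≠ 0 := fun h0 => hw0 (by
      have := Nat.find_spec h1
      rwa [h0, pow_zero, Module.End.one_apply] at this)
    obtain ⟨n, hn⟩ := Nat.exists_eq_succ_of_ne_zero hpos
    -- The last non-zero iterate of the nilpotent action on `w` is an eigenvector.
    refine (Submodule.ne_bot_iff _).2 ⟨(T ^ n) w, Submodule.mem_inf.2 ⟨hTW n, ?_⟩,
      Nat.find_min h1 (by omega)⟩
    have h2 := Nat.find_spec h1
    rw [hn, pow_succ', Module.End.mul_apply] at h2
    rw [Module.End.mem_eigenspace_iff, ← sub_eq_zero]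
    exact h2
  · obtain ⟨hw1, hw2⟩ := Submodule.mem_inf.1 hw
    refine Submodule.mem_inf.2 ⟨hWinv Y w hw1, ?_⟩
    rw [Module.End.mem_eigenspace_iff] at hw2 ⊢
    rw [← Module.End.mul_apply, (hf X Y).eq, Module.End.mul_apply, hw2, map_smul]

theorem exists_character_of_ne_bot {χ : B → ℂ}
    (h : ⨅ X, (f X).maxGenEigenspace (χ X) ≠ ⊥) : ∃ ψ : B →ₐ[ℂ] ℂ, ⇑ψ = χ := by
  obtain ⟨u, hu, hu0⟩ := Submodule.exists_mem_ne_zero_of_ne_bot (iInf_eigenspace_ne_bot hf h)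
  refine exists_character_of_eigenvector f hu0 fun X => ?_
  exact Module.End.mem_eigenspace_iff.1 ((Submodule.mem_iInf _).1 hu X)

/-- The component of the cyclic vector in the generalized eigenspace generates it, because the sum
of the other generalized eigenspaces is an invariant complement. -/
theorem exists_cyclic_genEigenspace {v₀ : V} (hv₀ : ∀ v, ∃ X, f X v₀ = v) (χ : B → ℂ) :
    ∃ v : V, ∀ u : V, u ∈ ⨅ X, (f X).maxGenEigenspace (χ X) ↔ ∃ X, f X v = u := by
  set G : (B → ℂ) → Submodule ℂ V := fun χ => ⨅ X, (f X).maxGenEigenspace (χ X) with hG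
  have hcompl : G χ ⊔ ⨆ (ψ) (_ : ψ ≠ χ), G ψ = ⊤ := by
    rw [eq_top_iff, ← iSup_iInf_maxGenEigenspace hf]
    refine iSup_le fun ψ => ?_
    by_cases h : ψ = χ
    · exact h ▸ le_sup_left
    · exact le_sup_of_le_right (le_iSup₂_of_le ψ h le_rfl)
  have hinv : ∀ X, (⨆ (ψ) (_ : ψ ≠ χ), G ψ) ≤ (⨆ (ψ) (_ : ψ ≠ χ), G ψ).comap (f X) := fun X =>
    iSup₂_le fun ψ h v hv => Submodule.mem_comap.2 <|
      (le_iSup₂_of_le (f := fun ψ (_ : ψ ≠ χ) => G ψ) ψ h le_rfl :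
        G ψ ≤ ⨆ (ψ) (_ : ψ ≠ χ), G ψ) (apply_mem_iInf_maxGenEigenspace hf X hv)
  obtain ⟨v, hv, w, hw, hvw⟩ := Submodule.mem_sup.1 (hcompl ▸ Submodule.mem_top : v₀ ∈ _)
  refine ⟨v, fun u => ⟨fun hu => ?_, ?_⟩⟩
  · obtain ⟨X, hX⟩ := hv₀ u
    refine ⟨X, ?_⟩
    have h1 : f X w ∈ G χ := by
      have : f X w = u - f X v := by rw [← hX, ← hvw, map_add, add_sub_cancel_left]
      rw [this]
      exact Submodule.sub_mem _ hu (apply_mem_iInf_maxGenEigenspace hf X hv)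
    have h2 := Submodule.disjoint_def.1 (iSupIndep_iInf_maxGenEigenspace hf χ) _ h1 (hinv X hw)
    rw [← hX, ← hvw, map_add, h2, add_zero]
  · rintro ⟨X, rfl⟩
    exact apply_mem_iInf_maxGenEigenspace hf X hv

/-- On each joint generalized eigenspace `f X` is a scalar plus a nilpotent operator, and nilpotent
operators have trace zero. -/
theorem trace_eq_sum_finrank (X : B) :
    ∃ hfin : {χ : B → ℂ | ⨅ X, (f X).maxGenEigenspace (χ X) ≠ ⊥}.Finite,
      LinearMap.trace ℂ V (f X) = ∑ χ ∈ hfin.toFinset,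
        Module.finrank ℂ (⨅ X, (f X).maxGenEigenspace (χ X) : Submodule ℂ V) * χ X := by
  classical
  have hind := iSupIndep_iInf_maxGenEigenspace hf
  have hfin := WellFoundedGT.finite_ne_bot_of_iSupIndep hind
  refine ⟨hfin, ?_⟩
  have hmaps : ∀ χ : B → ℂ, Set.MapsTo (f X) (⨅ X, (f X).maxGenEigenspace (χ X) : Submodule ℂ V)
      (⨅ X, (f X).maxGenEigenspace (χ X) : Submodule ℂ V) := fun χ v hv =>
    apply_mem_iInf_maxGenEigenspace hf X hv
  rw [LinearMap.trace_eq_sum_trace_restrict'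
    (DirectSum.isInternal_submodule_of_iSupIndep_of_iSup_eq_top hind
      (iSup_iInf_maxGenEigenspace hf)) hfin hmaps]
  refine Finset.sum_congr rfl fun χ _ => ?_
  set G : Submodule ℂ V := ⨅ X, (f X).maxGenEigenspace (χ X) with hG
  have hnil : IsNilpotent ((f X).restrict (hmaps χ) - algebraMap ℂ (Module.End ℂ G) (χ X)) := by
    have hle : G ≤ (f X).maxGenEigenspace (χ X) := iInf_le _ X
    refine ⟨Module.finrank ℂ V, LinearMap.ext fun v => Subtype.ext ?_⟩
    have h1 := hle v.2
    rw [Module.End.maxGenEigenspace_eq_genEigenspace_finrank, Module.End.mem_genEigenspace_nat,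
      LinearMap.mem_ker, ← Algebra.algebraMap_eq_smul_one] at h1
    have h2 : ∀ m, (((((f X).restrict (hmaps χ) - algebraMap ℂ (Module.End ℂ G) (χ X)) ^ m) v : G) : V) =
        ((f X - algebraMap ℂ (Module.End ℂ V) (χ X)) ^ m) v := by
      intro m
      induction m with
      | zero => rfl
      | succ m ih =>
        rw [pow_succ', pow_succ', Module.End.mul_apply, Module.End.mul_apply, ← ih]
        rfl
    rw [h2]
    exact h1
  have h0 := (LinearMap.isNilpotent_trace_of_isNilpotent hnil).eq_zero
  rw [map_sub, sub_eq_zero] at h0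
  rw [h0, Algebra.algebraMap_eq_smul_one, map_smul, LinearMap.trace_one, smul_eq_mul, mul_comm]

/-- The trace is written as a sum of characters in two ways. Distinct characters are linearly
independent, so the multiplicities agree as complex numbers, hence as natural numbers. -/
theorem finrank_genEigenspace_eq_card {ι : Type*} [Fintype ι] [DecidableEq (B →ₐ[ℂ] ℂ)]
    (c : ι → (B →ₐ[ℂ] ℂ)) (hc : ∀ X, LinearMap.trace ℂ V (f X) = ∑ i, c i X) (ψ : B →ₐ[ℂ] ℂ) :
    Module.finrank ℂ (⨅ X, (f X).maxGenEigenspace (ψ X) : Submodule ℂ V) =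
      (Finset.univ.filter fun i => c i = ψ).card := by
  set d : (B →ₐ[ℂ] ℂ) → ℕ := fun χ =>
    Module.finrank ℂ (⨅ X, (f X).maxGenEigenspace (χ X) : Submodule ℂ V) with hd
  have hind : LinearIndependent ℂ fun χ : B →ₐ[ℂ] ℂ => (⇑χ : B → ℂ) := by
    refine (linearIndependent_monoidHom B ℂ).comp
      (fun χ : B →ₐ[ℂ] ℂ => (χ : B →* ℂ)) fun χ χ' h => ?_
    ext X
    exact DFunLike.congr_fun h X
  obtain ⟨hfin, -⟩ := trace_eq_sum_finrank hf (f := f) 0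
  have hinj : Function.Injective fun χ : B →ₐ[ℂ] ℂ => (⇑χ : B → ℂ) := DFunLike.coe_injective
  let S : Finset (B →ₐ[ℂ] ℂ) := hfin.toFinset.preimage (fun χ : B →ₐ[ℂ] ℂ => (⇑χ : B → ℂ))
    hinj.injOn
  have hS : ∀ χ, χ ∉ S → d χ = 0 := by
    intro χ hχ
    have : (⨅ X, (f X).maxGenEigenspace (χ X) : Submodule ℂ V) = ⊥ := by
      by_contra h
      exact hχ (Finset.mem_preimage.2 (hfin.mem_toFinset.2 h))
    exact (congrArg (fun W : Submodule ℂ V => Module.finrank ℂ W) this).trans (finrank_bot ℂ V)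
  have htr : ∀ X, LinearMap.trace ℂ V (f X) = ∑ χ ∈ S, (d χ : ℂ) * χ X := by
    intro X
    obtain ⟨hfin', h⟩ := trace_eq_sum_finrank hf X
    rw [h]
    refine (Finset.sum_preimage _ _ hinj.injOn (fun χ : B → ℂ =>
      (Module.finrank ℂ (⨅ X, (f X).maxGenEigenspace (χ X) : Submodule ℂ V) : ℂ) * χ X) ?_).symm
    intro χ hχ hχ'
    obtain ⟨ψ, rfl⟩ := exists_character_of_ne_bot hf (hfin.mem_toFinset.1 hχ)
    exact absurd ⟨ψ, rfl⟩ hχ'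
  let T : Finset (B →ₐ[ℂ] ℂ) := insert ψ (S ∪ Finset.univ.image c)
  have h1 : ∑ χ ∈ T, ((d χ : ℂ) - (Finset.univ.filter fun i => c i = χ).card) •
      (⇑χ : B → ℂ) = 0 := by
    funext X
    rw [Finset.sum_apply, Pi.zero_apply]
    simp only [Pi.smul_apply, smul_eq_mul, sub_mul, Finset.sum_sub_distrib]
    rw [sub_eq_zero]
    have e1 : ∑ χ ∈ T, (d χ : ℂ) * χ X = ∑ χ ∈ S, (d χ : ℂ) * χ X := by
      refine (Finset.sum_subset (fun χ hχ => ?_) fun χ _ hχ => ?_).symm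
      · exact Finset.mem_insert_of_mem (Finset.mem_union_left _ hχ)
      · rw [hS χ hχ, Nat.cast_zero, zero_mul]
    rw [e1, ← htr, hc, ← Finset.sum_fiberwise_of_maps_to (t := T) (g := c) fun i _ =>
      Finset.mem_insert_of_mem (Finset.mem_union_right _ (Finset.mem_image_of_mem _ (Finset.mem_univ i)))]
    refine Finset.sum_congr rfl fun χ _ => ?_
    rw [Finset.sum_congr rfl fun i hi => by rw [(Finset.mem_filter.1 hi).2], Finset.sum_const,
      nsmul_eq_mul]
  have h2 := linearIndependent_iff'.1 hind T _ h1 ψ (Finset.mem_insert_self _ _)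
  exact_mod_cast sub_eq_zero.1 h2

end

/-! ### Commutative algebras of operators with a cyclic vector and a cocyclic form -/

section
variable {V : Type*} [AddCommGroup V] [Module ℂ V] {A : Subalgebra ℂ (Module.End ℂ V)}
  {v₀ : V} (hv₀ : ∀ v, ∃ T ∈ A, T v₀ = v)
include hv₀

theorem eq_of_apply_cyclic {S T : Module.End ℂ V} (hS : ∀ R ∈ A, S * R = R * S)
    (hT : ∀ R ∈ A, T * R = R * T) (h : S v₀ = T v₀) : S = T := by
  refine LinearMap.ext fun v => ?_
  obtain ⟨R, hR, rfl⟩ := hv₀ v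
  rw [← Module.End.mul_apply, ← Module.End.mul_apply, hS R hR, hT R hR, Module.End.mul_apply,
    Module.End.mul_apply, h]

variable (hA : ∀ S ∈ A, ∀ T ∈ A, S * T = T * S)
include hA

/-- An operator commuting with `A` is determined by its value on the cyclic vector, and that value
is also taken by a member of `A`. -/
theorem maximal_of_cyclic : Maximal (fun A : Subalgebra ℂ (Module.End ℂ V) =>
    ∀ S ∈ A, ∀ T ∈ A, S * T = T * S) A := by
  refine ⟨hA, fun A' hA' hle S hS => ?_⟩
  obtain ⟨T, hT, h⟩ := hv₀ (S v₀)
  rw [← eq_of_apply_cyclic hv₀ (fun R hR => hA T hT R hR)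
    (fun R hR => hA' S hS R (hle hR)) h]
  exact hT

/-- The isomorphism of the regular representation with a cyclic faithful module. -/
def regularEquiv : A ≃ₗ[A] V :=
  LinearEquiv.ofBijective (LinearMap.toSpanSingleton A V v₀) <| by
    constructor
    · intro S T h
      exact Subtype.ext (eq_of_apply_cyclic hv₀ (fun R hR => hA S S.2 R hR)
        (fun R hR => hA T T.2 R hR) h)
    · intro v
      obtain ⟨T, hT, h⟩ := hv₀ v
      exact ⟨⟨T, hT⟩, h⟩

theorem finrank_of_cyclic : Module.finrank ℂ A = Module.finrank ℂ V :=
  LinearEquiv.finrank_eq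
    { (regularEquiv hv₀ hA) with
      map_smul' := fun _ _ => rfl }

/-- The form is `(S, T) ↦ ω (S T v₀)`: commutativity gives symmetry, associativity gives invariance,
and the cocyclic hypothesis gives non-degeneracy. -/
theorem isFrobenius_of_cyclic [FiniteDimensional ℂ V] {ω : V →ₗ[ℂ] ℂ}
    (hω : ∀ v, (∀ T ∈ A, ω (T v) = 0) → v = 0) : IsFrobenius A := by
  have hcomm : ∀ S T : A, S * T = T * S := fun S T => Subtype.ext (hA S S.2 T T.2)
  refine ⟨hcomm, inferInstance, ?_⟩
  let F : LinearMap.BilinForm ℂ A := LinearMap.mk₂ ℂ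
    (fun S T => ω ((S * T : Module.End ℂ V) v₀))
    (by intros; simp [add_mul]) (by intros; simp) (by intros; simp [mul_add])
    (by intros; simp)
  have hF : ∀ S T : A, F S T = ω ((S * T : Module.End ℂ V) v₀) := fun _ _ => rfl
  have hsymm : F.IsSymm := ⟨fun S T => by rw [hF, hF, hA S S.2 T T.2]⟩
  have hsep : ∀ S : A, (∀ T : A, F T S = 0) → S = 0 := by
    intro S hS
    refine Subtype.ext (eq_of_apply_cyclic hv₀ (fun R hR => hA S S.2 R hR)
      (fun R hR => by simp) ?_)
    exact hω _ fun T hT => hS ⟨T, hT⟩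
  refine ⟨F, hsymm, ⟨fun S hS => hsep S fun T => ?_, hsep⟩, fun S T R => ?_⟩
  · rw [hsymm.eq]; exact hS T
  · rw [hF, hF, Subalgebra.coe_mul, Subalgebra.coe_mul, mul_assoc]

end

/-- On a joint eigenspace `ω (f X v)` is a multiple of `ω v`, so a cocyclic form is injective there.
-/
theorem finrank_iInf_eigenspace {B V : Type*} [Semiring B] [Algebra ℂ B] [AddCommGroup V] [Module ℂ V]
    {f : B →ₐ[ℂ] Module.End ℂ V} {ω : V →ₗ[ℂ] ℂ}
    (hω : ∀ v, (∀ X, ω (f X v) = 0) → v = 0) {χ : B → ℂ}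
    (h : ⨅ X, (f X).eigenspace (χ X) ≠ ⊥) :
    Module.finrank ℂ (⨅ X, (f X).eigenspace (χ X) : Submodule ℂ V) = 1 := by
  set E : Submodule ℂ V := ⨅ X, (f X).eigenspace (χ X) with hE
  have hinj : Function.Injective (ω ∘ₗ E.subtype) := by
    rw [← LinearMap.ker_eq_bot, LinearMap.ker_eq_bot']
    intro v hv
    refine Subtype.ext (hω v fun X => ?_)
    have hvX := Module.End.mem_eigenspace_iff.1 ((Submodule.mem_iInf _).1 v.2 X)
    rw [hvX, map_smul]
    have : ω v = 0 := hv
    rw [this, smul_zero]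
  have hfd : FiniteDimensional ℂ E := FiniteDimensional.of_injective _ hinj
  refine le_antisymm ((LinearMap.finrank_le_finrank_of_injective hinj).trans
    (Module.finrank_self ℂ).le) ?_
  rw [Nat.one_le_iff_ne_zero]
  exact fun h0 => h (Submodule.finrank_eq_zero.1 h0)

/-! ### Quotients of polynomials modulo antisymmetry and `φ` -/

/-- A realization of the `l`-th exterior power of `ℂ[x]/φ` as a quotient of the polynomials in
`l` variables. -/
structure IsWedgeQuotient (φ : Polynomial ℂ) {l : ℕ} {V : Type*} [AddCommGroup V] [Module ℂ V]
    (L : MvPolynomial (Fin l) ℂ →ₗ[ℂ] V) : Prop where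
  surjective : Function.Surjective L
  ker_eq : LinearMap.ker L = wedgeKer φ l

namespace IsWedgeQuotient

variable {φ : Polynomial ℂ} {l : ℕ} {V : Type*} [AddCommGroup V] [Module ℂ V]
  {L : MvPolynomial (Fin l) ℂ →ₗ[ℂ] V} (hL : IsWedgeQuotient φ L)
include hL

theorem eq_zero_iff (q : MvPolynomial (Fin l) ℂ) : L q = 0 ↔ q ∈ wedgeKer φ l := by
  rw [← hL.ker_eq, LinearMap.mem_ker]

theorem exists_mulOp (s : MvPolynomial.symmetricSubalgebra (Fin l) ℂ) :
    ∃ T : Module.End ℂ V, ∀ q, T (L q) = L (s * q) := by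
  let g := Function.surjInv hL.surjective
  have hg : ∀ v, L (g v) = v := Function.surjInv_eq hL.surjective
  have hmul : ∀ q q' : MvPolynomial (Fin l) ℂ, L q = L q' → L (s * q) = L (s * q') := by
    intro q q' h
    rw [← sub_eq_zero, ← map_sub, hL.eq_zero_iff] at h ⊢
    rw [← mul_sub]
    exact mul_mem_wedgeKer s.2 h
  refine ⟨{ toFun := fun v => L (s * g v), map_add' := fun v w => ?_, map_smul' := fun c v => ?_ },
    fun q => hmul _ _ (hg _)⟩
  · rw [← map_add, ← mul_add]
    exact hmul _ _ (by rw [hg, map_add, hg, hg])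
  · rw [RingHom.id_apply, ← map_smul, ← mul_smul_comm]
    exact hmul _ _ (by rw [hg, map_smul, hg])

/-- The action of symmetric polynomials by multiplication. -/
def symmAct : MvPolynomial.symmetricSubalgebra (Fin l) ℂ →ₐ[ℂ] Module.End ℂ V :=
  have hext : ∀ S T : Module.End ℂ V, (∀ q, S (L q) = T (L q)) → S = T := fun S T h =>
    LinearMap.ext fun v => by
      obtain ⟨q, rfl⟩ := hL.surjective v
      exact h q
  have h := fun s => (hL.exists_mulOp s).choose_spec
  AlgHom.ofLinearMap
    { toFun := fun s => (hL.exists_mulOp s).choose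
      map_add' := fun s t => hext _ _ fun q => by
        rw [LinearMap.add_apply, h, h, h, Subalgebra.coe_add, add_mul, map_add]
      map_smul' := fun c s => hext _ _ fun q => by
        rw [RingHom.id_apply, LinearMap.smul_apply, h, h, Subalgebra.coe_smul, smul_mul_assoc,
          map_smul] }
    (hext _ _ fun q => (h _ q).trans (by rw [Subalgebra.coe_one, one_mul]; rfl))
    (fun s t => hext _ _ fun q => (h _ q).trans (by
      rw [Subalgebra.coe_mul, mul_assoc, Module.End.mul_apply]
      exact ((h s _).symm.trans (congrArg _ (h t q).symm))))

theorem symmAct_apply (s : MvPolynomial.symmetricSubalgebra (Fin l) ℂ)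
    (q : MvPolynomial (Fin l) ℂ) : hL.symmAct s (L q) = L (s * q) :=
  (hL.exists_mulOp s).choose_spec q

theorem commute_symmAct (s t : MvPolynomial.symmetricSubalgebra (Fin l) ℂ) :
    Commute (hL.symmAct s) (hL.symmAct t) := by
  rw [Commute, SemiconjBy, ← map_mul, ← map_mul, mul_comm]

theorem exists_symmAct_staircase (v : V) : ∃ s, hL.symmAct s (L (staircase l)) = v := by
  obtain ⟨q, rfl⟩ := hL.surjective v
  obtain ⟨s, hs, h⟩ := exists_symmetric_mul_staircase q
  refine ⟨⟨s, hs⟩, ?_⟩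
  rw [symmAct_apply, eq_comm, ← sub_eq_zero, ← map_sub, hL.eq_zero_iff]
  exact Submodule.mem_sup_left h

theorem span_prodVars {m : ℕ} (S : Polynomial.Sequence ℂ) (hS : ∀ i, m ≤ i → φ ∣ S i) :
    ⊤ ≤ Submodule.span ℂ (Set.range fun I : Fin l ↪o Fin m => L (prodVars fun i => S (I i))) := by
  have h := congrArg (Submodule.map L) (wedgeKer_sup_span S hS l)
  rw [Submodule.map_sup, ← hL.ker_eq, LinearMap.le_ker_iff_map.1 le_rfl, bot_sup_eq,
    Submodule.map_span, Submodule.map_top, LinearMap.range_eq_top.2 hL.surjective,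
    ← Set.range_comp] at h
  exact h.ge

theorem finiteDimensional {m : ℕ} (S : Polynomial.Sequence ℂ) (hS : ∀ i, m ≤ i → φ ∣ S i) :
    FiniteDimensional ℂ V :=
  ⟨top_le_iff.1 (hL.span_prodVars S hS) ▸ Submodule.fg_span (Set.finite_range _)⟩

variable {l' : ℕ} {ℓ : MvPolynomial (Fin (l + l')) ℂ →ₗ[ℂ] ℂ}
  (hℓ : IsTopForm φ ℓ) (hφ : φ.Monic) (hdeg : φ.natDegree = l + l')
include hℓ hφ hdeg

theorem finrank_eq : Module.finrank ℂ V = Fintype.card (Fin l ↪o Fin (l + l')) := by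
  have hspan := hL.span_prodVars (m := l + l') (powerSequence φ hφ)
    (fun i hi => dvd_powerSequence hφ i (hdeg ▸ hi))
  have hli : LinearIndependent ℂ fun I : Fin l ↪o Fin (l + l') =>
      L (prodVars fun i => powerSequence φ hφ (I i)) := by
    rw [Fintype.linearIndependent_iff]
    intro c hc
    simp only [← map_smul, ← map_sum, hL.eq_zero_iff] at hc
    exact hℓ.coeff_eq_zero_of_pairing hφ hdeg c (hℓ.pairing_eq_zero_of_wedgeKer hc)
  exact Module.finrank_eq_card_basis (Module.Basis.mk hli hspan)

theorem finrank_eq_choose : Module.finrank ℂ V = (l + l').choose l := by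
  rw [hL.finrank_eq hℓ hφ hdeg, Fintype.card_congr Set.powersetCard.ofFinEmbEquiv,
    ← Nat.card_eq_fintype_card, Set.powersetCard.card, Nat.card_eq_fintype_card, Fintype.card_fin]

/-- The basis that corresponds to a basis of polynomials compatible with `φ`. -/
def sequenceBasis (S : Polynomial.Sequence ℂ) (hS : ∀ i, l + l' ≤ i → φ ∣ S i) :
    Module.Basis (Fin l ↪o Fin (l + l')) ℂ V :=
  Module.Basis.mk (linearIndependent_of_top_le_span_of_card_eq_finrank (hL.span_prodVars S hS)
    (hL.finrank_eq hℓ hφ hdeg).symm) (hL.span_prodVars S hS)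

theorem sequenceBasis_apply (S : Polynomial.Sequence ℂ) (hS : ∀ i, l + l' ≤ i → φ ∣ S i)
    (I : Fin l ↪o Fin (l + l')) :
    hL.sequenceBasis hℓ hφ hdeg S hS I = L (prodVars fun i => S (I i)) :=
  Module.Basis.mk_apply _ _ I

theorem exists_cocyclic : ∃ ω : V →ₗ[ℂ] ℂ, ∀ v, (∀ s, ω (hL.symmAct s v) = 0) → v = 0 := by
  obtain ⟨ω, hω⟩ : ∃ ω : V →ₗ[ℂ] ℂ, ∀ q,
      ω (L q) = ℓ (firstVars l l' q * lastVars l l' (staircase l')) := by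
    let F : MvPolynomial (Fin l) ℂ →ₗ[ℂ] ℂ := ℓ ∘ₗ
      LinearMap.mulRight ℂ (lastVars l l' (staircase l')) ∘ₗ (firstVars l l').toLinearMap
    have hF : LinearMap.ker L ≤ LinearMap.ker F := by
      rw [hL.ker_eq]
      exact fun q hq => hℓ.pairing_eq_zero_of_wedgeKer hq _
    refine ⟨(LinearMap.ker L).liftQ F hF ∘ₗ
      (L.quotKerEquivOfSurjective hL.surjective).symm.toLinearMap, fun q => ?_⟩
    have : (L.quotKerEquivOfSurjective hL.surjective).symm (L q) = Submodule.Quotient.mk q := by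
      rw [LinearEquiv.symm_apply_eq]
      rfl
    rw [LinearMap.comp_apply, LinearEquiv.coe_coe, this]
    rfl
  refine ⟨ω, fun v hv => ?_⟩
  obtain ⟨q, rfl⟩ := hL.surjective v
  rw [hL.eq_zero_iff]
  refine hℓ.wedgeKer_of_frobenius hφ hdeg fun s hs => ?_
  rw [← hω, ← hL.symmAct_apply ⟨s, hs⟩]
  exact hv _

/-- Testing on the staircase gives one direction. For the other, elements of zero class pair to zero
with everything, and the pairing is non-degenerate. -/
theorem symmAct_eq_zero_iff {ε : ℕ → ℂ}
    (hε : ∀ i, 1 ≤ i → i ≤ l + l' → ε i = (-1) ^ i * φ.coeff (l + l' - i))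
    (s : MvPolynomial.symmetricSubalgebra (Fin l) ℂ) :
    hL.symmAct s = 0 ↔ firstClass l l' ε s = 0 := by
  constructor
  · intro h
    refine firstClass_eq_zero_of_wedgeKer hφ hdeg hε ?_
    rw [← hL.eq_zero_iff, ← hL.symmAct_apply, h, LinearMap.zero_apply]
  · intro h
    refine LinearMap.ext fun v => ?_
    obtain ⟨q, rfl⟩ := hL.surjective v
    rw [hL.symmAct_apply, LinearMap.zero_apply, hL.eq_zero_iff]
    exact hℓ.mul_mem_wedgeKer_of_firstClass hφ hdeg hε h q

theorem nonempty_range_equiv {ε : ℕ → ℂ}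
    (hε : ∀ i, 1 ≤ i → i ≤ l + l' → ε i = (-1) ^ i * φ.coeff (l + l' - i)) :
    Nonempty (hL.symmAct.range ≃ₐ[ℂ] (invariants (l + l') l ⧸ symmIdeal (l + l') l ε)) := by
  have hker : RingHom.ker hL.symmAct.rangeRestrict = RingHom.ker (firstClass l l' ε) := by
    ext s
    rw [RingHom.mem_ker, RingHom.mem_ker, ← hL.symmAct_eq_zero_iff hℓ hφ hdeg hε]
    exact ⟨fun h => congrArg Subtype.val h, fun h => Subtype.ext h⟩
  exact ⟨((Ideal.quotientKerAlgEquivOfSurjective hL.symmAct.rangeRestrict_surjective).symm.trans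
    (Ideal.quotientEquivAlgOfEq ℂ hker)).trans
    (Ideal.quotientKerAlgEquivOfSurjective (firstClass_surjective l l' ε))⟩

end IsWedgeQuotient

/-! ### Newton bases -/

/-- The Newton polynomials `∏_{j < i} (x - a_j)`. -/
def newton (a : ℕ → ℂ) : Polynomial.Sequence ℂ where
  elems' i := ∏ j ∈ Finset.range i, (Polynomial.X - Polynomial.C (a j))
  degree_eq' i := by
    rw [Polynomial.degree_prod]
    simp

theorem newton_apply (a : ℕ → ℂ) (i : ℕ) :
    newton a i = ∏ j ∈ Finset.range i, (Polynomial.X - Polynomial.C (a j)) := rfl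

theorem newton_dvd (a : ℕ → ℂ) {m i : ℕ} (h : m ≤ i) : newton a m ∣ newton a i :=
  Finset.prod_dvd_prod_of_subset _ _ _ (Finset.range_mono h)

theorem X_mul_newton (a : ℕ → ℂ) (i : ℕ) :
    Polynomial.X * newton a i = Polynomial.C (a i) * newton a i + newton a (i + 1) := by
  rw [newton_apply, newton_apply, Finset.prod_range_succ]
  ring

/-- Take for `a` any listing of the roots with multiplicity; the default value beyond the list plays
no role. -/
theorem exists_newton_eq {φ : Polynomial ℂ} (hφ : φ.Monic) :
    ∃ a : ℕ → ℂ, newton a φ.natDegree = φ := by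
  have hs := (IsAlgClosed.splits φ).eq_prod_roots_of_monic hφ
  have hc := (IsAlgClosed.splits φ).natDegree_eq_card_roots
  refine ⟨fun j => φ.roots.toList.getD j 0, ?_⟩
  rw [newton_apply, hc]
  conv_rhs => rw [hs, ← Multiset.coe_toList φ.roots, Multiset.map_coe, Multiset.prod_coe]
  rw [← Multiset.length_toList, ← Fin.prod_univ_eq_prod_range, ← List.prod_ofFn]
  congr 1
  refine List.ext_getElem (by simp) fun i h1 h2 => ?_
  simp

theorem C_mul_prodVars_update {l : ℕ} (p : Fin l → Polynomial ℂ) (i : Fin l) (c : ℂ) :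
    prodVars (Function.update p i (Polynomial.C c * p i)) = MvPolynomial.C c * prodVars p := by
  rw [← aeval_mul_prodVars, Polynomial.aeval_C, MvPolynomial.algebraMap_eq]

theorem prodVars_update_add {l : ℕ} (p : Fin l → Polynomial ℂ) (i : Fin l) (f g : Polynomial ℂ) :
    prodVars (Function.update p i (f + g)) =
      prodVars (Function.update p i f) + prodVars (Function.update p i g) := by
  have h : ∀ f, prodVars (Function.update p i f) = aeval (MvPolynomial.X i) f *
      prodVars (Function.update p i 1) := fun f => by
    rw [aeval_mul_prodVars]; simp
  rw [h, h f, h g, map_add, add_mul]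

theorem X_mul_prodVars_newton (a : ℕ → ℂ) {l : ℕ} (μ : Fin l → ℕ) (i : Fin l) :
    MvPolynomial.X i * prodVars (fun j => newton a (μ j)) =
      MvPolynomial.C (a (μ i)) * prodVars (fun j => newton a (μ j)) +
        prodVars (fun j => newton a (Function.update μ i (μ i + 1) j)) := by
  have h := aeval_mul_prodVars i Polynomial.X (fun j => newton a (μ j))
  rw [Polynomial.aeval_X, X_mul_newton, prodVars_update_add] at h
  rw [h, C_mul_prodVars_update]
  congr 2
  funext j
  by_cases hj : j = i
  · subst hj; simp
  · simp [hj]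

/-- The span of the products of Newton polynomials of index sum at least `d`. -/
def newtonFilt (a : ℕ → ℂ) (l d : ℕ) : Submodule ℂ (MvPolynomial (Fin l) ℂ) :=
  Submodule.span ℂ {x | ∃ μ : Fin l → ℕ, d ≤ ∑ i, μ i ∧ x = prodVars fun i => newton a (μ i)}

theorem newtonFilt_anti (a : ℕ → ℂ) (l : ℕ) {d d' : ℕ} (h : d ≤ d') :
    newtonFilt a l d' ≤ newtonFilt a l d :=
  Submodule.span_mono fun _ ⟨μ, hμ, hx⟩ => ⟨μ, h.trans hμ, hx⟩

/-- From `x N_i = a_i N_i + N_{i+1}`, a variable acts on a product of Newton polynomials by its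
diagonal value plus a term of larger index sum. This is the triangularity behind the spectrum. -/
theorem mul_prodVars_newton (a : ℕ → ℂ) {l : ℕ} (q : MvPolynomial (Fin l) ℂ) (μ : Fin l → ℕ) :
    q * prodVars (fun i => newton a (μ i)) -
      MvPolynomial.eval (fun i => a (μ i)) q • prodVars (fun i => newton a (μ i)) ∈
        newtonFilt a l (∑ i, μ i + 1) := by
  induction q using MvPolynomial.induction_on generalizing μ with
  | C c =>
    rw [MvPolynomial.eval_C, MvPolynomial.smul_eq_C_mul, sub_self]
    exact Submodule.zero_mem _
  | add p q hp hq =>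
    rw [map_add, add_mul, add_smul, add_sub_add_comm]
    exact Submodule.add_mem _ (hp μ) (hq μ)
  | mul_X p i hp =>
    set μ' := Function.update μ i (μ i + 1) with hμ'
    have hsum : ∑ j, μ' j = ∑ j, μ j + 1 := by
      rw [hμ', Finset.sum_update_of_mem (Finset.mem_univ i),
        Finset.sum_eq_add_sum_sdiff_singleton_of_mem (Finset.mem_univ i) μ]
      omega
    have h1 := Submodule.smul_mem _ (a (μ i)) (hp μ)
    have h2 := newtonFilt_anti a l (by omega : ∑ j, μ j + 1 ≤ ∑ j, μ' j + 1) (hp μ')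
    have h3 : prodVars (fun i => newton a (μ' i)) ∈ newtonFilt a l (∑ j, μ j + 1) :=
      Submodule.subset_span ⟨μ', hsum.ge, rfl⟩
    have h4 := Submodule.add_mem _ (Submodule.add_mem _ h1 h2)
      (Submodule.smul_mem _ (MvPolynomial.eval (fun i => a (μ' i)) p) h3)
    convert h4 using 1
    rw [mul_assoc, X_mul_prodVars_newton, map_mul, MvPolynomial.eval_X]
    simp only [MvPolynomial.smul_eq_C_mul, map_mul]
    ring

/-! ### Characters and traces in the Newton basis -/

namespace IsWedgeQuotient

variable {φ : Polynomial ℂ} {l : ℕ} {V : Type*} [AddCommGroup V] [Module ℂ V]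
  {L : MvPolynomial (Fin l) ℂ →ₗ[ℂ] V} (hL : IsWedgeQuotient φ L)

theorem dvd_newton {m : ℕ} {a : ℕ → ℂ} (ha : newton a m = φ) (i : ℕ) (h : m ≤ i) :
    φ ∣ newton a i :=
  ha ▸ newton_dvd a h

include hL in
theorem map_newtonFilt_le {m : ℕ} {a : ℕ → ℂ} (ha : newton a m = φ) {d : ℕ}
    {x : MvPolynomial (Fin l) ℂ} (hx : x ∈ newtonFilt a l d) :
    L x ∈ Submodule.span ℂ {v | ∃ J : Fin l ↪o Fin m, d ≤ ∑ i, (J i : ℕ) ∧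
      v = L (prodVars fun i => newton a (J i))} := by
  induction hx using Submodule.span_induction with
  | mem x hx =>
    obtain ⟨μ, hμ, rfl⟩ := hx
    rcases prodVars_sort (newton a) (dvd_newton ha) μ with h | ⟨J, c, hJ, h⟩
    · rw [(hL.eq_zero_iff _).2 h]
      exact Submodule.zero_mem _
    · rw [← hL.eq_zero_iff, map_sub, sub_eq_zero] at h
      rw [h, map_zsmul]
      refine zsmul_mem (Submodule.subset_span ?_) c
      exact ⟨J, hJ ▸ hμ, rfl⟩
  | zero => rw [map_zero]; exact Submodule.zero_mem _
  | add x y _ _ hx hy => rw [map_add]; exact Submodule.add_mem _ hx hy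
  | smul c x _ hx => rw [map_smul]; exact Submodule.smul_mem _ c hx

variable {l' : ℕ} {ℓ : MvPolynomial (Fin (l + l')) ℂ →ₗ[ℂ] ℂ}
  (hℓ : IsTopForm φ ℓ) (hφ : φ.Monic) (hdeg : φ.natDegree = l + l')
  {a : ℕ → ℂ} (ha : newton a (l + l') = φ)

/-- The error terms have strictly larger index sum. Sorting preserves index sums, so the basis
vector `I` itself cannot occur among them. -/
theorem repr_symmAct_newton (s : MvPolynomial.symmetricSubalgebra (Fin l) ℂ)
    (I : Fin l ↪o Fin (l + l')) :
    (hL.sequenceBasis hℓ hφ hdeg (newton a) (dvd_newton ha)).repr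
      (hL.symmAct s (hL.sequenceBasis hℓ hφ hdeg (newton a) (dvd_newton ha) I)) I =
      MvPolynomial.eval (fun i => a (I i)) (s : MvPolynomial (Fin l) ℂ) := by
  set N := hL.sequenceBasis hℓ hφ hdeg (newton a) (dvd_newton ha) with hN
  have hNI : ∀ J, N J = L (prodVars fun i => newton a (J i)) :=
    hL.sequenceBasis_apply hℓ hφ hdeg (newton a) (dvd_newton ha)
  have h1 := hL.map_newtonFilt_le ha
    (mul_prodVars_newton a (s : MvPolynomial (Fin l) ℂ) fun i => (I i : ℕ))
  rw [map_sub, map_smul, ← hL.symmAct_apply, ← hNI] at h1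
  have h2 : ∀ v ∈ Submodule.span ℂ {v | ∃ J : Fin l ↪o Fin (l + l'),
      ∑ i, (I i : ℕ) + 1 ≤ ∑ i, (J i : ℕ) ∧ v = L (prodVars fun i => newton a (J i))},
      N.repr v I = 0 := by
    intro v hv
    induction hv using Submodule.span_induction with
    | mem x hx =>
      obtain ⟨J, hJ, rfl⟩ := hx
      rw [← hNI, Module.Basis.repr_self, Finsupp.single_apply, if_neg]
      rintro rfl
      omega
    | zero => simp
    | add x y _ _ hx hy => simp [hx, hy]
    | smul c x _ hx => simp [hx]
  have h3 := h2 _ h1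
  rw [map_sub, map_smul, Finsupp.sub_apply, Finsupp.smul_apply, Module.Basis.repr_self,
    Finsupp.single_eq_same, smul_eq_mul, mul_one, sub_eq_zero] at h3
  exact h3

include hℓ hφ hdeg ha in
theorem trace_symmAct (s : MvPolynomial.symmetricSubalgebra (Fin l) ℂ) :
    LinearMap.trace ℂ V (hL.symmAct s) = ∑ I : Fin l ↪o Fin (l + l'),
      MvPolynomial.eval (fun i => a (I i)) (s : MvPolynomial (Fin l) ℂ) := by
  classical
  rw [LinearMap.trace_eq_matrix_trace ℂ (hL.sequenceBasis hℓ hφ hdeg (newton a) (dvd_newton ha)),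
    Matrix.trace]
  refine Finset.sum_congr rfl fun I _ => ?_
  rw [Matrix.diag_apply, LinearMap.toMatrix_apply, hL.repr_symmAct_newton hℓ hφ hdeg ha]

variable {B : Type*} [Semiring B] [Algebra ℂ B] {f : B →ₐ[ℂ] Module.End ℂ V}
  (hf : f.range = hL.symmAct.range)

include hf in
theorem exists_symmAct_eq (X : B) : ∃ s, hL.symmAct s = f X :=
  (hf ▸ ⟨X, rfl⟩ : f X ∈ hL.symmAct.range)

include hf in
theorem exists_eq_symmAct (s : MvPolynomial.symmetricSubalgebra (Fin l) ℂ) :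
    ∃ X, f X = hL.symmAct s :=
  (hf ▸ ⟨s, rfl⟩ : hL.symmAct s ∈ f.range)

/-- The diagonal coefficients of the action in the Newton basis. -/
def character (I : Fin l ↪o Fin (l + l')) : B →ₐ[ℂ] ℂ :=
  let N := hL.sequenceBasis hℓ hφ hdeg (newton a) (dvd_newton ha)
  AlgHom.ofLinearMap (N.coord I ∘ₗ LinearMap.applyₗ (N I) ∘ₗ f.toLinearMap)
    (by simp) (fun X Y => by
      obtain ⟨s, hs⟩ := hL.exists_symmAct_eq hf X
      obtain ⟨t, ht⟩ := hL.exists_symmAct_eq hf Y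
      simp only [LinearMap.comp_apply, AlgHom.toLinearMap_apply, map_mul, ← hs, ← ht,
        LinearMap.applyₗ_apply_apply, Module.Basis.coord_apply]
      rw [← map_mul]
      simp only [N, hL.repr_symmAct_newton hℓ hφ hdeg ha]
      rw [Subalgebra.coe_mul, map_mul])

theorem character_apply (I : Fin l ↪o Fin (l + l')) {X : B}
    {s : MvPolynomial.symmetricSubalgebra (Fin l) ℂ} (h : f X = hL.symmAct s) :
    hL.character hℓ hφ hdeg ha hf I X =
      MvPolynomial.eval (fun i => a (I i)) (s : MvPolynomial (Fin l) ℂ) := by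
  rw [← hL.repr_symmAct_newton hℓ hφ hdeg ha, ← h]
  rfl

theorem trace_eq_sum_character (X : B) :
    LinearMap.trace ℂ V (f X) = ∑ I, hL.character hℓ hφ hdeg ha hf I X := by
  obtain ⟨s, hs⟩ := hL.exists_symmAct_eq hf X
  rw [← hs, hL.trace_symmAct hℓ hφ hdeg ha]
  exact Finset.sum_congr rfl fun I _ => (hL.character_apply hℓ hφ hdeg ha hf I hs.symm).symm

/-- The polynomial with roots `a_i`, `i ∈ I`. -/
def _root_.Gaudin.rootPoly (a : ℕ → ℂ) {l m : ℕ} (I : Fin l ↪o Fin m) : Polynomial ℂ :=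
  ∏ i, (Polynomial.X - Polynomial.C (a (I i)))

theorem _root_.Gaudin.rootPoly_eq_map (a : ℕ → ℂ) {l m : ℕ} (I : Fin l ↪o Fin m) :
    rootPoly a I = (charPoly l).map (MvPolynomial.eval fun i => a (I i)) := by
  simp [rootPoly, charPoly, Polynomial.map_prod]

theorem _root_.Gaudin.roots_rootPoly (a : ℕ → ℂ) {l m : ℕ} (I : Fin l ↪o Fin m) :
    (rootPoly a I).roots = Finset.univ.val.map fun i => a (I i) := by
  have h : rootPoly a I = ((Finset.univ.val.map fun i => a (I i)).map
      fun c => Polynomial.X - Polynomial.C c).prod := by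
    rw [Multiset.map_map]
    rfl
  rw [h, Polynomial.roots_multiset_prod_X_sub_C]

theorem _root_.Gaudin.eval_psum_eq (a : ℕ → ℂ) {l m : ℕ} (I : Fin l ↪o Fin m) (r : ℕ) :
    MvPolynomial.eval (fun i => a (I i)) (MvPolynomial.psum (Fin l) ℂ r) =
      ((rootPoly a I).roots.map fun c => c ^ r).sum := by
  rw [roots_rootPoly, Multiset.map_map, MvPolynomial.psum, map_sum]
  simp only [map_pow, MvPolynomial.eval_X]
  rfl

/-- The values at the coefficients of `charPoly` recover `rootPoly`; conversely, power sums generate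
and their values depend only on the multiset of roots. -/
theorem character_eq_iff (I J : Fin l ↪o Fin (l + l')) :
    hL.character hℓ hφ hdeg ha hf I = hL.character hℓ hφ hdeg ha hf J ↔
      rootPoly a I = rootPoly a J := by
  constructor
  · intro h
    ext i
    rw [rootPoly_eq_map, rootPoly_eq_map, Polynomial.coeff_map, Polynomial.coeff_map]
    obtain ⟨X, hX⟩ := hL.exists_eq_symmAct hf ⟨_, coeff_charPoly_isSymmetric l i⟩
    have := DFunLike.congr_fun h X
    rwa [hL.character_apply hℓ hφ hdeg ha hf I hX,
      hL.character_apply hℓ hφ hdeg ha hf J hX] at this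
  · intro h
    ext X
    obtain ⟨⟨s, hs⟩, hsX⟩ := hL.exists_symmAct_eq hf X
    rw [hL.character_apply hℓ hφ hdeg ha hf I hsX.symm,
      hL.character_apply hℓ hφ hdeg ha hf J hsX.symm]
    clear hsX
    change MvPolynomial.eval _ s = MvPolynomial.eval _ s
    have hs' : s ∈ Algebra.adjoin ℂ (Set.range (MvPolynomial.psum (Fin l) ℂ)) := by
      rw [adjoin_psum]; exact hs
    clear hs
    induction hs' using Algebra.adjoin_induction with
    | mem x hx =>
      obtain ⟨r, rfl⟩ := hx
      rw [eval_psum_eq, eval_psum_eq, h]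
    | algebraMap r => simp [MvPolynomial.algebraMap_eq]
    | add x y _ _ hx hy => rw [map_add, map_add, hx, hy]
    | mul x y _ _ hx hy => rw [map_mul, map_mul, hx, hy]

end IsWedgeQuotient

/-! ### Counting divisors with multiplicities -/

/-- Induction on the index set: subsets with or without the new index give the two summands of
Pascal's rule at the value `a i`, and the other factors are unchanged. -/
theorem card_filter_map_eq {ι K : Type*} [DecidableEq ι] [DecidableEq K] (a : ι → K) (C : Finset K)
    (s : Finset ι) (hs : ∀ i ∈ s, a i ∈ C) (R : Multiset K) (hR : ∀ c ∈ R, c ∈ C) :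
    (s.powerset.filter fun T => T.val.map a = R).card =
      ∏ c ∈ C, ((s.val.map a).count c).choose (R.count c) := by
  induction s using Finset.induction_on generalizing R with
  | empty =>
    rw [Finset.powerset_empty, Finset.filter_singleton]
    by_cases h : R = 0
    · simp [h]
    · obtain ⟨c, hc⟩ := Multiset.exists_mem_of_ne_zero h
      rw [if_neg (fun h' => h (by simpa using h'.symm)), Finset.card_empty, eq_comm]
      refine Finset.prod_eq_zero (hR c hc) ?_
      have := Multiset.count_pos.2 hc
      simpa using Nat.choose_eq_zero_of_lt this
  | insert i s hi ih =>
    have hs' : ∀ j ∈ s, a j ∈ C := fun j hj => hs j (Finset.mem_insert_of_mem hj)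
    have hiC : a i ∈ C := hs i (Finset.mem_insert_self _ _)
    have hsplit : ((insert i s).powerset.filter fun T => T.val.map a = R).card =
        (s.powerset.filter fun T => T.val.map a = R).card +
        (s.powerset.filter fun T => a i ::ₘ T.val.map a = R).card := by
      rw [Finset.powerset_insert, Finset.filter_union, Finset.card_union_of_disjoint]
      · congr 1
        rw [Finset.filter_image, Finset.card_image_of_injOn]
        · congr 1
          refine Finset.filter_congr fun T hT => ?_
          have : i ∉ T := fun h => hi (Finset.mem_powerset.1 hT h)
          rw [Finset.insert_val_of_notMem this, Multiset.map_cons]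
        · intro T hT T' hT' h
          have h1 : i ∉ T := fun h => hi
            (Finset.mem_powerset.1 (Finset.mem_filter.1 (Finset.mem_coe.1 hT)).1 h)
          have h2 : i ∉ T' := fun h => hi
            (Finset.mem_powerset.1 (Finset.mem_filter.1 (Finset.mem_coe.1 hT')).1 h)
          have h3 := congrArg (fun S => S.erase i) h
          simpa [Finset.erase_insert h1, Finset.erase_insert h2] using h3
      · refine Finset.disjoint_filter_filter (Finset.disjoint_left.2 fun T hT hT' => ?_)
        obtain ⟨S, -, rfl⟩ := Finset.mem_image.1 hT'
        exact hi (Finset.mem_powerset.1 hT (Finset.mem_insert_self _ _))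
    have hcount : ∀ c, ((insert i s).val.map a).count c =
        (s.val.map a).count c + if c = a i then 1 else 0 := fun c => by
      rw [Finset.insert_val_of_notMem hi, Multiset.map_cons, Multiset.count_cons]
    have hrest : ∀ R' : Multiset K, (∀ c, c ≠ a i → R'.count c = R.count c) →
        ∏ c ∈ C.erase (a i), (((insert i s).val.map a).count c).choose (R.count c) =
          ∏ c ∈ C.erase (a i), ((s.val.map a).count c).choose (R'.count c) := fun R' h =>
      Finset.prod_congr rfl fun c hc => by
        have := (Finset.mem_erase.1 hc).1
        rw [hcount, if_neg this, add_zero, h c this]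
    rw [hsplit, ih hs' R hR, ← Finset.mul_prod_erase C _ hiC, ← Finset.mul_prod_erase C _ hiC,
      hrest R fun _ _ => rfl, hcount, if_pos rfl]
    by_cases hmem : a i ∈ R
    · obtain ⟨R', rfl⟩ := Multiset.exists_cons_of_mem hmem
      simp only [Multiset.cons_inj_right]
      rw [ih hs' R' fun c hc => hR c (Multiset.mem_cons_of_mem hc),
        ← Finset.mul_prod_erase C _ hiC, Multiset.count_cons_self, Nat.choose_succ_succ, add_mul,
        add_comm]
      congr 2
      refine Finset.prod_congr rfl fun c hc => ?_
      rw [Multiset.count_cons_of_ne (Finset.mem_erase.1 hc).1]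
    · rw [Finset.filter_false_of_mem, Finset.card_empty, add_zero, Multiset.count_eq_zero.2 hmem,
        Nat.choose_zero_right, Nat.choose_zero_right]
      rintro T - rfl
      exact hmem (Multiset.mem_cons_self _ _)

theorem roots_newton (a : ℕ → ℂ) (m : ℕ) :
    (newton a m : Polynomial ℂ).roots = (Finset.univ : Finset (Fin m)).val.map fun i : Fin m => a i := by
  have h : (newton a m : Polynomial ℂ) = (((Finset.univ : Finset (Fin m)).val.map fun i : Fin m => a i).map
      fun c => Polynomial.X - Polynomial.C c).prod := by
    rw [Multiset.map_map, newton_apply, ← Fin.prod_univ_eq_prod_range]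
    rfl
  rw [h, Polynomial.roots_multiset_prod_X_sub_C]

theorem monic_rootPoly (a : ℕ → ℂ) {l m : ℕ} (I : Fin l ↪o Fin m) : (rootPoly a I).Monic :=
  Polynomial.monic_prod_of_monic _ _ fun _ _ => Polynomial.monic_X_sub_C _

theorem natDegree_rootPoly (a : ℕ → ℂ) {l m : ℕ} (I : Fin l ↪o Fin m) :
    (rootPoly a I).natDegree = l := by
  rw [rootPoly, Polynomial.natDegree_prod_of_monic _ _ fun _ _ => Polynomial.monic_X_sub_C _]
  simp

theorem rootPoly_dvd (a : ℕ → ℂ) {l m : ℕ} (I : Fin l ↪o Fin m) : rootPoly a I ∣ newton a m := by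
  have h : rootPoly a I = ∏ i ∈ Finset.univ.map I.toEmbedding,
      (Polynomial.X - Polynomial.C (a i)) := by
    rw [Finset.prod_map]
    rfl
  rw [h, newton_apply, ← Fin.prod_univ_eq_prod_range]
  exact Finset.prod_dvd_prod_of_subset _ _ _ (Finset.subset_univ _)

theorem eq_rootPoly_iff {y : Polynomial ℂ} (hy : y.Monic) (a : ℕ → ℂ) {l m : ℕ}
    (I : Fin l ↪o Fin m) : rootPoly a I = y ↔ (rootPoly a I).roots = y.roots := by
  refine ⟨fun h => h ▸ rfl, fun h => ?_⟩
  rw [(IsAlgClosed.splits y).eq_prod_roots_of_monic hy,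
    (IsAlgClosed.splits (rootPoly a I)).eq_prod_roots_of_monic (monic_rootPoly a I), h]

theorem card_rootPoly_eq (a : ℕ → ℂ) {l m : ℕ} {y : Polynomial ℂ} (hy : y.Monic)
    (hdeg : y.natDegree = l) [DecidableEq (Polynomial ℂ)] :
    (Finset.univ.filter fun I : Fin l ↪o Fin m => rootPoly a I = y).card =
      ∏ᶠ c : ℂ, ((newton a m : Polynomial ℂ).rootMultiplicity c).choose
        (y.rootMultiplicity c) := by
  classical
  have hcard : y.roots.card = l := by
    rw [← (IsAlgClosed.splits y).natDegree_eq_card_roots, hdeg]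
  have h1 := card_filter_map_eq (fun i : Fin m => a i)
    ((newton a m : Polynomial ℂ).roots.toFinset ∪ y.roots.toFinset) Finset.univ
    (fun i _ => Finset.mem_union_left _ (Multiset.mem_toFinset.2 (by
      rw [roots_newton]
      exact Multiset.mem_map_of_mem _ (Finset.mem_univ_val i)))) y.roots
    (fun c hc => Finset.mem_union_right _ (Multiset.mem_toFinset.2 hc))
  rw [← roots_newton] at h1
  simp only [Polynomial.count_roots] at h1
  rw [finprod_eq_prod_of_mulSupport_subset _ (s := (newton a m : Polynomial ℂ).roots.toFinset ∪
    y.roots.toFinset) ?_, ← h1]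
  · refine Finset.card_bij (fun I _ => Finset.univ.map I.toEmbedding) (fun I hI => ?_)
      (fun I _ J _ h => ?_) (fun T hT => ?_)
    · have hI' := (Finset.mem_filter.1 hI).2
      refine Finset.mem_filter.2 ⟨Finset.mem_powerset.2 (Finset.subset_univ _), ?_⟩
      rw [← hI', roots_rootPoly, Finset.map_val, Multiset.map_map]
      rfl
    · have hr : Set.range I = Set.range J := by
        have := congrArg (fun s : Finset _ => (s : Set (Fin m))) h
        simpa using this
      exact DFunLike.coe_injective ((StrictMono.range_inj I.strictMono J.strictMono).1 hr)
    · have hT' := (Finset.mem_filter.1 hT).2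
      have hTl : T.card = l := by
        rw [← hcard, ← hT', Multiset.card_map]
        rfl
      have hmap : Finset.univ.map (T.orderEmbOfFin hTl).toEmbedding = T :=
        Finset.map_orderEmbOfFin_univ T hTl
      refine ⟨T.orderEmbOfFin hTl, Finset.mem_filter.2 ⟨Finset.mem_univ _, ?_⟩, hmap⟩
      rw [eq_rootPoly_iff hy, roots_rootPoly, ← hT']
      conv_rhs => rw [← hmap, Finset.map_val, Multiset.map_map]
      rfl
  · intro c hc
    by_contra hcon
    rw [Finset.coe_union, Set.mem_union, not_or] at hcon
    simp only [Finset.mem_coe, Multiset.mem_toFinset] at hcon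
    refine hc ?_
    beta_reduce
    rw [← Polynomial.count_roots, ← Polynomial.count_roots, Multiset.count_eq_zero.2 hcon.1,
      Multiset.count_eq_zero.2 hcon.2, Nat.choose_zero_right]

/-- Divisibility bounds the multiplicities, so all binomial coefficients in the count are positive.
-/
theorem exists_rootPoly_eq (a : ℕ → ℂ) {l m : ℕ} {y : Polynomial ℂ} (hy : y.Monic)
    (hdeg : y.natDegree = l) (hdvd : y ∣ newton a m) :
    ∃ I : Fin l ↪o Fin m, rootPoly a I = y := by
  classical
  have h : (Finset.univ.filter fun I : Fin l ↪o Fin m => rootPoly a I = y).card ≠ 0 := by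
    rw [card_rootPoly_eq a hy hdeg]
    refine finprod_induction (fun n : ℕ => n ≠ 0) one_ne_zero (fun _ _ => mul_ne_zero) fun c => ?_
    exact (Nat.choose_pos (Polynomial.rootMultiplicity_le_rootMultiplicity_of_dvd
      ((newton a).ne_zero m) hdvd c)).ne'
  obtain ⟨I, hI⟩ := Finset.card_ne_zero.1 h
  exact ⟨I, (Finset.mem_filter.1 hI).2⟩

/-! ### Eigenspaces of an algebra with the same image as the symmetric polynomials -/

namespace IsWedgeQuotient

variable {φ : Polynomial ℂ} {l : ℕ} {V : Type*} [AddCommGroup V] [Module ℂ V]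
  {L : MvPolynomial (Fin l) ℂ →ₗ[ℂ] V} (hL : IsWedgeQuotient φ L)
  {B : Type*} [Semiring B] [Algebra ℂ B] {f : B →ₐ[ℂ] Module.End ℂ V}
  (hf : f.range = hL.symmAct.range)
include hf

theorem commute_of_range_eq (X Y : B) : Commute (f X) (f Y) := by
  obtain ⟨s, hs⟩ := hL.exists_symmAct_eq hf X
  obtain ⟨t, ht⟩ := hL.exists_symmAct_eq hf Y
  rw [← hs, ← ht]
  exact hL.commute_symmAct s t

theorem exists_cyclic_of_range_eq : ∃ v₀ : V, ∀ v, ∃ X, f X v₀ = v := by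
  refine ⟨L (staircase l), fun v => ?_⟩
  obtain ⟨s, hs⟩ := hL.exists_symmAct_staircase v
  obtain ⟨X, hX⟩ := hL.exists_eq_symmAct hf s
  exact ⟨X, by rw [hX, hs]⟩

variable {l' : ℕ} {ℓ : MvPolynomial (Fin (l + l')) ℂ →ₗ[ℂ] ℂ}
  (hℓ : IsTopForm φ ℓ) (hφ : φ.Monic) (hdeg : φ.natDegree = l + l')
include hℓ hφ hdeg

theorem exists_cocyclic_of_range_eq :
    ∃ ω : V →ₗ[ℂ] ℂ, ∀ v, (∀ X, ω (f X v) = 0) → v = 0 := by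
  obtain ⟨ω, hω⟩ := hL.exists_cocyclic hℓ hφ hdeg
  refine ⟨ω, fun v hv => hω v fun s => ?_⟩
  obtain ⟨X, hX⟩ := hL.exists_eq_symmAct hf s
  rw [← hX]
  exact hv X

variable {a : ℕ → ℂ} (ha : newton a (l + l') = φ)

theorem finrank_genEigenspace [DecidableEq (B →ₐ[ℂ] ℂ)] (ψ : B →ₐ[ℂ] ℂ) :
    Module.finrank ℂ (⨅ X, (f X).maxGenEigenspace (ψ X) : Submodule ℂ V) =
      (Finset.univ.filter fun I => hL.character hℓ hφ hdeg ha hf I = ψ).card := by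
  have := hL.finiteDimensional (newton a) (dvd_newton ha)
  exact finrank_genEigenspace_eq_card (hL.commute_of_range_eq hf) _
    (hL.trace_eq_sum_character hℓ hφ hdeg ha hf) ψ

theorem eigenspace_character_ne_bot (I : Fin l ↪o Fin (l + l')) :
    (⨅ X, (f X).eigenspace (hL.character hℓ hφ hdeg ha hf I X) : Submodule ℂ V) ≠ ⊥ := by
  classical
  have := hL.finiteDimensional (newton a) (dvd_newton ha)
  refine iInf_eigenspace_ne_bot (hL.commute_of_range_eq hf) fun h => ?_
  have h1 := hL.finrank_genEigenspace hf hℓ hφ hdeg ha (hL.character hℓ hφ hdeg ha hf I)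
  rw [h, finrank_bot, eq_comm, Finset.card_eq_zero, Finset.filter_eq_empty_iff] at h1
  exact h1 (Finset.mem_univ I) rfl

theorem exists_character_eq {ψ : B →ₐ[ℂ] ℂ}
    (hψ : (⨅ X, (f X).eigenspace (ψ X) : Submodule ℂ V) ≠ ⊥) :
    ∃ I, hL.character hℓ hφ hdeg ha hf I = ψ := by
  classical
  have := hL.finiteDimensional (newton a) (dvd_newton ha)
  have hG : Module.finrank ℂ (⨅ X, (f X).maxGenEigenspace (ψ X) : Submodule ℂ V) ≠ 0 := by
    intro h
    refine hψ (eq_bot_iff.2 (le_trans (iInf_mono fun X => ?_) (Submodule.finrank_eq_zero.1 h).le))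
    exact Module.End.genEigenspace_le_maximal _ _ _
  rw [hL.finrank_genEigenspace hf hℓ hφ hdeg ha] at hG
  obtain ⟨I, hI⟩ := Finset.card_ne_zero.1 hG
  exact ⟨I, (Finset.mem_filter.1 hI).2⟩

theorem rootPoly_eq_of_eigenspace_eq {I J : Fin l ↪o Fin (l + l')}
    (h : (⨅ X, (f X).eigenspace (hL.character hℓ hφ hdeg ha hf I X) : Submodule ℂ V) =
      ⨅ X, (f X).eigenspace (hL.character hℓ hφ hdeg ha hf J X)) :
    rootPoly a I = rootPoly a J := by
  refine (hL.character_eq_iff hℓ hφ hdeg ha hf I J).1 (AlgHom.ext fun X => ?_)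
  obtain ⟨u, hu, hu0⟩ := Submodule.exists_mem_ne_zero_of_ne_bot
    (hL.eigenspace_character_ne_bot hf hℓ hφ hdeg ha I)
  have e1 := Module.End.mem_eigenspace_iff.1 ((Submodule.mem_iInf _).1 hu X)
  rw [h] at hu
  have e2 := Module.End.mem_eigenspace_iff.1 ((Submodule.mem_iInf _).1 hu X)
  exact smul_left_injective ℂ hu0 (e1.symm.trans e2)

theorem finrank_genEigenspace_character (I : Fin l ↪o Fin (l + l')) :
    Module.finrank ℂ (⨅ X, (f X).maxGenEigenspace (hL.character hℓ hφ hdeg ha hf I X) :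
      Submodule ℂ V) = ∏ᶠ c : ℂ, (φ.rootMultiplicity c).choose
        ((rootPoly a I).rootMultiplicity c) := by
  classical
  have h := card_rootPoly_eq a (m := l + l') (monic_rootPoly a I) (natDegree_rootPoly a I)
  rw [ha] at h
  rw [hL.finrank_genEigenspace hf hℓ hφ hdeg ha, ← h]
  congr 1
  exact Finset.filter_congr fun I' _ => hL.character_eq_iff hℓ hφ hdeg ha hf I' I

theorem exists_bijOn_eigenspace : ∃ χ : Polynomial ℂ → (B →ₐ[ℂ] ℂ),
    Set.BijOn (fun y => (⨅ X, (f X).eigenspace (χ y X) : Submodule ℂ V))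
      {y | y.Monic ∧ y.natDegree = l ∧ y ∣ φ}
      {W | W ≠ ⊥ ∧ ∃ ψ : B →ₐ[ℂ] ℂ, W = ⨅ X, (f X).eigenspace (ψ X)} ∧
    ∀ y : Polynomial ℂ, y.Monic → y.natDegree = l → y ∣ φ →
      ∃ I, rootPoly a I = y ∧ χ y = hL.character hℓ hφ hdeg ha hf I := by
  have hne : Nonempty (Fin l ↪o Fin (l + l')) := ⟨Fin.castAddOrderEmb l'⟩
  -- Several index sets may have root polynomial `y`; any of them will do, because the character
  -- depends only on `y`.
  let J : Polynomial ℂ → (Fin l ↪o Fin (l + l')) := fun y =>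
    Classical.epsilon fun I => rootPoly a I = y
  have hy : ∀ y : Polynomial ℂ, y.Monic → y.natDegree = l → y ∣ φ → rootPoly a (J y) = y :=
    fun y h1 h2 h3 => Classical.epsilon_spec (p := fun I => rootPoly a I = y)
      (exists_rootPoly_eq a h1 h2 (ha ▸ h3))
  refine ⟨fun y => hL.character hℓ hφ hdeg ha hf (J y), ⟨fun y _ => ?_, ?_, ?_⟩,
    fun y h1 h2 h3 => ⟨J y, hy y h1 h2 h3, rfl⟩⟩
  · exact ⟨hL.eigenspace_character_ne_bot hf hℓ hφ hdeg ha _, _, rfl⟩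
  · rintro y ⟨h1, h2, h3⟩ y' ⟨h1', h2', h3'⟩ h
    rw [← hy y h1 h2 h3, ← hy y' h1' h2' h3']
    exact hL.rootPoly_eq_of_eigenspace_eq hf hℓ hφ hdeg ha h
  · rintro W ⟨hW, ψ, rfl⟩
    obtain ⟨I, rfl⟩ := hL.exists_character_eq hf hℓ hφ hdeg ha hW
    have h3 : rootPoly a I ∣ φ := by
      have := rootPoly_dvd a I
      rwa [ha] at this
    refine ⟨rootPoly a I, ⟨monic_rootPoly a I, natDegree_rootPoly a I, h3⟩, ?_⟩
    have h := (hL.character_eq_iff hℓ hφ hdeg ha hf _ _).2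
      (hy _ (monic_rootPoly a I) (natDegree_rootPoly a I) h3)
    simp only [h]

end IsWedgeQuotient

/-! ### Expansion of the eigenvalues -/

/-- The expansion of `1 / (x - c)` in `x⁻¹`. -/
def geom (c : ℂ) : PowerSeries ℂ := PowerSeries.X * PowerSeries.mk fun r => c ^ r

theorem coeff_geom_mul_of_lt (c d : ℂ) {r : ℕ} (hr : r < 2) :
    PowerSeries.coeff r (geom c * geom d) = 0 := by
  have h : geom c * geom d = PowerSeries.X ^ 2 *
      ((PowerSeries.mk fun r => c ^ r) * PowerSeries.mk fun r => d ^ r) := by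
    rw [geom, geom]; ring
  rw [h, PowerSeries.coeff_X_pow_mul', if_neg (by omega)]

theorem coeff_geom_mul (c d : ℂ) (r : ℕ) :
    PowerSeries.coeff (r + 2) (geom c * geom d) =
      ∑ x ∈ Finset.HasAntidiagonal.antidiagonal r, c ^ x.1 * d ^ x.2 := by
  have h : geom c * geom d = PowerSeries.X ^ 2 *
      ((PowerSeries.mk fun r => c ^ r) * PowerSeries.mk fun r => d ^ r) := by
    rw [geom, geom]; ring
  rw [h, PowerSeries.coeff_X_pow_mul, PowerSeries.coeff_mul]
  simp only [PowerSeries.coeff_mk]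

theorem xVar_sub_mul_geom (c : ℂ) :
    (xVar - HahnSeries.C c) * HahnSeries.ofPowerSeries ℤ ℂ (geom c) = 1 := by
  have h1 : xVar * HahnSeries.ofPowerSeries ℤ ℂ PowerSeries.X = 1 := by
    rw [HahnSeries.ofPowerSeries_X, xVar, HahnSeries.single_mul_single]
    simp
  have h2 : (PowerSeries.mk fun r => c ^ r) -
      PowerSeries.C c * (PowerSeries.X * PowerSeries.mk fun r => c ^ r) = 1 := by
    ext r
    cases r with
    | zero => simp
    | succ r => simp [PowerSeries.coeff_succ_X_mul, PowerSeries.coeff_one, pow_succ']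
  have h3 := congrArg (HahnSeries.ofPowerSeries ℤ ℂ) h2
  rw [map_sub, map_mul, map_one, HahnSeries.ofPowerSeries_C] at h3
  rw [geom, sub_mul, ← h3, map_mul, ← mul_assoc, h1, one_mul]

theorem pole_eq (c : ℂ) : pole c = HahnSeries.ofPowerSeries ℤ ℂ (geom c) :=
  inv_eq_of_mul_eq_one_right (xVar_sub_mul_geom c)

theorem xVar_sub_ne_zero (c : ℂ) : xVar - HahnSeries.C c ≠ 0 := fun h => by
  have := xVar_sub_mul_geom c
  rw [h, zero_mul] at this
  exact zero_ne_one this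

theorem eval₂_derivative_div {l : ℕ} (c : Fin l → ℂ) :
    Polynomial.eval₂ HahnSeries.C xVar
        (Polynomial.derivative (∏ i, (Polynomial.X - Polynomial.C (c i)))) /
      Polynomial.eval₂ HahnSeries.C xVar (∏ i, (Polynomial.X - Polynomial.C (c i))) =
      ∑ i, pole (c i) := by
  have h : ∀ p : Polynomial ℂ, Polynomial.eval₂ HahnSeries.C xVar p =
      Polynomial.eval₂RingHom HahnSeries.C xVar p := fun _ => rfl
  have hX : ∀ d : ℂ, Polynomial.eval₂RingHom HahnSeries.C xVar
      (Polynomial.X - Polynomial.C d) = xVar - HahnSeries.C d := fun d => by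
    rw [← h, Polynomial.eval₂_sub, Polynomial.eval₂_X, Polynomial.eval₂_C]
  rw [h, h, Polynomial.derivative_prod_finset, map_sum, Finset.sum_div]
  refine Finset.sum_congr rfl fun i _ => ?_
  rw [Polynomial.derivative_X_sub_C, mul_one, ← Finset.mul_prod_erase Finset.univ _
    (Finset.mem_univ i), map_mul, hX, pole, div_eq_iff, ← mul_assoc, inv_mul_cancel₀, one_mul]
  · exact xVar_sub_ne_zero _
  · refine mul_ne_zero (xVar_sub_ne_zero _) ?_
    rw [map_prod]
    exact Finset.prod_ne_zero_iff.2 fun j _ => by rw [hX]; exact xVar_sub_ne_zero _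

/-- Each term of the eigenvalue is a combination of products of two poles, whose expansions have
antidiagonal sums as coefficients. The logarithmic derivative of `y` supplies the poles at its
roots. -/
theorem eigenvalueSer_eq {k l : ℕ} (α β : Fin k → ℕ) (b : Fin k → ℂ) (c : Fin l → ℂ) (t : ℕ → ℂ)
    (ht : ∀ r < 2, t r = 0)
    (h : ∀ r, t (r + 2) = vacCoeff α β b r - ∑ x ∈ Finset.HasAntidiagonal.antidiagonal r,
      zetaCoeff α β b x.1 * ∑ i, c i ^ x.2) :
    HahnSeries.ofPowerSeries ℤ ℂ (PowerSeries.mk t) =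
      eigenvalueSer α β b (∏ i, (Polynomial.X - Polynomial.C (c i))) := by
  obtain ⟨n, hn⟩ : ∃ n : Fin k → ℂ, ∀ s, (α s : ℂ) + β s = n s := ⟨_, fun _ => rfl⟩
  have hζ : ∀ p, zetaCoeff α β b p = ∑ s, n s * b s ^ p := fun p => by
    rw [zetaCoeff_eq, ← Finset.sum_add_distrib]
    exact Finset.sum_congr rfl fun s _ => by rw [← hn]; ring
  have hS : PowerSeries.mk t =
      -(PowerSeries.C (1 / 2 : ℂ) * ∑ s, PowerSeries.C (n s) * (geom (b s) * geom (b s)))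
      - (∑ s, ∑ i, PowerSeries.C (n s) * (geom (b s) * geom (c i)))
      + ∑ r, ∑ s, PowerSeries.C (((α r : ℂ) * α s - β r * β s) / 2) *
          (geom (b r) * geom (b s)) := by
    ext r
    rcases Nat.lt_or_ge r 2 with hr | hr
    · simp only [PowerSeries.coeff_mk, ht r hr, map_add, map_sub, map_neg, map_sum,
        PowerSeries.coeff_C_mul, coeff_geom_mul_of_lt _ _ hr]
      simp
    · obtain ⟨r, rfl⟩ := Nat.exists_eq_add_of_le' hr
      simp only [PowerSeries.coeff_mk, h, map_add, map_sub, map_neg, map_sum,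
        PowerSeries.coeff_C_mul, coeff_geom_mul]
      have e1 : 1 / 2 * ∑ s, n s * ∑ x ∈ Finset.HasAntidiagonal.antidiagonal r,
          b s ^ x.1 * b s ^ x.2 = ∑ x ∈ Finset.HasAntidiagonal.antidiagonal r,
          1 / 2 * zetaCoeff α β b (x.1 + x.2) := by
        simp only [Finset.mul_sum, hζ, pow_add]
        exact Finset.sum_comm
      have e2 : ∑ s, ∑ i, n s * ∑ x ∈ Finset.HasAntidiagonal.antidiagonal r,
          b s ^ x.1 * c i ^ x.2 = ∑ x ∈ Finset.HasAntidiagonal.antidiagonal r,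
          zetaCoeff α β b x.1 * ∑ i, c i ^ x.2 := by
        simp only [hζ, Finset.sum_mul_sum]
        simp only [Finset.mul_sum]
        rw [Finset.sum_comm]
        refine (Finset.sum_congr rfl fun i _ => Finset.sum_comm).trans ?_
        rw [Finset.sum_comm]
        refine Finset.sum_congr rfl fun x _ => ?_
        rw [Finset.sum_comm]
        simp only [mul_assoc]
      have e3 : ∑ p, ∑ s, ((α p : ℂ) * α s - β p * β s) / 2 *
          ∑ x ∈ Finset.HasAntidiagonal.antidiagonal r, b p ^ x.1 * b s ^ x.2 =
          ∑ x ∈ Finset.HasAntidiagonal.antidiagonal r, (1 / 2 : ℂ) *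
            ((∑ s, b s ^ x.1 * α s) * (∑ s, b s ^ x.2 * α s) -
              (∑ s, b s ^ x.1 * β s) * (∑ s, b s ^ x.2 * β s)) := by
        simp only [Finset.sum_mul_sum, ← Finset.sum_sub_distrib]
        simp only [Finset.mul_sum]
        rw [Finset.sum_comm]
        refine (Finset.sum_congr rfl fun i _ => Finset.sum_comm).trans ?_
        rw [Finset.sum_comm]
        refine Finset.sum_congr rfl fun x _ => ?_
        rw [Finset.sum_comm]
        exact Finset.sum_congr rfl fun p _ => Finset.sum_congr rfl fun s _ => by ring
      rw [e1, e2, e3, vacCoeff]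
      simp only [mul_sub, Finset.sum_sub_distrib]
      ring
  rw [hS, eigenvalueSer, eval₂_derivative_div, zeta, zetaDeriv, Finset.sum_mul_sum]
  simp only [map_add, map_sub, map_neg, map_sum, map_mul, HahnSeries.ofPowerSeries_C, ← pole_eq, hn,
    mul_assoc, pow_two, mul_neg]

/-! ### The Bethe algebra as an algebra of symmetric polynomials -/

section
variable {k : ℕ} (α β : Fin k → ℕ) (b : Fin k → ℂ) (hα : ∀ s, 0 < α s)
  (hb : Function.Injective b) (hk : 0 < k)

include hα hb in
theorem exists_isTopForm {m : ℕ} (hm : m + 1 = k) :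
    ∃ ω : TensorSpace k →ₗ[ℂ] ℂ, IsTopForm (monicPhi α β b) (ω ∘ₗ wordPoly α β b m) := by
  have hk : 0 < k := by omega
  have h0 := wordPoly_staircase_ne_zero α β b hα hb hk hm
  obtain ⟨ω, hω⟩ : ∃ ω : Module.Dual ℂ (TensorSpace k), ω (wordPoly α β b m (staircase m)) ≠ 0 := by
    by_contra h
    push Not at h
    exact h0 ((Module.forall_dual_apply_eq_zero_iff ℂ _).1 h)
  refine ⟨ω, fun σ q => ?_, fun i q => ?_, hω⟩
  · rw [LinearMap.comp_apply, wordPoly_rename, map_zsmul]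
    rfl
  · rw [LinearMap.comp_apply, wordPoly_monicPhi_mul α β b hα hb hk, map_zero]

/-- The parametrization of `M α β b l` by polynomials in `l` variables. -/
def singVec (l : ℕ) : MvPolynomial (Fin l) ℂ →ₗ[ℂ] M α β b l :=
  (wordPoly α β b l).codRestrict _ fun q => wordPoly_mem_M α β b hα hb hk q

theorem coe_singVec {l : ℕ} (q : MvPolynomial (Fin l) ℂ) :
    (singVec α β b hα hb hk l q : TensorSpace k) = wordPoly α β b l q := rfl

theorem isWedgeQuotient_singVec {l l' : ℕ} (hm : l + l' + 1 = k) :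
    IsWedgeQuotient (monicPhi α β b) (singVec α β b hα hb hk l) where
  surjective v := by
    obtain ⟨q, hq⟩ := exists_wordPoly_eq α β b hα hb hk v.2
    exact ⟨q, Subtype.ext hq⟩
  -- If `q` gives the zero vector, so does its product with any polynomial in the other block. Hence
  -- all pairings vanish and `wedgeKer_of_pairing` applies.
  ker_eq := by
    have hn := boxes_dot_one_ne_zero α β hα hk
    obtain ⟨ω, hω⟩ := exists_isTopForm α β b hα hb hm
    refine le_antisymm (fun q hq => ?_) (wedgeKer_le_ker _ (fun σ q => ?_) fun i q => ?_)
    · have hq0 : wordPoly α β b l q = 0 := congrArg Subtype.val (LinearMap.mem_ker.1 hq)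
      refine hω.wedgeKer_of_pairing (monic_monicPhi α β b hn)
        (by rw [natDegree_monicPhi α β b hn]; omega) fun q' => ?_
      rw [LinearMap.comp_apply, wordPoly_mul_of_eq_zero α β b q hq0, map_zero]
    · refine Subtype.ext ?_
      rw [coe_singVec, wordPoly_rename]
      rfl
    · exact Subtype.ext (wordPoly_monicPhi_mul α β b hα hb hk i q)

theorem betheAct_transferCoeff_of_lt (l : ℕ) {r : ℕ} (hr : r < 2) :
    betheAct α β b l (transferCoeff r) = 0 := by
  have : transferCoeff r = 0 := Subtype.ext (coeff_transferSer_of_lt hr)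
  rw [this, map_zero]

variable {l : ℕ} (hL : IsWedgeQuotient (monicPhi α β b) (singVec α β b hα hb hk l))

/-- The symmetric polynomial `p_r`. -/
def powerSum (l r : ℕ) : MvPolynomial.symmetricSubalgebra (Fin l) ℂ :=
  ⟨_, MvPolynomial.psum_isSymmetric (Fin l) ℂ r⟩

theorem betheAct_transferCoeff (r : ℕ) :
    betheAct α β b l (transferCoeff (r + 2)) = vacCoeff α β b r • 1 -
      ∑ x ∈ Finset.HasAntidiagonal.antidiagonal r,
        zetaCoeff α β b x.1 • hL.symmAct (powerSum l x.2) := by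
  refine LinearMap.ext fun v => ?_
  obtain ⟨q, rfl⟩ := hL.surjective v
  refine Subtype.ext ?_
  change tensorRep α β b (PowerSeries.coeff (r + 2) transferSer) (wordPoly α β b l q) = _
  rw [tensorRep_transfer, LinearMap.sub_apply, LinearMap.smul_apply, Module.End.one_apply,
    hopOp_wordPoly α β b hα hb hk, LinearMap.sub_apply, LinearMap.smul_apply, Module.End.one_apply,
    LinearMap.sum_apply, AddSubgroupClass.coe_sub, Submodule.coe_smul, coe_singVec]
  congr 1
  rw [Submodule.coe_sum]
  refine Finset.sum_congr rfl fun x _ => ?_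
  rw [LinearMap.smul_apply, Submodule.coe_smul, hL.symmAct_apply, coe_singVec]
  rfl

theorem tensorRep_centralSer (r : ℕ) :
    tensorRep α β b (PowerSeries.coeff r centralSer) =
      (if r = 0 then 0 else zetaCoeff α β b (r - 1)) • 1 := by
  rw [centralSer, map_add]
  cases r with
  | zero => simp [eSer]
  | succ r =>
    rw [eSer, eSer, PowerSeries.coeff_succ_X_mul, PowerSeries.coeff_succ_X_mul,
      PowerSeries.coeff_mk, PowerSeries.coeff_mk, map_add, tensorRep_e, tensorRep_e,
      tensorOp_zero_zero, tensorOp_one_one, if_neg (Nat.succ_ne_zero r), Nat.add_sub_cancel,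
      zetaCoeff_eq, add_smul]
    abel

/-- The central series acts by scalars and the transfer coefficients through power sums. Conversely,
the coefficient of index `r + 2` contains the power sum of degree `r` with factor `ζ_0 = n ≠ 0` and
otherwise only power sums of lower degree, so the system can be solved recursively. -/
theorem range_betheAct : (betheAct α β b l).range = hL.symmAct.range := by
  refine le_antisymm ?_ ?_
  · rintro _ ⟨⟨X, hX⟩, rfl⟩
    change betheAct α β b l ⟨X, hX⟩ ∈ hL.symmAct.range
    induction hX using Algebra.adjoin_induction with
    | mem x hx =>
      rcases hx with ⟨r, rfl⟩ | ⟨r, rfl⟩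
      · have : betheAct α β b l ⟨PowerSeries.coeff r centralSer,
            Algebra.subset_adjoin (Or.inl ⟨r, rfl⟩)⟩ =
            algebraMap ℂ _ (if r = 0 then 0 else zetaCoeff α β b (r - 1)) := by
          refine LinearMap.ext fun v => Subtype.ext ?_
          exact LinearMap.congr_fun (tensorRep_centralSer α β b r) v
        rw [this]
        exact Subalgebra.algebraMap_mem _ _
      · change betheAct α β b l (transferCoeff r) ∈ _
        rcases Nat.lt_or_ge r 2 with hr | hr
        · rw [betheAct_transferCoeff_of_lt α β b l hr]
          exact Subalgebra.zero_mem _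
        · obtain ⟨r, rfl⟩ := Nat.exists_eq_add_of_le' hr
          rw [betheAct_transferCoeff α β b hα hb hk hL]
          exact Subalgebra.sub_mem _ (Subalgebra.smul_mem _ (Subalgebra.one_mem _) _)
            (Subalgebra.sum_mem _ fun x _ =>
              Subalgebra.smul_mem _ (AlgHom.mem_range_self _ (powerSum l x.2)) _)
    | algebraMap c =>
      have := AlgHom.commutes (betheAct α β b l) c
      rw [show (⟨algebraMap ℂ U c, _⟩ : betheAlgebra) = algebraMap ℂ betheAlgebra c from rfl, this]
      exact Subalgebra.algebraMap_mem _ _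
    | add x y hx hy h1 h2 =>
      have := Subalgebra.add_mem _ h1 h2
      rw [← map_add] at this
      exact this
    | mul x y hx hy h1 h2 =>
      have := Subalgebra.mul_mem _ h1 h2
      rw [← map_mul] at this
      exact this
  · have hpow : ∀ r, hL.symmAct (powerSum l r) ∈ (betheAct α β b l).range := by
      intro r
      induction r using Nat.strong_induction_on with
      | _ r ih =>
        have h := betheAct_transferCoeff α β b hα hb hk hL r
        have hmem : ((0, r) : ℕ × ℕ) ∈ Finset.HasAntidiagonal.antidiagonal r := by simp
        rw [← Finset.add_sum_erase _ _ hmem, eq_sub_iff_add_eq] at h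
        have hrest : ∑ x ∈ (Finset.HasAntidiagonal.antidiagonal r).erase (0, r),
            zetaCoeff α β b x.1 • hL.symmAct (powerSum l x.2) ∈ (betheAct α β b l).range := by
          refine Subalgebra.sum_mem _ fun x hx => Subalgebra.smul_mem _ (ih x.2 ?_) _
          obtain ⟨h1, h2⟩ := Finset.mem_erase.1 hx
          rw [Finset.HasAntidiagonal.mem_antidiagonal] at h2
          rcases Nat.eq_zero_or_pos x.1 with h3 | h3
          · exact absurd (Prod.ext h3 (by simp only; omega)) h1
          · omega
        have h0 : zetaCoeff α β b 0 ≠ 0 := by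
          rw [zetaCoeff, pow_zero]
          exact boxes_dot_one_ne_zero α β hα hk
        have h1 : zetaCoeff α β b 0 • hL.symmAct (powerSum l r) ∈ (betheAct α β b l).range := by
          have e : zetaCoeff α β b 0 • hL.symmAct (powerSum l r) = vacCoeff α β b r • 1 -
              betheAct α β b l (transferCoeff (r + 2)) -
              ∑ x ∈ (Finset.HasAntidiagonal.antidiagonal r).erase (0, r),
                zetaCoeff α β b x.1 • hL.symmAct (powerSum l x.2) := by
            rw [← h]
            abel
          rw [e]
          exact Subalgebra.sub_mem _ (Subalgebra.sub_mem _
            (Subalgebra.smul_mem _ (Subalgebra.one_mem _) _) (AlgHom.mem_range_self _ _)) hrest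
        have h2 := Subalgebra.smul_mem _ h1 (zetaCoeff α β b 0)⁻¹
        rwa [smul_smul, inv_mul_cancel₀ h0, one_smul] at h2
    rintro _ ⟨⟨s, hs⟩, rfl⟩
    change hL.symmAct ⟨s, hs⟩ ∈ (betheAct α β b l).range
    have hs' : s ∈ Algebra.adjoin ℂ (Set.range (MvPolynomial.psum (Fin l) ℂ)) := by
      rw [adjoin_psum]; exact hs
    induction hs' using Algebra.adjoin_induction with
    | mem x hx =>
      obtain ⟨r, rfl⟩ := hx
      exact hpow r
    | algebraMap c =>
      have := AlgHom.commutes hL.symmAct c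
      have h2 := Subalgebra.algebraMap_mem (betheAct α β b l).range c
      rw [← this] at h2
      exact h2
    | add x y hx hy h1 h2 =>
      rw [adjoin_psum] at hx hy
      have := Subalgebra.add_mem _ (h1 hx) (h2 hy)
      rw [← map_add] at this
      exact this
    | mul x y hx hy h1 h2 =>
      rw [adjoin_psum] at hx hy
      have := Subalgebra.mul_mem _ (h1 hx) (h2 hy)
      rw [← map_mul] at this
      exact this

theorem eigenvalueSer_character {l' : ℕ} {ℓ : MvPolynomial (Fin (l + l')) ℂ →ₗ[ℂ] ℂ}
    (hℓ : IsTopForm (monicPhi α β b) ℓ) (hφ : (monicPhi α β b).Monic)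
    (hdeg : (monicPhi α β b).natDegree = l + l') {a : ℕ → ℂ}
    (ha : newton a (l + l') = monicPhi α β b)
    (hf : (betheAct α β b l).range = hL.symmAct.range) (I : Fin l ↪o Fin (l + l')) :
    HahnSeries.ofPowerSeries ℤ ℂ (PowerSeries.mk fun r =>
      hL.character hℓ hφ hdeg ha hf I (transferCoeff r)) =
      eigenvalueSer α β b (rootPoly a I) := by
  refine eigenvalueSer_eq α β b (fun i => a (I i)) _ (fun r hr => ?_) fun r => ?_
  · rw [hL.character_apply hℓ hφ hdeg ha hf I (s := 0) (by
      rw [betheAct_transferCoeff_of_lt α β b l hr, map_zero])]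
    simp
  · rw [hL.character_apply hℓ hφ hdeg ha hf I (s := vacCoeff α β b r • 1 -
      ∑ x ∈ Finset.HasAntidiagonal.antidiagonal r, zetaCoeff α β b x.1 • powerSum l x.2) (by
      rw [betheAct_transferCoeff α β b hα hb hk hL, map_sub, map_smul, map_one, map_sum]
      simp only [map_smul])]
    rw [Subalgebra.coe_sub, AddSubmonoidClass.coe_finsetSum, map_sub, map_sum]
    simp only [Subalgebra.coe_smul, Subalgebra.coe_one, powerSum,
      MvPolynomial.smul_eval, map_one, mul_one, MvPolynomial.psum, map_sum, map_pow,
      MvPolynomial.eval_X]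

end

theorem eq_X_pow_add_sum {p : Polynomial ℂ} (hp : p.Monic) {m : ℕ} (hm : p.natDegree = m) :
    p = Polynomial.X ^ m + ∑ i ∈ Finset.Icc 1 m,
      Polynomial.C ((-1) ^ i * ((-1) ^ i * p.coeff (m - i))) * Polynomial.X ^ (m - i) := by
  conv_lhs => rw [hp.as_sum, hm]
  congr 1
  refine (Finset.sum_bij (fun i _ => m - i) (fun i hi => ?_) (fun i hi j hj h => ?_)
    (fun j hj => ?_) fun i hi => ?_).symm
  · have := Finset.mem_Icc.1 hi
    exact Finset.mem_range.2 (by omega)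
  · have := Finset.mem_Icc.1 hi
    have := Finset.mem_Icc.1 hj
    omega
  · have := Finset.mem_range.1 hj
    exact ⟨m - j, Finset.mem_Icc.2 ⟨by omega, by omega⟩, by omega⟩
  · rw [← mul_assoc, ← mul_pow]
    simp

end Gaudin

end

/-! ### Assembly of the theorem -/

theorem theorem4p6 {k : ℕ} (α β : Fin k → ℕ) (hα : ∀ s, 0 < α s)
    (b : Fin k → ℂ) (hb : Function.Injective b) (l : ℕ) (hl : l < k) :
    -- (i) the algebra
    (∃ ε : ℕ → ℂ,
      Gaudin.phi α β b = Polynomial.C (∑ s, ((α s : ℂ) + β s)) *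
        (Polynomial.X ^ (k - 1) + ∑ i ∈ Finset.Icc 1 (k - 1),
          Polynomial.C ((-1) ^ i * ε i) * Polynomial.X ^ (k - 1 - i)) ∧
      Nonempty (Gaudin.betheImage α β b l ≃ₐ[ℂ]
        (Gaudin.invariants (k - 1) l ⧸ Gaudin.symmIdeal (k - 1) l ε))) ∧
    -- (ii) Frobenius, and the module is the regular representation
    Gaudin.IsFrobenius (Gaudin.betheImage α β b l) ∧
    Nonempty (Gaudin.M α β b l ≃ₗ[Gaudin.betheImage α β b l] Gaudin.betheImage α β b l) ∧
    -- (iii) maximal commutative, and the dimension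
    Maximal (fun A : Subalgebra ℂ (Module.End ℂ (Gaudin.M α β b l)) =>
      ∀ S ∈ A, ∀ T ∈ A, S * T = T * S) (Gaudin.betheImage α β b l) ∧
    Module.finrank ℂ (Gaudin.betheImage α β b l) = (k - 1).choose l ∧
    -- (iv) eigenspaces are lines
    (∀ χ : Gaudin.betheAlgebra →ₐ[ℂ] ℂ, Gaudin.eigenspace α β b l χ ≠ ⊥ →
      Module.finrank ℂ (Gaudin.eigenspace α β b l χ) = 1) ∧
    -- (vi) generalized eigenspaces are cyclic modules
    (∀ χ : Gaudin.betheAlgebra →ₐ[ℂ] ℂ, ∃ v : Gaudin.M α β b l, ∀ u : Gaudin.M α β b l,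
      u ∈ Gaudin.genEigenspace α β b l χ ↔
        ∃ X : Gaudin.betheAlgebra, Gaudin.betheAct α β b l X v = u) ∧
    -- (v) and (vii) `χ y` is the character of the eigenspace that corresponds to `y`
    ∃ χ : Polynomial ℂ → (Gaudin.betheAlgebra →ₐ[ℂ] ℂ),
      Set.BijOn (fun y => Gaudin.eigenspace α β b l (χ y))
        {y | y.Monic ∧ y.natDegree = l ∧ y ∣ Gaudin.phi α β b}
        {W | W ≠ ⊥ ∧ ∃ ψ : Gaudin.betheAlgebra →ₐ[ℂ] ℂ, W = Gaudin.eigenspace α β b l ψ} ∧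
      ∀ y : Polynomial ℂ, y.Monic → y.natDegree = l → y ∣ Gaudin.phi α β b →
        HahnSeries.ofPowerSeries ℤ ℂ
            (PowerSeries.mk fun r => χ y (Gaudin.transferCoeff r)) =
          Gaudin.eigenvalueSer α β b y ∧
        Module.finrank ℂ (Gaudin.genEigenspace α β b l (χ y)) =
          ∏ᶠ a : ℂ, ((Gaudin.phi α β b).rootMultiplicity a).choose (y.rootMultiplicity a) := by
  obtain ⟨l', hk⟩ : ∃ l', l + l' + 1 = k := ⟨k - 1 - l, by omega⟩
  have hk0 : 0 < k := by omega
  have hn := Gaudin.boxes_dot_one_ne_zero α β hα hk0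
  have hφ := Gaudin.monic_monicPhi α β b hn
  have hdeg : (Gaudin.monicPhi α β b).natDegree = l + l' := by
    rw [Gaudin.natDegree_monicPhi α β b hn]; omega
  have hL := Gaudin.isWedgeQuotient_singVec α β b hα hb hk0 hk
  obtain ⟨ω, hℓ⟩ := Gaudin.exists_isTopForm α β b hα hb hk
  have hf := Gaudin.range_betheAct α β b hα hb hk0 hL
  obtain ⟨a, ha⟩ := Gaudin.exists_newton_eq hφ
  rw [hdeg] at ha
  have hkm : k - 1 = l + l' := by omega
  have hsum : (∑ s, ((α s : ℂ) + β s)) = Gaudin.boxes α β ⬝ᵥ 1 := by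
    simp [dotProduct, Gaudin.boxes]
  have hphi := Gaudin.phi_eq α β b hn
  have hfd : FiniteDimensional ℂ (Gaudin.M α β b l) :=
    hL.finiteDimensional (Gaudin.newton a) (Gaudin.IsWedgeQuotient.dvd_newton ha)
  have hcomm := hL.commute_of_range_eq hf
  have hA : ∀ S ∈ Gaudin.betheImage α β b l, ∀ T ∈ Gaudin.betheImage α β b l,
      S * T = T * S := by
    rintro _ ⟨X, rfl⟩ _ ⟨Y, rfl⟩
    exact hcomm X Y
  obtain ⟨v₀, hv₀⟩ := hL.exists_cyclic_of_range_eq hf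
  have hv₀' : ∀ v, ∃ T ∈ Gaudin.betheImage α β b l, T v₀ = v := fun v => by
    obtain ⟨X, hX⟩ := hv₀ v
    exact ⟨_, ⟨X, rfl⟩, hX⟩
  obtain ⟨ξ, hξ⟩ := hL.exists_cocyclic_of_range_eq hf hℓ hφ hdeg
  rw [hkm]
  -- By Vieta, these are the elementary symmetric polynomials of the roots of `φ`.
  refine ⟨⟨fun i => (-1) ^ i * (Gaudin.monicPhi α β b).coeff (l + l' - i), ?_, ?_⟩,
    ?_, ?_, Gaudin.maximal_of_cyclic hv₀' hA, ?_,
    fun χ hχ => Gaudin.finrank_iInf_eigenspace hξ hχ,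
    fun χ => Gaudin.exists_cyclic_genEigenspace hcomm hv₀ χ, ?_⟩
  · rw [hsum, hphi, ← Gaudin.eq_X_pow_add_sum hφ hdeg]
  · rw [Gaudin.betheImage, hf]
    exact hL.nonempty_range_equiv hℓ hφ hdeg fun _ _ _ => rfl
  · exact Gaudin.isFrobenius_of_cyclic hv₀' hA fun v hv => hξ v fun X => hv _ ⟨X, rfl⟩
  · exact ⟨(Gaudin.regularEquiv hv₀' hA).symm⟩
  · rw [Gaudin.finrank_of_cyclic hv₀' hA, hL.finrank_eq_choose hℓ hφ hdeg]
  obtain ⟨χ, hbij, hχ⟩ := hL.exists_bijOn_eigenspace hf hℓ hφ hdeg ha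
  -- The two polynomials differ by the unit `n`, so they have the same divisors and, below, the same
  -- root multiplicities.
  have hdvd : ∀ y : Polynomial ℂ, y ∣ Gaudin.phi α β b ↔ y ∣ Gaudin.monicPhi α β b :=
    fun y => by rw [hphi, (Polynomial.isUnit_C.2 hn.isUnit).dvd_mul_left]
  refine ⟨χ, ?_, fun y h1 h2 h3 => ?_⟩
  · simp only [hdvd]
    exact hbij
  obtain ⟨I, rfl, hI⟩ := hχ y h1 h2 ((hdvd y).1 h3)
  rw [hI]
  constructor
  · exact Gaudin.eigenvalueSer_character α β b hα hb hk0 hL hℓ hφ hdeg ha hf I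
  · have hroots : ∀ x, (Gaudin.phi α β b).rootMultiplicity x =
        (Gaudin.monicPhi α β b).rootMultiplicity x := fun x => by
      rw [hphi, ← Polynomial.count_roots, ← Polynomial.count_roots, Polynomial.roots_C_mul _ hn]
    simp only [hroots]
    exact hL.finrank_genEigenspace_character hf hℓ hφ hdeg ha I
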